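/- **Setting.** Let $P_n(z)=\sum_{k=0}^n \xi_k a_{k;n}z^k$, where * (A1) $\xi_0,\xi_1,\dots$ are i.i.d. complex random variables, not almost surely constant, with $\mathbb E\log(1+|\xi_0|)<\infty$; * (A2) $a_{k;n}\in\mathbb C$ are deterministic and $\lim_{n\to\infty}\sup_{0\le k\le n}\left|\frac1n\log|a_{k;n}|-g(k/n)\right|=0$ (with $\log 0=-\infty$) for a continuous concave function $g:[0,1]\to\mathbb R$ with left derivative $g'_-(1)>-\infty$; * (A3) $g$ is $C^\infty$ on $(0,1)$ with $g''<0$ there, and if $g'(0):=\lim_{\alpha\downarrow0}g'(\alpha)=+\infty$, then $\lim_{\alpha\downarrow0}\alpha e^{g'(\alpha)}=0$. Put $g'(1):=\lim_{\alpha\uparrow1}g'(\alpha)$ and $P_n(z;t)=e^{-\frac{t}{2n}\partial_z^2}P_n(z)$. For a polynomial $P$ of degree $d\ge1$ let $[\![P]\!]$ be its empirical zero distribution (mass $1/d$ at each zero, counted with multiplicity); put $[\![P]\!]=0$ if $P$ is constant. For $z\neq0$ let $\alpha_0(z)$ be the unique maximizer of $\alpha\mapsto g(\alpha)+\alpha\log|z|$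 on $[0,1]$, and let $\alpha_0(0)=0$. Let $$t_{\rm sing}=\Big(\sup_{e^{-g'(0)}<s<e^{-g'(1)}}\big|(\alpha_0(s)/s)'\big|\Big)^{-1}\in[0,\infty],$$ $$T_t(w)=w+t\,\frac{\alpha_0(w)}{w}\quad(w\ne0),\qquad T_t(0)=0,$$ $$\mathcal E_{s,t}=\Big\{u+iv:\tfrac{u^2}{(s+t\alpha_0(s)/s)^2}+\tfrac{v^2}{(s-t\alpha_0(s)/s)^2}\le1\Big\},$$ $$\mathcal R_t=\Big\{u+iv: u^2+v^2>e^{-2g'(0)},\ \tfrac{u^2}{(e^{-g'(1)}+te^{g'(1)})^2}+\tfrac{v^2}{(e^{-g'(1)}-te^{g'(1)})^2}<1\Big\}.$$ With the branch $\sqrt{z^2-4}\sim z$ at infinity, cut along $[-2,2]$, let $$\Psi(z)=\tfrac14\mathrm{Re}\big(z^2-z\sqrt{z^2-4}\big)+\log\Big|\tfrac{z+\sqrt{z^2-4}}2\Big|-\tfrac12,$$ $$f_t(\alpha,z)=g(\alpha)+\alpha\log\sqrt{t\alpha}+\alpha\Psi\big(z/\sqrt{t\alpha}\big)\ (0<\alpha\le1),\qquad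 f_t(0,z)=g(0),$$ $$U_t(z)=\sup_{\alpha\in[0,1]}f_t(\alpha,z)-g(1)\ (t>0),\qquad U_0(z)=\sup_{\alpha\in[0,1]}\big(g(\alpha)+\alpha\log|z|\big)-g(1)\ (z\neq0).$$ **Theorem.** Assume (A1)–(A3) and $0<t<t_{\rm sing}$. The random measures $[\![P_n]\!]$ and $[\![P_n(\cdot\,;t)]\!]$ converge weakly in probability, as $n\to\infty$, to deterministic probability measures $\nu_0$ and $\nu_t$ on $\mathbb C$, with the following properties. (a) $\nu_t=(T_t)_\#\nu_0$. Moreover $\nu_t(\mathbb C\setminus\mathcal R_t)=0$, and $\nu_t(\mathcal E_{s,t})=\alpha_0(s)$ for all $s>0$. (b) $\nu_t$ has a globally bounded Lebesgue density. (c) The Stieltjes transform $m_t(z)=\int_{\mathbb C}\frac{\nu_t(dy)}{z-y}$ converges absolutely for all $z\in\mathbb C$ and is continuous on $\mathbb C$. For all $w\ne0$, $$m_t(T_t(w))=m_0(w)=\frac{\alpha_0(w)}{w}=\frac{\partial}{\partial t}T_t(w),$$ where $m_0(w)=\int_{\mathbb C}\frac{\nu_0(dy)}{w-y}$ converges absolutely.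 (d) For every $z\in\mathcal R_t$ the function $\alpha\mapsto f_t(\alpha,z)$ on $[0,1]$ has a unique maximizer $\alpha_t(z)$, and it lies in $(0,1)$. For every $w\in\mathbb C$ the function $\alpha\mapsto f_t(\alpha,T_t(w))$ has a unique maximizer $\alpha_t(T_t(w))$, and $\alpha_t(T_t(w))=\alpha_0(w)$. (e) $U_t$ is the logarithmic potential of $\nu_t$, that is $U_t(z)=\int_{\mathbb C}\log|z-y|\,\nu_t(dy)$ with absolute convergence for all $z\in\mathbb C$; likewise $U_0(w)=\int_{\mathbb C}\log|w-y|\,\nu_0(dy)$ for all $w\ne0$. The function $U_t$ is real continuously differentiable on $\mathbb C$, and for all $w\ne0$ $$U_t(T_t(w))=U_0(w)+\frac{\alpha_0(w)^2}{2}\,\mathrm{Re}\Big(\frac{t}{w^2}\Big).$$ -/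

import Mathlib

open MeasureTheory ProbabilityTheory Filter Topology Set
open scoped ENNReal

namespace HeatFlowZeros

/-! ### Assumptions on the random polynomials -/

/-- The coefficients `ξ 0, ξ 1, …` are i.i.d. complex random variables, not almost surely constant,
with `E log (1 + |ξ 0|) < ∞`. -/
structure RandomCoeffs {Ω : Type*} [MeasurableSpace Ω] (P : Measure Ω) (ξ : ℕ → Ω → ℂ) :
    Prop where
  measurable : ∀ k, Measurable (ξ k)
  indep : iIndepFun ξ P
  identDistrib : ∀ k, IdentDistrib (ξ k) (ξ 0) P P
  nondegenerate : ¬ ∃ c : ℂ, ∀ᵐ ω ∂P, ξ 0 ω = c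
  logMoment : Integrable (fun ω => Real.log (1 + ‖ξ 0 ω‖)) P

/-- The deterministic weights `a n k` (for `k ≤ n`) have the exponential profile `g`, which is a
continuous concave function on `[0, 1]` whose left derivative at `1` is not `-∞`. In `profile` the
convention is `log 0 = -∞`, whence `a n k ≠ 0` for large `n`. -/
structure ExponentialProfile (a : ℕ → ℕ → ℂ) (g : ℝ → ℝ) : Prop where
  continuousOn : ContinuousOn g (Icc 0 1)
  profile : ∀ ε : ℝ, 0 < ε → ∀ᶠ n : ℕ in atTop, ∀ k : ℕ, k ≤ n →
    a n k ≠ 0 ∧ |1 / (n : ℝ) * Real.log ‖a n k‖ - g ((k : ℝ) / (n : ℝ))| ≤ ε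
  concaveOn : ConcaveOn ℝ (Icc 0 1) g
  leftDeriv_one : DifferentiableWithinAt ℝ g (Iio 1) 1

/-- `g` is smooth on `(0, 1)` with `g'' < 0` there, and if `g'(0+) = +∞` then
`α exp (g' α) → 0` as `α ↓ 0`. -/
structure SmoothProfile (g : ℝ → ℝ) : Prop where
  contDiffOn : ContDiffOn ℝ (⊤ : ℕ∞) g (Ioo 0 1)
  deriv2_neg : ∀ α ∈ Ioo (0 : ℝ) 1, deriv (deriv g) α < 0
  tendsto_zero : Tendsto (deriv g) (𝓝[>] 0) atTop →
    Tendsto (fun α : ℝ => α * Real.exp (deriv g α)) (𝓝[>] 0) (𝓝 0)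

/-! ### Random polynomials, heat flow, zeros -/

/-- The random polynomial `P_n(z) = ∑_{k ≤ n} ξ_k a_{k;n} z^k`, for one realisation `x` of `ξ`. -/
noncomputable def randomPoly (x : ℕ → ℂ) (a : ℕ → ℕ → ℂ) (n : ℕ) : Polynomial ℂ :=
  ∑ k ∈ Finset.range (n + 1), Polynomial.C (x k * a n k) * Polynomial.X ^ k

/-- `exp (-(s/2) ∂²) p`; the series terminates, all terms with `2 j > deg p` being zero. -/
noncomputable def heatFlow (s : ℂ) (p : Polynomial ℂ) : Polynomial ℂ :=
  ∑ j ∈ Finset.range (p.natDegree + 1),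
    Polynomial.C (1 / (j.factorial : ℂ) * (-s / 2) ^ j) * Polynomial.derivative^[2 * j] p

/-- Empirical distribution of the zeros (with multiplicity) of `p`; it is `0` for constant `p`. -/
noncomputable def zeroMeasure (p : Polynomial ℂ) : Measure ℂ :=
  ((p.natDegree : ℝ≥0∞)⁻¹) • (p.roots.map (fun z => Measure.dirac z)).sum

/-- Empirical zero distribution of the heat-evolved random polynomial `exp (-(t/2n) ∂²) P_n`. -/
noncomputable def evolvedZeros (x : ℕ → ℂ) (a : ℕ → ℕ → ℂ) (t : ℝ) (n : ℕ) : Measure ℂ :=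
  zeroMeasure (heatFlow ((t : ℂ) / (n : ℂ)) (randomPoly x a n))

/-- Weak convergence in probability of random finite measures on `ℂ` to a deterministic one. -/
def TendstoWeaklyInProbability {Ω : Type*} [MeasurableSpace Ω] (P : Measure Ω)
    (μ : ℕ → Ω → Measure ℂ) (ν : Measure ℂ) : Prop :=
  ∀ f : BoundedContinuousFunction ℂ ℝ,
    TendstoInMeasure P (fun n ω => ∫ z, f z ∂(μ n ω)) atTop (fun _ => ∫ z, f z ∂ν)

/-! ### Maximisers over `[0, 1]` -/

/-- `α` is the unique maximiser of `φ` on `[0, 1]`. -/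
def IsUniqueMaximizer (φ : ℝ → ℝ) (α : ℝ) : Prop :=
  α ∈ Icc (0 : ℝ) 1 ∧ ∀ β ∈ Icc (0 : ℝ) 1, β ≠ α → φ β < φ α

/-- A maximiser of `φ` on `[0, 1]`. -/
noncomputable def argmaxUnit (φ : ℝ → ℝ) : ℝ :=
  Classical.epsilon fun α => α ∈ Icc (0 : ℝ) 1 ∧ IsMaxOn φ (Icc 0 1) α

/-- The maximiser `α₀(z)` of `α ↦ g α + α log |z|` on `[0, 1]`, where `log 0 = -∞`. -/
noncomputable def alphaZero (g : ℝ → ℝ) (z : ℂ) : ℝ :=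
  if z = 0 then 0 else argmaxUnit fun α => g α + α * Real.log ‖z‖

/-! ### The transport map and the critical time -/

/-- `exp (-g'(0+))`, a finite number also when `g'(0+) = +∞`. -/
noncomputable def innerRadius (g : ℝ → ℝ) : ℝ :=
  limUnder (𝓝[>] (0 : ℝ)) fun α => Real.exp (-deriv g α)

/-- `exp (-g'(1-))`. -/
noncomputable def outerRadius (g : ℝ → ℝ) : ℝ :=
  limUnder (𝓝[<] (1 : ℝ)) fun α => Real.exp (-deriv g α)

/-- The critical time: the inverse, in `[0, ∞]`, of the supremum of `|(α₀(s)/s)'|` over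
`innerRadius g < s < outerRadius g`. -/
noncomputable def tSing (g : ℝ → ℝ) : ℝ≥0∞ :=
  (⨆ s ∈ Ioo (innerRadius g) (outerRadius g),
    ENNReal.ofReal |deriv (fun r : ℝ => alphaZero g (r : ℂ) / r) s|)⁻¹

/-- The transport map `T_t(w) = w + t α₀(w) / w`; the value at `0` is `0`. -/
noncomputable def transport (g : ℝ → ℝ) (t : ℝ) (w : ℂ) : ℂ :=
  w + (t : ℂ) * ((alphaZero g w : ℂ) / w)

/-- The closed solid ellipse with half-axes `s + t α₀(s)/s` and `s - t α₀(s)/s`. -/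
def ellipse (g : ℝ → ℝ) (s t : ℝ) : Set ℂ :=
  {z | z.re ^ 2 / (s + t * (alphaZero g (s : ℂ) / s)) ^ 2
      + z.im ^ 2 / (s - t * (alphaZero g (s : ℂ) / s)) ^ 2 ≤ 1}

/-- The domain between the circle of radius `exp (-g'(0+))` and the ellipse with half-axes
`exp (-g'(1-)) ± t exp (g'(1-))`. -/
def domain (g : ℝ → ℝ) (t : ℝ) : Set ℂ :=
  {z | innerRadius g ^ 2 < z.re ^ 2 + z.im ^ 2 ∧
    z.re ^ 2 / (outerRadius g + t * (outerRadius g)⁻¹) ^ 2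
      + z.im ^ 2 / (outerRadius g - t * (outerRadius g)⁻¹) ^ 2 < 1}

/-! ### Potentials and Stieltjes transforms -/

/-- The branch of `√(z² - 4)` that is holomorphic off `[-2, 2]` and `∼ z` at infinity, as the
product of the principal branches of `√(z - 2)` and `√(z + 2)`. -/
noncomputable def sqrtBranch (z : ℂ) : ℂ :=
  (z - 2) ^ (1 / 2 : ℂ) * (z + 2) ^ (1 / 2 : ℂ)

/-- The function `Ψ`, the logarithmic potential of the semicircle law. -/
noncomputable def Psi (z : ℂ) : ℝ :=
  1 / 4 * (z ^ 2 - z * sqrtBranch z).re + Real.log ‖(z + sqrtBranch z) / 2‖ - 1 / 2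

/-- `f_t(α, z) = g α + α log √(t α) + α Ψ(z / √(t α))`, and `f_t(0, z) = g 0`. -/
noncomputable def fT (g : ℝ → ℝ) (t α : ℝ) (z : ℂ) : ℝ :=
  if α = 0 then g 0 else
    g α + α * Real.log (Real.sqrt (t * α)) + α * Psi (z / (Real.sqrt (t * α) : ℂ))

/-- A maximiser `α_t(z)` of `α ↦ f_t(α, z)` on `[0, 1]`. -/
noncomputable def alphaT (g : ℝ → ℝ) (t : ℝ) (z : ℂ) : ℝ :=
  argmaxUnit fun α => fT g t α z

/-- `U_0(z) = sup_{0 ≤ α ≤ 1} (g α + α log |z|) - g 1`, for `z ≠ 0`. -/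
noncomputable def UZero (g : ℝ → ℝ) (z : ℂ) : ℝ :=
  (⨆ α : Icc (0 : ℝ) 1, (g α + α * Real.log ‖z‖)) - g 1

/-- `U_t(z) = sup_{0 ≤ α ≤ 1} f_t(α, z) - g 1`, for `t > 0`. -/
noncomputable def UT (g : ℝ → ℝ) (t : ℝ) (z : ℂ) : ℝ :=
  (⨆ α : Icc (0 : ℝ) 1, fT g t α z) - g 1

/-- `u` is the logarithmic potential of `ν` at `z` (as a convergent integral). -/
def HasLogPotentialAt (ν : Measure ℂ) (u : ℝ) (z : ℂ) : Prop :=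
  Integrable (fun y => Real.log ‖z - y‖) ν ∧ ∫ y, Real.log ‖z - y‖ ∂ν = u

/-- The Stieltjes transform of `ν`. -/
noncomputable def stieltjes (ν : Measure ℂ) (z : ℂ) : ℂ := ∫ y, 1 / (z - y) ∂ν

end HeatFlowZeros

open HeatFlowZeros

namespace HeatFlowZeros

/-! ### Unique maximizers -/

/-! Everything is organised by the level `α`. Since `g'' < 0`, `radius g α = exp (-g' α)` is
strictly increasing, and `α₀` is its inverse, constant outside the annulus. The rotation invariant
measure `ν₀` with radial distribution function `α₀` is parametrised by a uniform level and a uniform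
angle.

Below the critical time, `α₀(s)/s` has Lipschitz constant `L` with `t L < 1` (`exists_isSlopeBound`,
`abs_ratio_sub_le`). In polar coordinates the bound passes to `w ↦ α₀(w)/w` on the plane
(`norm_alphaZero_div_sub_le`). Thus `T_t` is the identity plus a contraction: a bi-Lipschitz
bijection that carries concentric circles to nested ellipses. Bounded density survives the
push-forward.

For fixed `α` put `τ = t α` and let `ω` be the larger root of `ω (z - ω) = τ`, the inverse Joukowski
map. Then `f_t(α, z) = g α + rate α z ω` (`fT_eq`), and the derivative of the rate in `α` is just
`log |ω|` (`hasDerivAt_rate`). So `∂_α f_t = log (|ω| / radius α)`. The circle of radius `radius α`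
has the same image under `ω ↦ ω + τ/ω` and under `T_t`; hence the sign of this derivative at `z =
T_t(w)` tells whether `α < α₀(w)` (`norm_outerRoot_cmp`). This gives the unique maximizer `α₀(w)`.

By Jensen's formula the level `α` contributes `log max (radius α) |ω|` to the potential of `ν_t`.
Integrating over `α`, split at `α₀(w)`, yields `f_t(α₀(w), z) - g 1 = U_t(z)` (`logPotential_nuT`).
Each fixed level bounds the potential from below, with equality at its own ellipse, so gradients
agree there; this envelope argument gives the Stieltjes transform (`stieltjes_nuT`).

For the zeros, the heat flow turns `z^k` into a Hermite polynomial. Cauchy's formula with its saddle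
placed at `u = 1` shows that its size is `exp (n rate)` up to subexponential factors
(`norm_eval_hermiteFlow`). The logarithmic moment bounds the random polynomial from above by `exp (n
(U_t + g 1 + o(1)))`. For the lower bound at a non-real point, there are arbitrarily many degrees
whose terms have nearly maximal and mutually different exponential sizes; each lowers the
concentration of the sum by a fixed factor (`eventually_concentration_le`). Upper bounds everywhere
and lower bounds on a finite net determine circle-averaged potentials up to a constant. Differences
of such averages are integrals of bumps, and these approximate test functions
(`exists_zeroMeasure_close`). Time zero is covered by the same argument. -/

theorem IsUniqueMaximizer.argmaxUnit_eq {φ : ℝ → ℝ} {α : ℝ} (h : IsUniqueMaximizer φ α) :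
    argmaxUnit φ = α := by
  have hex : ∃ α, α ∈ Icc (0 : ℝ) 1 ∧ IsMaxOn φ (Icc 0 1) α :=
    ⟨α, h.1, fun β hβ => by
      by_cases hb : β = α
      · simp [hb]
      · exact (h.2 β hβ hb).le⟩
  obtain ⟨h1, h2⟩ := Classical.epsilon_spec hex
  by_contra hne
  exact absurd (h2 h.1) (not_le.2 (h.2 _ h1 hne))

theorem isUniqueMaximizer_of_monotone {φ : ℝ → ℝ} {m : ℝ} (hm : m ∈ Icc (0 : ℝ) 1)
    (h1 : StrictMonoOn φ (Icc 0 m)) (h2 : StrictAntiOn φ (Icc m 1)) : IsUniqueMaximizer φ m := by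
  refine ⟨hm, fun β hβ hne => ?_⟩
  rcases lt_or_gt_of_ne hne with h | h
  · exact h1 ⟨hβ.1, h.le⟩ ⟨hm.1, le_rfl⟩ h
  · exact h2 ⟨le_rfl, hm.2⟩ ⟨h.le, hβ.2⟩ h

theorem IsUniqueMaximizer.iSup_eq {φ : ℝ → ℝ} {α : ℝ} (h : IsUniqueMaximizer φ α) :
    ⨆ β : Icc (0 : ℝ) 1, φ β = φ α := by
  have hle : ∀ β : Icc (0 : ℝ) 1, φ β ≤ φ α := fun β => by
    by_cases hb : (β : ℝ) = α
    · rw [hb]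
    · exact (h.2 β β.2 hb).le
  have : Nonempty (Icc (0 : ℝ) 1) := ⟨⟨α, h.1⟩⟩
  exact le_antisymm (ciSup_le hle) (le_ciSup (f := fun β : Icc (0 : ℝ) 1 => φ β)
    ⟨φ α, by rintro _ ⟨β, rfl⟩; exact hle β⟩ ⟨α, h.1⟩)

theorem IsUniqueMaximizer.le {φ : ℝ → ℝ} {α : ℝ} (h : IsUniqueMaximizer φ α) {β : ℝ}
    (hβ : β ∈ Icc (0 : ℝ) 1) : φ β ≤ φ α := by
  by_cases hb : β = α
  · rw [hb]
  · exact (h.2 β hβ hb).le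

/-! ### Profiles -/

/-- The analytic assumptions on the exponential profile `g`. -/
structure IsProfile (g : ℝ → ℝ) : Prop where
  continuousOn : ContinuousOn g (Icc 0 1)
  concaveOn : ConcaveOn ℝ (Icc 0 1) g
  leftDeriv_one : DifferentiableWithinAt ℝ g (Iio 1) 1
  smooth : SmoothProfile g

/-- The radius `exp (-g' α)` at which the mass of the limiting zero distribution equals `α`. -/
noncomputable def radius (g : ℝ → ℝ) (α : ℝ) : ℝ := Real.exp (-deriv g α)

theorem radius_pos (g : ℝ → ℝ) (α : ℝ) : 0 < radius g α := Real.exp_pos _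

theorem log_radius (g : ℝ → ℝ) (α : ℝ) : Real.log (radius g α) = -deriv g α := Real.log_exp _

theorem measurable_radius (g : ℝ → ℝ) : Measurable (radius g) :=
  Real.measurable_exp.comp (measurable_deriv g).neg

namespace IsProfile

variable {g : ℝ → ℝ}

theorem hasDerivAt (hg : IsProfile g) {α : ℝ} (hα : α ∈ Ioo (0 : ℝ) 1) :
    HasDerivAt g (deriv g α) α :=
  ((hg.smooth.contDiffOn.differentiableOn (by simp)).differentiableAt
    (isOpen_Ioo.mem_nhds hα)).hasDerivAt

theorem hasDerivAt_deriv (hg : IsProfile g) {α : ℝ} (hα : α ∈ Ioo (0 : ℝ) 1) :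
    HasDerivAt (deriv g) (deriv (deriv g) α) α := by
  have h : ContDiffOn ℝ 1 (deriv g) (Ioo 0 1) :=
    hg.smooth.contDiffOn.deriv_of_isOpen isOpen_Ioo (by
      change ((1 : ℕ∞) : WithTop ℕ∞) + ((1 : ℕ∞) : WithTop ℕ∞) ≤ _
      rw [← WithTop.coe_add]; exact WithTop.coe_le_coe.2 le_top)
  exact ((h.differentiableOn one_ne_zero).differentiableAt (isOpen_Ioo.mem_nhds hα)).hasDerivAt

theorem hasDerivAt_radius (hg : IsProfile g) {α : ℝ} (hα : α ∈ Ioo (0 : ℝ) 1) :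
    HasDerivAt (radius g) (radius g α * -deriv (deriv g) α) α :=
  (hg.hasDerivAt_deriv hα).neg.exp

theorem deriv_radius_pos (hg : IsProfile g) {α : ℝ} (hα : α ∈ Ioo (0 : ℝ) 1) :
    0 < radius g α * -deriv (deriv g) α :=
  mul_pos (radius_pos g α) (neg_pos.2 (hg.smooth.deriv2_neg α hα))

theorem continuousAt_radius (hg : IsProfile g) {α : ℝ} (hα : α ∈ Ioo (0 : ℝ) 1) :
    ContinuousAt (radius g) α := (hg.hasDerivAt_radius hα).continuousAt

theorem strictMonoOn_radius (hg : IsProfile g) : StrictMonoOn (radius g) (Ioo 0 1) :=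
  strictMonoOn_of_deriv_pos (convex_Ioo 0 1)
    (fun α hα => (hg.continuousAt_radius hα).continuousWithinAt)
    (fun α hα => by
      rw [interior_Ioo] at hα
      rw [(hg.hasDerivAt_radius hα).deriv]
      exact hg.deriv_radius_pos hα)

/-- By concavity the tangent slope at `α` dominates the chord slopes from `α` to `β` and from `β` to
`1`, and the latter tend to the left derivative at `1`. This is what makes the outer radius finite.
-/
theorem exists_deriv_ge (hg : IsProfile g) : ∃ d : ℝ, ∀ α ∈ Ioo (0 : ℝ) 1, d ≤ deriv g α := by
  refine ⟨derivWithin g (Iio 1) 1, fun α hα => ?_⟩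
  have h := hg.leftDeriv_one.hasDerivWithinAt
  rw [hasDerivWithinAt_iff_tendsto_slope] at h
  have hs : Iio (1 : ℝ) \ {1} = Iio 1 := by ext; simp
  rw [hs] at h
  refine le_of_tendsto h ?_
  have : Ioo α 1 ∈ 𝓝[<] (1 : ℝ) := Ioo_mem_nhdsLT hα.2
  filter_upwards [this] with β hβ
  have := hg.concaveOn.slope_le_of_hasDerivAt (x := α) (y := β) ⟨hα.1.le, hα.2.le⟩
    ⟨hα.1.le.trans hβ.1.le, hβ.2.le⟩ hβ.1 (hg.hasDerivAt hα)
  have h3 := hg.concaveOn.slope_anti (x := β) ⟨hα.1.le.trans hβ.1.le, hβ.2.le⟩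
    (a := α) (b := 1) ⟨⟨hα.1.le, hα.2.le⟩, by simpa using hβ.1.ne⟩
    ⟨⟨zero_le_one, le_rfl⟩, by simpa using hβ.2.ne'⟩ hα.2.le
  rw [slope_comm, slope_comm g 1 β] at *
  linarith

theorem exists_radius_le (hg : IsProfile g) : ∃ R : ℝ, 0 < R ∧ ∀ α ∈ Ioo (0 : ℝ) 1, radius g α ≤ R := by
  obtain ⟨d, hd⟩ := hg.exists_deriv_ge
  exact ⟨Real.exp (-d), Real.exp_pos _, fun α hα => Real.exp_le_exp.2 (neg_le_neg (hd α hα))⟩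

/-- `outerRadius` is a `limUnder` and means something only once a limit is known to exist; here a
bounded monotone function provides it. -/
theorem tendsto_radius_one (hg : IsProfile g) :
    Tendsto (radius g) (𝓝[<] 1) (𝓝 (outerRadius g)) := by
  obtain ⟨R, -, hR⟩ := hg.exists_radius_le
  have h := hg.strictMonoOn_radius.monotoneOn.tendsto_nhdsWithin_Ioo_left
    (by simp : (Ioo (0 : ℝ) 1).Nonempty) ⟨R, by rintro _ ⟨α, hα, rfl⟩; exact hR α hα⟩
  exact tendsto_nhds_limUnder ⟨_, h⟩

theorem tendsto_radius_zero (hg : IsProfile g) :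
    Tendsto (radius g) (𝓝[>] 0) (𝓝 (innerRadius g)) := by
  have h := hg.strictMonoOn_radius.monotoneOn.tendsto_nhdsWithin_Ioo_right
    (by simp : (Ioo (0 : ℝ) 1).Nonempty) ⟨0, by rintro _ ⟨α, hα, rfl⟩; exact (radius_pos g α).le⟩
  exact tendsto_nhds_limUnder ⟨_, h⟩

theorem radius_lt_outerRadius (hg : IsProfile g) {α : ℝ} (hα : α ∈ Ioo (0 : ℝ) 1) :
    radius g α < outerRadius g := by
  obtain ⟨β, hβ⟩ := exists_between hα.2
  have hβ' : β ∈ Ioo (0 : ℝ) 1 := ⟨hα.1.trans hβ.1, hβ.2⟩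
  refine (hg.strictMonoOn_radius hα hβ' hβ.1).trans_le (ge_of_tendsto hg.tendsto_radius_one ?_)
  filter_upwards [Ioo_mem_nhdsLT hβ.2] with γ hγ
  exact (hg.strictMonoOn_radius hβ' ⟨hβ'.1.trans hγ.1, hγ.2⟩ hγ.1).le

theorem innerRadius_lt_radius (hg : IsProfile g) {α : ℝ} (hα : α ∈ Ioo (0 : ℝ) 1) :
    innerRadius g < radius g α := by
  obtain ⟨β, hβ⟩ := exists_between hα.1
  have hβ' : β ∈ Ioo (0 : ℝ) 1 := ⟨hβ.1, hβ.2.trans hα.2⟩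
  refine (le_of_tendsto hg.tendsto_radius_zero ?_).trans_lt (hg.strictMonoOn_radius hβ' hα hβ.2)
  filter_upwards [Ioo_mem_nhdsGT hβ.1] with γ hγ
  exact (hg.strictMonoOn_radius ⟨hγ.1, hγ.2.trans hβ'.2⟩ hβ' hγ.2).le

theorem innerRadius_nonneg (hg : IsProfile g) : 0 ≤ innerRadius g :=
  ge_of_tendsto' hg.tendsto_radius_zero fun α => (radius_pos g α).le

theorem innerRadius_lt_outerRadius (hg : IsProfile g) : innerRadius g < outerRadius g :=
  (hg.innerRadius_lt_radius (α := 1 / 2) (by norm_num)).trans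
    (hg.radius_lt_outerRadius (by norm_num))

theorem outerRadius_pos (hg : IsProfile g) : 0 < outerRadius g :=
  hg.innerRadius_nonneg.trans_lt hg.innerRadius_lt_outerRadius

theorem exists_radius_eq (hg : IsProfile g) {s : ℝ} (hs : s ∈ Ioo (innerRadius g) (outerRadius g)) :
    ∃ α ∈ Ioo (0 : ℝ) 1, radius g α = s := by
  obtain ⟨a, ha, ha'⟩ := ((hg.tendsto_radius_zero.eventually_lt_const hs.1).and
    (Ioo_mem_nhdsGT (zero_lt_one (α := ℝ)))).exists
  obtain ⟨b, hb, hb'⟩ := ((hg.tendsto_radius_one.eventually_const_lt hs.2).and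
    (Ioo_mem_nhdsLT (zero_lt_one (α := ℝ)))).exists
  have hab : a < b := (hg.strictMonoOn_radius.lt_iff_lt ha' hb').1 (ha.trans hb)
  obtain ⟨c, hc, hcs⟩ := intermediate_value_Ioo hab.le (f := radius g) (fun x hx =>
    (hg.continuousAt_radius ⟨ha'.1.trans_le hx.1, hx.2.trans_lt hb'.2⟩).continuousWithinAt) ⟨ha, hb⟩
  exact ⟨c, ⟨ha'.1.trans hc.1, hc.2.trans hb'.2⟩, hcs⟩

/-- The maximizer for `g α + α log s`, characterised by `radius`. -/
theorem exists_isUniqueMaximizer (hg : IsProfile g) {s : ℝ} (hs : 0 < s) :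
    ∃ m, IsUniqueMaximizer (fun α => g α + α * Real.log s) m ∧
      (∀ α ∈ Ioo (0 : ℝ) 1, α < m ↔ radius g α < s) ∧
      (∀ α ∈ Ioo (0 : ℝ) 1, m < α ↔ s < radius g α) := by
  -- The point `0` is added so that the supremum lies in `[0, 1]` even when no radius is below `s`.
  set S : Set ℝ := insert 0 {β ∈ Ioo (0 : ℝ) 1 | radius g β < s} with hS
  have hne : S.Nonempty := ⟨0, mem_insert _ _⟩
  have hbdd : BddAbove S := ⟨1, by
    rintro x (rfl | hx)
    · exact zero_le_one
    · exact hx.1.2.le⟩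
  set m := sSup S with hmdef
  have hm0 : 0 ≤ m := le_csSup hbdd (mem_insert _ _)
  have hm1 : m ≤ 1 := csSup_le hne (by
    rintro x (rfl | hx)
    · exact zero_le_one
    · exact hx.1.2.le)
  have hlt : ∀ α ∈ Ioo (0 : ℝ) 1, α < m → radius g α < s := fun α hα h => by
    obtain ⟨x, hx, hαx⟩ := exists_lt_of_lt_csSup hne h
    rcases hx with rfl | hx
    · exact absurd hαx (not_lt.2 hα.1.le)
    · exact (hg.strictMonoOn_radius hα hx.1 hαx).trans hx.2
  have hge : ∀ α ∈ Ioo (0 : ℝ) 1, radius g α < s → α ≤ m := fun α hα h =>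
    le_csSup hbdd (Or.inr ⟨hα, h⟩)
  have h1 : ∀ α ∈ Ioo (0 : ℝ) 1, α < m ↔ radius g α < s := fun α hα => by
    refine ⟨hlt α hα, fun h => ?_⟩
    have : ∀ᶠ β in 𝓝[>] α, radius g β < s :=
      ((hg.continuousAt_radius hα).eventually_lt_const h).filter_mono nhdsWithin_le_nhds
    obtain ⟨β, hβ, hβ'⟩ := (this.and (Ioo_mem_nhdsGT hα.2)).exists
    exact hβ'.1.trans_le (hge β ⟨hα.1.trans hβ'.1, hβ'.2⟩ hβ)
  have h2 : ∀ α ∈ Ioo (0 : ℝ) 1, m < α ↔ s < radius g α := fun α hα => by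
    constructor
    · intro h
      obtain ⟨β, hβ1, hβ2⟩ := exists_between h
      have hβ : β ∈ Ioo (0 : ℝ) 1 := ⟨hm0.trans_lt hβ1, hβ2.trans hα.2⟩
      have := mt (hge β hβ) (not_le.2 hβ1)
      exact (not_lt.1 this).trans_lt (hg.strictMonoOn_radius hβ hα hβ2)
    · intro h
      have : ∀ᶠ β in 𝓝[<] α, s < radius g β :=
        ((hg.continuousAt_radius hα).eventually_const_lt h).filter_mono nhdsWithin_le_nhds
      obtain ⟨β, hβ, hβ'⟩ := (this.and (Ioo_mem_nhdsLT hα.1)).exists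
      by_contra hcon
      exact absurd (hlt β ⟨hβ'.1, hβ'.2.trans hα.2⟩ (hβ'.2.trans_le (not_lt.1 hcon)))
        (not_lt.2 hβ.le)
  have hderiv : ∀ α ∈ Ioo (0 : ℝ) 1,
      HasDerivAt (fun α => g α + α * Real.log s) (deriv g α + Real.log s) α := fun α hα => by
    have := (hg.hasDerivAt hα).fun_add ((hasDerivAt_id' α).mul_const (Real.log s))
    rwa [one_mul] at this
  have hcont : ContinuousOn (fun α => g α + α * Real.log s) (Icc 0 1) :=
    hg.continuousOn.add (by fun_prop)
  refine ⟨m, isUniqueMaximizer_of_monotone ⟨hm0, hm1⟩ ?_ ?_, h1, h2⟩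
  · refine strictMonoOn_of_deriv_pos (convex_Icc _ _) (hcont.mono (Icc_subset_Icc le_rfl hm1)) ?_
    intro α hα
    rw [interior_Icc] at hα
    have hα' : α ∈ Ioo (0 : ℝ) 1 := ⟨hα.1, hα.2.trans_le hm1⟩
    rw [(hderiv α hα').deriv]
    have := Real.log_lt_log (radius_pos g α) ((h1 α hα').1 hα.2)
    rw [log_radius] at this
    linarith
  · refine strictAntiOn_of_deriv_neg (convex_Icc _ _) (hcont.mono (Icc_subset_Icc hm0 le_rfl)) ?_
    intro α hα
    rw [interior_Icc] at hα
    have hα' : α ∈ Ioo (0 : ℝ) 1 := ⟨hm0.trans_lt hα.1, hα.2⟩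
    rw [(hderiv α hα').deriv]
    have := Real.log_lt_log hs ((h2 α hα').1 hα.1)
    rw [log_radius] at this
    linarith

theorem isUniqueMaximizer_alphaZero (hg : IsProfile g) {w : ℂ} (hw : w ≠ 0) :
    IsUniqueMaximizer (fun α => g α + α * Real.log ‖w‖) (alphaZero g w) := by
  obtain ⟨m, hm, -⟩ := hg.exists_isUniqueMaximizer (norm_pos_iff.2 hw)
  rw [alphaZero, if_neg hw, hm.argmaxUnit_eq]
  exact hm

/-- Together with `alphaZero_lt_iff` this expresses that `α₀` inverts `radius`, plateaus and the
point `w = 0` included. Continuity and the values of `α₀` are read off from these two equivalences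
rather than from the maximization. -/
theorem lt_alphaZero_iff (hg : IsProfile g) (w : ℂ) {α : ℝ} (hα : α ∈ Ioo (0 : ℝ) 1) :
    α < alphaZero g w ↔ radius g α < ‖w‖ := by
  by_cases hw : w = 0
  · simp only [hw, alphaZero, if_true, norm_zero]
    exact iff_of_false (not_lt.2 hα.1.le) (not_lt.2 (radius_pos g α).le)
  · obtain ⟨m, hm, h1, -⟩ := hg.exists_isUniqueMaximizer (norm_pos_iff.2 hw)
    rw [alphaZero, if_neg hw, hm.argmaxUnit_eq]
    exact h1 α hα

theorem alphaZero_lt_iff (hg : IsProfile g) (w : ℂ) {α : ℝ} (hα : α ∈ Ioo (0 : ℝ) 1) :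
    alphaZero g w < α ↔ ‖w‖ < radius g α := by
  by_cases hw : w = 0
  · simp [hw, alphaZero, hα.1, radius_pos g α]
  · obtain ⟨m, hm, -, h1⟩ := hg.exists_isUniqueMaximizer (norm_pos_iff.2 hw)
    rw [alphaZero, if_neg hw, hm.argmaxUnit_eq]
    exact h1 α hα

theorem alphaZero_mem (hg : IsProfile g) (w : ℂ) : alphaZero g w ∈ Icc (0 : ℝ) 1 := by
  by_cases hw : w = 0
  · simp [alphaZero, hw]
  · exact (hg.isUniqueMaximizer_alphaZero hw).1

end IsProfile

@[simp] theorem alphaZero_zero (g : ℝ → ℝ) : alphaZero g 0 = 0 := by simp [alphaZero]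

theorem alphaZero_norm (g : ℝ → ℝ) (w : ℂ) : alphaZero g (‖w‖ : ℂ) = alphaZero g w := by
  simp [alphaZero]

namespace IsProfile

variable {g : ℝ → ℝ}

theorem alphaZero_of_norm_eq_radius (hg : IsProfile g) {w : ℂ} {α : ℝ} (hα : α ∈ Ioo (0 : ℝ) 1)
    (hw : ‖w‖ = radius g α) : alphaZero g w = α := by
  rcases lt_trichotomy (alphaZero g w) α with h | h | h
  · exact absurd ((hg.alphaZero_lt_iff w hα).1 h) (by simp [hw])
  · exact h
  · exact absurd ((hg.lt_alphaZero_iff w hα).1 h) (by simp [hw])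

theorem alphaZero_of_norm_le_innerRadius (hg : IsProfile g) {w : ℂ} (hw : ‖w‖ ≤ innerRadius g) :
    alphaZero g w = 0 := by
  refine le_antisymm (le_of_forall_gt_imp_ge_of_dense fun α hα => ?_) (hg.alphaZero_mem w).1
  rcases lt_or_ge α 1 with h | h
  · exact ((hg.alphaZero_lt_iff w ⟨hα, h⟩).2 (hw.trans_lt (hg.innerRadius_lt_radius ⟨hα, h⟩))).le
  · exact (hg.alphaZero_mem w).2.trans h

theorem alphaZero_of_outerRadius_le (hg : IsProfile g) {w : ℂ} (hw : outerRadius g ≤ ‖w‖) :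
    alphaZero g w = 1 := by
  refine le_antisymm (hg.alphaZero_mem w).2 (le_of_forall_lt_imp_le_of_dense fun α hα => ?_)
  rcases lt_or_ge 0 α with h | h
  · exact ((hg.lt_alphaZero_iff w ⟨h, hα⟩).2 ((hg.radius_lt_outerRadius ⟨h, hα⟩).trans_le hw)).le
  · exact h.trans (hg.alphaZero_mem w).1

theorem alphaZero_mem_Ioo (hg : IsProfile g) {w : ℂ}
    (hw : ‖w‖ ∈ Ioo (innerRadius g) (outerRadius g)) : alphaZero g w ∈ Ioo (0 : ℝ) 1 := by
  obtain ⟨α, hα, h⟩ := hg.exists_radius_eq hw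
  rw [hg.alphaZero_of_norm_eq_radius hα h.symm]
  exact hα

end IsProfile

/-! ### The slope bound below the critical time -/

/-- The function `s ↦ α₀(s) / s`. -/
noncomputable def ratio (g : ℝ → ℝ) (r : ℝ) : ℝ := alphaZero g (r : ℂ) / r

/-- `L` bounds the derivative of `α₀(s) / s` on `(innerRadius g, outerRadius g)`. -/
def IsSlopeBound (g : ℝ → ℝ) (L : ℝ) : Prop :=
  0 ≤ L ∧ ∀ s ∈ Ioo (innerRadius g) (outerRadius g), |deriv (ratio g) s| ≤ L

/-- `L` is the supremum in the definition of `tSing`; the strict inequality makes it finite and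
smaller than `1 / t`. -/
theorem exists_isSlopeBound {g : ℝ → ℝ} {t : ℝ} (ht : 0 < t)
    (hts : ENNReal.ofReal t < tSing g) : ∃ L, IsSlopeBound g L ∧ t * L < 1 := by
  unfold tSing at hts
  set S := ⨆ s ∈ Ioo (innerRadius g) (outerRadius g),
    ENNReal.ofReal |deriv (fun r : ℝ => alphaZero g (r : ℂ) / r) s| with hS
  rw [ENNReal.lt_inv_iff_lt_inv] at hts
  have htop : S ≠ ⊤ := (hts.trans_le le_top).ne
  refine ⟨S.toReal, ⟨ENNReal.toReal_nonneg, fun s hs => ?_⟩, ?_⟩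
  · have : ENNReal.ofReal |deriv (ratio g) s| ≤ S := le_iSup₂_of_le s hs le_rfl
    exact (ENNReal.ofReal_le_iff_le_toReal htop).1 this
  · have h := ENNReal.toReal_strict_mono (by simpa using ht) hts
    rw [ENNReal.toReal_inv, ENNReal.toReal_ofReal ht.le] at h
    calc t * S.toReal < t * t⁻¹ := mul_lt_mul_of_pos_left h ht
      _ = 1 := mul_inv_cancel₀ ht.ne'

@[simp] theorem ratio_zero (g : ℝ → ℝ) : ratio g 0 = 0 := by simp [ratio]

/-- Gluing two Lipschitz estimates at a point. -/
theorem abs_sub_le_of_glue {f : ℝ → ℝ} {L a c : ℝ}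
    (h1 : ∀ x y, a ≤ x → x ≤ y → y ≤ c → |f y - f x| ≤ L * (y - x))
    (h2 : ∀ x y, c ≤ x → x ≤ y → |f y - f x| ≤ L * (y - x)) :
    ∀ x y, a ≤ x → x ≤ y → |f y - f x| ≤ L * (y - x) := by
  intro x y hx hxy
  rcases le_total y c with hy | hy
  · exact h1 x y hx hxy hy
  rcases le_total c x with hc | hc
  · exact h2 x y hc hxy
  have e1 := h1 x c hx hc le_rfl
  have e2 := h2 c y le_rfl hy
  have := abs_sub_le (f y) (f c) (f x)
  linarith

/-! ### Regularity of `α₀` and the Lipschitz bound for `α₀(s)/s` -/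

namespace IsProfile

variable {g : ℝ → ℝ}

theorem continuous_alphaZero (hg : IsProfile g) : Continuous (alphaZero g) := by
  rw [continuous_iff_continuousAt]
  intro w
  refine tendsto_order.2 ⟨fun a ha => ?_, fun a ha => ?_⟩
  · rcases lt_or_ge a 0 with h0 | h0
    · exact Eventually.of_forall fun w' => h0.trans_le (hg.alphaZero_mem w').1
    obtain ⟨α, h1, h2⟩ := exists_between ha
    have hα : α ∈ Ioo (0 : ℝ) 1 := ⟨h0.trans_lt h1, h2.trans_le (hg.alphaZero_mem w).2⟩
    have := (continuous_norm.tendsto w).eventually_const_lt ((hg.lt_alphaZero_iff w hα).1 h2)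
    filter_upwards [this] with w' hw'
    exact h1.trans ((hg.lt_alphaZero_iff w' hα).2 hw')
  · rcases lt_or_ge 1 a with h0 | h0
    · exact Eventually.of_forall fun w' => (hg.alphaZero_mem w').2.trans_lt h0
    obtain ⟨α, h1, h2⟩ := exists_between ha
    have hα : α ∈ Ioo (0 : ℝ) 1 := ⟨(hg.alphaZero_mem w).1.trans_lt h1, h2.trans_le h0⟩
    have := (continuous_norm.tendsto w).eventually_lt_const ((hg.alphaZero_lt_iff w hα).1 h1)
    filter_upwards [this] with w' hw'
    exact ((hg.alphaZero_lt_iff w' hα).2 hw').trans h2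

theorem alphaZero_radius (hg : IsProfile g) {α : ℝ} (hα : α ∈ Ioo (0 : ℝ) 1) :
    alphaZero g (radius g α : ℂ) = α :=
  hg.alphaZero_of_norm_eq_radius hα (by simp [abs_of_pos (radius_pos g α)])

theorem ratio_radius (hg : IsProfile g) {α : ℝ} (hα : α ∈ Ioo (0 : ℝ) 1) :
    ratio g (radius g α) = α / radius g α := by
  rw [ratio, hg.alphaZero_radius hα]

theorem ratio_of_le_innerRadius (hg : IsProfile g) {s : ℝ} (h0 : 0 ≤ s) (hs : s ≤ innerRadius g) :
    ratio g s = 0 := by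
  rw [ratio, hg.alphaZero_of_norm_le_innerRadius (by simpa [abs_of_nonneg h0] using hs), zero_div]

theorem ratio_of_outerRadius_le (hg : IsProfile g) {s : ℝ} (hs : outerRadius g ≤ s) :
    ratio g s = 1 / s := by
  rw [ratio, hg.alphaZero_of_outerRadius_le
    (by simpa [abs_of_pos (hg.outerRadius_pos.trans_le hs)] using hs)]

theorem ratio_nonneg (hg : IsProfile g) {s : ℝ} (hs : 0 ≤ s) : 0 ≤ ratio g s :=
  div_nonneg (hg.alphaZero_mem _).1 hs

/-- If the inner radius is positive, `α₀` vanishes near `0`. Otherwise `g'(0+) = +∞`, and with `s =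
radius α` the ratio is `α exp (g' α)`, which tends to `0` by the last clause of the smoothness
assumption. -/
theorem tendsto_ratio_zero (hg : IsProfile g) : Tendsto (ratio g) (𝓝[>] 0) (𝓝 0) := by
  rcases hg.innerRadius_nonneg.eq_or_lt with h0 | h0
  · have hr := hg.tendsto_radius_zero
    rw [← h0] at hr
    have hlog : Tendsto (deriv g) (𝓝[>] 0) atTop := by
      have h1 : Tendsto (radius g) (𝓝[>] 0) (𝓝[>] 0) :=
        tendsto_nhdsWithin_iff.2 ⟨hr, Eventually.of_forall fun α => radius_pos g α⟩
      have h2 := tendsto_neg_atBot_atTop.comp (Real.tendsto_log_nhdsGT_zero.comp h1)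
      refine h2.congr fun α => ?_
      simp [log_radius]
    have hlim := hg.smooth.tendsto_zero hlog
    rw [Metric.tendsto_nhdsWithin_nhds]
    intro ε hε
    obtain ⟨a, ha, ha'⟩ := (Metric.tendsto_nhdsWithin_nhds.1 hlim) ε hε
    set b := min (a / 2) (1 / 2) with hb
    have hb0 : b ∈ Ioo (0 : ℝ) 1 := ⟨by positivity, (min_le_right _ _).trans_lt (by norm_num)⟩
    refine ⟨radius g b, radius_pos g b, fun {s} hs hs' => ?_⟩
    have hs0 : 0 < s := hs
    rw [Real.dist_eq, sub_zero, abs_of_pos hs0] at hs'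
    obtain ⟨α, hα, rfl⟩ := hg.exists_radius_eq
      ⟨h0 ▸ hs0, hs'.trans (hg.radius_lt_outerRadius hb0)⟩
    rw [hg.ratio_radius hα]
    have hαb := (hg.strictMonoOn_radius.lt_iff_lt hα hb0).1 hs'
    have := ha' hα.1 (by
      rw [Real.dist_eq, sub_zero, abs_of_pos hα.1]
      have : b ≤ a / 2 := min_le_left _ _
      linarith)
    rwa [radius, Real.exp_neg, div_inv_eq_mul]
  · refine Tendsto.congr' ?_ tendsto_const_nhds
    filter_upwards [Ioo_mem_nhdsGT h0] with s hs
    exact (hg.ratio_of_le_innerRadius hs.1.le hs.2.le).symm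

theorem continuousOn_ratio (hg : IsProfile g) : ContinuousOn (ratio g) (Ici 0) := by
  intro s hs
  rcases (mem_Ici.1 hs).eq_or_lt with rfl | hs
  · rw [← continuousWithinAt_Ioi_iff_Ici, ContinuousWithinAt, ratio_zero]
    exact hg.tendsto_ratio_zero
  · exact ((hg.continuous_alphaZero.continuousAt.comp
      Complex.continuous_ofReal.continuousAt).div continuousAt_id hs.ne').continuousWithinAt

theorem hasDerivAt_alphaZero (hg : IsProfile g) {α : ℝ} (hα : α ∈ Ioo (0 : ℝ) 1) :
    HasDerivAt (fun s : ℝ => alphaZero g (s : ℂ)) (radius g α * -deriv (deriv g) α)⁻¹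
      (radius g α) := by
  refine HasDerivAt.of_local_left_inverse (f := radius g)
    (hg.continuous_alphaZero.comp Complex.continuous_ofReal).continuousAt ?_
    (hg.deriv_radius_pos hα).ne' ?_
  · rw [hg.alphaZero_radius hα]
    exact hg.hasDerivAt_radius hα
  · filter_upwards [Ioo_mem_nhds (hg.innerRadius_lt_radius hα) (hg.radius_lt_outerRadius hα)]
      with s hs
    obtain ⟨β, hβ, rfl⟩ := hg.exists_radius_eq hs
    rw [hg.alphaZero_radius hβ]

theorem hasDerivAt_ratio (hg : IsProfile g) {α : ℝ} (hα : α ∈ Ioo (0 : ℝ) 1) :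
    HasDerivAt (ratio g) (((radius g α * -deriv (deriv g) α)⁻¹ * radius g α - α) / radius g α ^ 2)
      (radius g α) := by
  have := (hg.hasDerivAt_alphaZero hα).fun_div (hasDerivAt_id' (radius g α)) (radius_pos g α).ne'
  rwa [hg.alphaZero_radius hα, mul_one] at this

variable {L : ℝ}

/-- The mean value theorem across the whole annulus, where the ratio climbs from `0` to `1 /
outerRadius`, forces `L ≥ 1 / outerRadius²`. That is the largest slope of the tail `1 / s`, which
the definition of `L` does not see. -/
theorem one_le_slopeBound_mul (hg : IsProfile g) (hL : IsSlopeBound g L) :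
    1 ≤ L * outerRadius g ^ 2 ∧ ∀ x y, innerRadius g ≤ x → x ≤ y → y ≤ outerRadius g →
      |ratio g y - ratio g x| ≤ L * (y - x) := by
  have key : ∀ x y, innerRadius g ≤ x → x ≤ y → y ≤ outerRadius g →
      |ratio g y - ratio g x| ≤ L * (y - x) := by
    intro x y hx hxy hy
    rcases hxy.eq_or_lt with rfl | hxy
    · simp
    obtain ⟨c, hc, hc'⟩ := exists_deriv_eq_slope (ratio g) hxy
      (hg.continuousOn_ratio.mono fun z hz => hg.innerRadius_nonneg.trans (hx.trans hz.1))
      (fun z hz => by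
        obtain ⟨α, hα, rfl⟩ := hg.exists_radius_eq ⟨hx.trans_lt hz.1, hz.2.trans_le hy⟩
        exact (hg.hasDerivAt_ratio hα).differentiableAt.differentiableWithinAt)
    have h := hL.2 c ⟨hx.trans_lt hc.1, hc.2.trans_le hy⟩
    rw [hc', abs_div, abs_of_pos (sub_pos.2 hxy), div_le_iff₀ (sub_pos.2 hxy)] at h
    exact h
  refine ⟨?_, key⟩
  have h := key _ _ le_rfl hg.innerRadius_lt_outerRadius.le le_rfl
  have hpos := hg.outerRadius_pos
  rw [hg.ratio_of_outerRadius_le le_rfl, hg.ratio_of_le_innerRadius hg.innerRadius_nonneg le_rfl,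
    sub_zero, abs_of_pos (by positivity), div_le_iff₀ hpos] at h
  nlinarith [mul_nonneg (mul_nonneg hL.1 hg.innerRadius_nonneg) hpos.le]

/-- Three pieces are glued: zero inside the inner radius, slope at most `L` in the annulus, and `1 /
s` outside, whose slope is controlled by `one_le_slopeBound_mul`. -/
theorem abs_ratio_sub_le (hg : IsProfile g) (hL : IsSlopeBound g L) :
    ∀ x y, 0 ≤ x → x ≤ y → |ratio g y - ratio g x| ≤ L * (y - x) := by
  obtain ⟨hone, hmid⟩ := hg.one_le_slopeBound_mul hL
  refine abs_sub_le_of_glue (c := innerRadius g) (fun x y hx hxy hy => ?_)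
    (abs_sub_le_of_glue (c := outerRadius g) hmid fun x y hx hxy => ?_)
  · rw [hg.ratio_of_le_innerRadius hx (hxy.trans hy),
      hg.ratio_of_le_innerRadius (hx.trans hxy) hy]
    simpa using mul_nonneg hL.1 (sub_nonneg.2 hxy)
  · have h1 := hg.outerRadius_pos
    have hx0 : 0 < x := h1.trans_le hx
    have hy0 : 0 < y := hx0.trans_le hxy
    rw [hg.ratio_of_outerRadius_le hx, hg.ratio_of_outerRadius_le (hx.trans hxy), abs_sub_comm,
      abs_of_nonneg (sub_nonneg.2 (one_div_le_one_div_of_le hx0 hxy)),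
      div_sub_div _ _ hx0.ne' hy0.ne', div_le_iff₀ (by positivity)]
    have : 1 ≤ L * (x * y) := hone.trans (mul_le_mul_of_nonneg_left (by nlinarith) hL.1)
    nlinarith [sub_nonneg.2 hxy]

theorem ratio_le (hg : IsProfile g) (hL : IsSlopeBound g L) {s : ℝ} (hs : 0 ≤ s) :
    ratio g s ≤ L * s := by
  simpa using (le_abs_self _).trans (hg.abs_ratio_sub_le hL 0 s le_rfl hs)

theorem alphaZero_le (hg : IsProfile g) (hL : IsSlopeBound g L) (w : ℂ) :
    alphaZero g w ≤ L * ‖w‖ ^ 2 := by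
  rcases eq_or_ne w 0 with rfl | hw
  · simp
  have h := hg.ratio_le hL (norm_nonneg w)
  rw [ratio, alphaZero_norm, div_le_iff₀ (norm_pos_iff.2 hw)] at h
  linarith

theorem le_slopeBound_mul_radius (hg : IsProfile g) (hL : IsSlopeBound g L) {α : ℝ}
    (hα : α ∈ Ioo (0 : ℝ) 1) : α ≤ L * radius g α ^ 2 := by
  have := hg.alphaZero_le hL (radius g α : ℂ)
  rwa [hg.alphaZero_radius hα, Complex.norm_real, Real.norm_eq_abs, sq_abs] at this

/-- The upper bound on the derivative of `α₀(s)/s` and `α ≤ L r²` combine to `α₀'(r) ≤ 2 L r`,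
written here through the inverse function. As the density of `ν₀` at radius `r` is `α₀'(r) / (2 π
r)`, this is the density bound `L / π`. -/
theorem one_le_deriv_radius (hg : IsProfile g) (hL : IsSlopeBound g L) {α : ℝ}
    (hα : α ∈ Ioo (0 : ℝ) 1) :
    1 ≤ 2 * L * radius g α * (radius g α * -deriv (deriv g) α) := by
  have h := hL.2 _ ⟨hg.innerRadius_lt_radius hα, hg.radius_lt_outerRadius hα⟩
  rw [(hg.hasDerivAt_ratio hα).deriv] at h
  have h1 := (le_abs_self _).trans h
  have hr := radius_pos g α
  have hd := hg.deriv_radius_pos hα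
  set d := radius g α * -deriv (deriv g) α
  rw [div_le_iff₀ (by positivity)] at h1
  have h2 := hg.le_slopeBound_mul_radius hL hα
  have h3 : d⁻¹ * radius g α ≤ 2 * L * radius g α ^ 2 := by linarith
  have h4 : d⁻¹ ≤ 2 * L * radius g α := by
    refine le_of_mul_le_mul_right ?_ hr
    calc _ ≤ _ := h3
      _ = _ := by ring
  calc 1 = d⁻¹ * d := (inv_mul_cancel₀ hd.ne').symm
    _ ≤ _ := mul_le_mul_of_nonneg_right h4 hd.le

end IsProfile

/-! ### The transport map -/

/-- The law of cosines, which separates a radial from an angular contribution. -/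
theorem norm_smul_sub_smul_sq {p q : ℂ} (hp : ‖p‖ = 1) (hq : ‖q‖ = 1) (x y : ℝ) :
    ‖(x : ℂ) * p - y * q‖ ^ 2 = (x - y) ^ 2 + x * y * ‖p - q‖ ^ 2 := by
  have h1 : p.re * p.re + p.im * p.im = 1 := by
    rw [← Complex.normSq_apply, Complex.normSq_eq_norm_sq, hp, one_pow]
  have h2 : q.re * q.re + q.im * q.im = 1 := by
    rw [← Complex.normSq_apply, Complex.normSq_eq_norm_sq, hq, one_pow]
  simp only [← Complex.normSq_eq_norm_sq, Complex.normSq_apply, Complex.sub_re, Complex.sub_im,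
    Complex.mul_re, Complex.mul_im, Complex.ofReal_re, Complex.ofReal_im]
  linear_combination (x ^ 2 - x * y) * h1 + (y ^ 2 - x * y) * h2

theorem alphaZero_div_eq (g : ℝ → ℝ) {w : ℂ} (hw : w ≠ 0) :
    (alphaZero g w : ℂ) / w = (ratio g ‖w‖ : ℂ) * (starRingEnd ℂ) (w / ‖w‖) := by
  have h : (‖w‖ : ℂ) ≠ 0 := by simpa using hw
  rw [ratio, alphaZero_norm, map_div₀, Complex.conj_ofReal, div_eq_iff hw]
  push_cast
  have : (starRingEnd ℂ) w * w = (‖w‖ : ℂ) ^ 2 := by rw [mul_comm, Complex.mul_conj']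
  field_simp
  rw [mul_assoc, this]

namespace IsProfile

variable {g : ℝ → ℝ} {L t : ℝ}

theorem norm_alphaZero_div (hg : IsProfile g) (w : ℂ) :
    ‖(alphaZero g w : ℂ) / w‖ = ratio g ‖w‖ := by
  rw [norm_div, Complex.norm_real, Real.norm_of_nonneg (hg.alphaZero_mem w).1, ratio,
    alphaZero_norm]

/-- The map sends `r e^{iθ}` to `ratio r · e^{-iθ}`. In the law of cosines the radial term is
controlled by the Lipschitz bound for `ratio`, and the angular term by `ratio r ≤ L r`; both with
the same constant. -/
theorem norm_alphaZero_div_sub_le (hg : IsProfile g) (hL : IsSlopeBound g L) (w w' : ℂ) :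
    ‖(alphaZero g w : ℂ) / w - (alphaZero g w' : ℂ) / w'‖ ≤ L * ‖w - w'‖ := by
  rcases eq_or_ne w 0 with rfl | hw
  · have := hg.ratio_le hL (norm_nonneg w')
    simpa [← hg.norm_alphaZero_div w'] using this
  rcases eq_or_ne w' 0 with rfl | hw'
  · have := hg.ratio_le hL (norm_nonneg w)
    simpa [← hg.norm_alphaZero_div w] using this
  set p := w / ‖w‖ with hp
  set q := w' / ‖w'‖ with hq
  have hr : 0 < ‖w‖ := norm_pos_iff.2 hw
  have hs : 0 < ‖w'‖ := norm_pos_iff.2 hw'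
  have hp1 : ‖p‖ = 1 := by simp [hp, hr.ne']
  have hq1 : ‖q‖ = 1 := by simp [hq, hs.ne']
  have hwp : w = (‖w‖ : ℂ) * p := by rw [hp, mul_div_cancel₀]; exact_mod_cast hr.ne'
  have hwq : w' = (‖w'‖ : ℂ) * q := by rw [hq, mul_div_cancel₀]; exact_mod_cast hs.ne'
  have e1 : ‖w - w'‖ ^ 2 = (‖w‖ - ‖w'‖) ^ 2 + ‖w‖ * ‖w'‖ * ‖p - q‖ ^ 2 := by
    rw [← norm_smul_sub_smul_sq hp1 hq1, ← hwp, ← hwq]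
  have e2 : ‖(alphaZero g w : ℂ) / w - (alphaZero g w' : ℂ) / w'‖ ^ 2 =
      (ratio g ‖w‖ - ratio g ‖w'‖) ^ 2 + ratio g ‖w‖ * ratio g ‖w'‖ * ‖p - q‖ ^ 2 := by
    rw [alphaZero_div_eq g hw, alphaZero_div_eq g hw', ← hp, ← hq,
      norm_smul_sub_smul_sq (by simpa using hp1) (by simpa using hq1), ← map_sub, RCLike.norm_conj]
  have h1 : (ratio g ‖w‖ - ratio g ‖w'‖) ^ 2 ≤ (L * (‖w‖ - ‖w'‖)) ^ 2 := by
    rw [sq_le_sq, abs_mul, abs_of_nonneg hL.1]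
    rcases le_total ‖w‖ ‖w'‖ with h | h
    · have := hg.abs_ratio_sub_le hL _ _ hr.le h
      rwa [abs_sub_comm, abs_sub_comm ‖w‖, abs_of_nonneg (sub_nonneg.2 h)]
    · have := hg.abs_ratio_sub_le hL _ _ hs.le h
      rwa [abs_of_nonneg (sub_nonneg.2 h)]
  have h2 : ratio g ‖w‖ * ratio g ‖w'‖ ≤ (L * ‖w‖) * (L * ‖w'‖) :=
    mul_le_mul (hg.ratio_le hL hr.le) (hg.ratio_le hL hs.le) (hg.ratio_nonneg hs.le)
      (mul_nonneg hL.1 hr.le)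
  refine le_of_sq_le_sq ?_ (mul_nonneg hL.1 (norm_nonneg _))
  rw [e2, mul_pow, e1]
  nlinarith [mul_le_mul_of_nonneg_right h2 (sq_nonneg ‖p - q‖)]

theorem transport_sub_le (hg : IsProfile g) (hL : IsSlopeBound g L) (ht : 0 ≤ t) (w w' : ℂ) :
    (1 - t * L) * ‖w - w'‖ ≤ ‖transport g t w - transport g t w'‖ := by
  have h := mul_le_mul_of_nonneg_left (hg.norm_alphaZero_div_sub_le hL w w') ht
  have e : w - w' = (transport g t w - transport g t w') -
      (t : ℂ) * ((alphaZero g w : ℂ) / w - (alphaZero g w' : ℂ) / w') := by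
    simp only [transport]; ring
  have h2 := norm_sub_le (transport g t w - transport g t w')
    ((t : ℂ) * ((alphaZero g w : ℂ) / w - (alphaZero g w' : ℂ) / w'))
  rw [← e, norm_mul, Complex.norm_real, Real.norm_of_nonneg ht] at h2
  linarith

theorem continuous_alphaZero_div (hg : IsProfile g) (hL : IsSlopeBound g L) :
    Continuous fun w : ℂ => (alphaZero g w : ℂ) / w :=
  (LipschitzWith.of_dist_le_mul (K := ⟨L, hL.1⟩) fun w w' => by
    rw [dist_eq_norm, dist_eq_norm]
    exact hg.norm_alphaZero_div_sub_le hL w w').continuous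

theorem continuous_transport (hg : IsProfile g) (hL : IsSlopeBound g L) :
    Continuous (transport g t) :=
  continuous_id.add (continuous_const.mul (hg.continuous_alphaZero_div hL))

theorem antilipschitz_transport (hg : IsProfile g) (hL : IsSlopeBound g L) (ht : 0 ≤ t)
    (htL : t * L < 1) :
    AntilipschitzWith ⟨(1 - t * L)⁻¹, inv_nonneg.2 (sub_nonneg.2 htL.le)⟩ (transport g t) :=
  AntilipschitzWith.of_le_mul_dist fun w w' => by
    rw [dist_eq_norm, dist_eq_norm]
    change _ ≤ (1 - t * L)⁻¹ * _
    rw [inv_mul_eq_div, le_div_iff₀ (sub_pos.2 htL), mul_comm]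
    exact hg.transport_sub_le hL ht w w'

/-- A preimage of `z` is a fixed point of `w ↦ z - t α₀(w)/w`, a contraction with constant `t L`. -/
theorem surjective_transport (hg : IsProfile g) (hL : IsSlopeBound g L) (ht : 0 ≤ t)
    (htL : t * L < 1) : Function.Surjective (transport g t) := by
  intro z
  have hc : ContractingWith ⟨t * L, mul_nonneg ht hL.1⟩
      (fun w : ℂ => z - (t : ℂ) * ((alphaZero g w : ℂ) / w)) := by
    refine ⟨by exact_mod_cast htL, LipschitzWith.of_dist_le_mul fun w w' => ?_⟩
    rw [dist_eq_norm, dist_eq_norm]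
    change _ ≤ t * L * _
    rw [sub_sub_sub_cancel_left, ← mul_sub, norm_mul, Complex.norm_real, Real.norm_of_nonneg ht,
      mul_assoc, norm_sub_rev w w']
    exact mul_le_mul_of_nonneg_left (hg.norm_alphaZero_div_sub_le hL w' w) ht
  refine ⟨ContractingWith.fixedPoint _ hc, ?_⟩
  have h := hc.fixedPoint_isFixedPt
  set w := ContractingWith.fixedPoint _ hc
  have h' : z - (t : ℂ) * ((alphaZero g w : ℂ) / w) = w := h
  rw [transport]
  linear_combination -h'

end IsProfile

@[simp] theorem transport_zero (g : ℝ → ℝ) (t : ℝ) : transport g t 0 = 0 := by simp [transport]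

/-! ### The outer root of `ω (z - ω) = τ` -/

/-- `ω` is a root of `ω (z - ω) = τ` of largest modulus; the other root is `z - ω`. -/
def IsOuterRoot (τ : ℝ) (z ω : ℂ) : Prop := ω * (z - ω) = τ ∧ ‖z - ω‖ ≤ ‖ω‖

theorem exists_isOuterRoot (τ : ℝ) (z : ℂ) : ∃ ω, IsOuterRoot τ z ω := by
  obtain ⟨s, hs⟩ := IsAlgClosed.exists_pow_nat_eq (z ^ 2 - 4 * τ) (n := 2) (by norm_num)
  have h1 : (z + s) / 2 * (z - (z + s) / 2) = τ := by linear_combination -hs / 4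
  rcases le_total ‖z - (z + s) / 2‖ ‖(z + s) / 2‖ with h | h
  · exact ⟨_, h1, h⟩
  · exact ⟨z - (z + s) / 2, by rw [← h1]; ring, by rwa [sub_sub_cancel]⟩

/-- A root of `ω (z - ω) = τ` of largest modulus. -/
noncomputable def outerRoot (τ : ℝ) (z : ℂ) : ℂ := (exists_isOuterRoot τ z).choose

theorem outerRoot_spec (τ : ℝ) (z : ℂ) : IsOuterRoot τ z (outerRoot τ z) :=
  (exists_isOuterRoot τ z).choose_spec

namespace IsOuterRoot

variable {τ : ℝ} {z ω ω' : ℂ}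

theorem norm_mul (h : IsOuterRoot τ z ω) (hτ : 0 ≤ τ) : ‖ω‖ * ‖z - ω‖ = τ := by
  rw [← _root_.norm_mul, h.1, Complex.norm_real, Real.norm_of_nonneg hτ]

theorem le_norm_sq (h : IsOuterRoot τ z ω) (hτ : 0 ≤ τ) : τ ≤ ‖ω‖ ^ 2 := by
  rw [← h.norm_mul hτ, sq]
  exact mul_le_mul_of_nonneg_left h.2 (norm_nonneg _)

theorem norm_sub_sq_le (h : IsOuterRoot τ z ω) (hτ : 0 ≤ τ) : ‖z - ω‖ ^ 2 ≤ τ := by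
  rw [← h.norm_mul hτ, sq]
  exact mul_le_mul_of_nonneg_right h.2 (norm_nonneg _)

theorem ne_zero (h : IsOuterRoot τ z ω) (hτ : 0 < τ) : ω ≠ 0 := by
  rintro rfl
  have := h.1
  rw [zero_mul] at this
  exact hτ.ne (by exact_mod_cast this)

theorem eq_or_eq (h : IsOuterRoot τ z ω) (h' : IsOuterRoot τ z ω') : ω' = ω ∨ ω' = z - ω := by
  have : (ω' - ω) * (ω' - (z - ω)) = 0 := by linear_combination h.1 - h'.1
  rcases mul_eq_zero.1 this with h | h
  · exact Or.inl (sub_eq_zero.1 h)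
  · exact Or.inr (sub_eq_zero.1 h)

theorem norm_eq (h : IsOuterRoot τ z ω) (h' : IsOuterRoot τ z ω') : ‖ω'‖ = ‖ω‖ := by
  rcases h.eq_or_eq h' with rfl | rfl
  · rfl
  · exact le_antisymm h.2 (by simpa using h'.2)

theorem norm_le (h : IsOuterRoot τ z ω) (hτ : 0 ≤ τ) : ‖ω‖ ≤ ‖z‖ + Real.sqrt τ := by
  have h1 : ‖z - ω‖ ≤ Real.sqrt τ := Real.le_sqrt_of_sq_le (h.norm_sub_sq_le hτ)
  have h2 : ‖ω‖ ≤ ‖z‖ + ‖z - ω‖ := by simpa using norm_sub_le z (z - ω)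
  linarith

theorem eq_add_div (h : IsOuterRoot τ z ω) (hω : ω ≠ 0) : z = ω + τ / ω := by
  rw [← h.1, mul_div_cancel_left₀ _ hω]; ring

theorem of_eq_add_div (hτ : 0 ≤ τ) (hω : ω ≠ 0) (h : z = ω + τ / ω) (hle : τ ≤ ‖ω‖ ^ 2) :
    IsOuterRoot τ z ω := by
  have h1 : z - ω = τ / ω := by rw [h]; ring
  refine ⟨by rw [h1, mul_div_cancel₀ _ hω], ?_⟩
  rw [h1, norm_div, Complex.norm_real, Real.norm_of_nonneg hτ, div_le_iff₀ (norm_pos_iff.2 hω)]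
  linarith

theorem scale (h : IsOuterRoot τ z ω) (hτ : 0 < τ) :
    IsOuterRoot 1 (z / (Real.sqrt τ : ℂ)) (ω / (Real.sqrt τ : ℂ)) := by
  have h0 : (Real.sqrt τ : ℂ) ≠ 0 := by exact_mod_cast (Real.sqrt_pos.2 hτ).ne'
  have h1 : (Real.sqrt τ : ℂ) ^ 2 = τ := by exact_mod_cast Real.sq_sqrt hτ.le
  refine ⟨?_, ?_⟩
  · rw [← sub_div, div_mul_div_comm, h.1, ← sq, h1, div_self, Complex.ofReal_one]
    exact_mod_cast hτ.ne'
  · rw [← sub_div, norm_div, norm_div]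
    gcongr
    exact h.2

/-- On the cut the two roots are complex conjugate. -/
theorem sub_eq_conj (h : IsOuterRoot τ z ω) (hτ : 0 < τ) (heq : ‖z - ω‖ = ‖ω‖) :
    z - ω = (starRingEnd ℂ) ω := by
  have h1 := h.norm_mul hτ.le
  rw [heq] at h1
  have h2 : ω * (starRingEnd ℂ) ω = τ := by
    rw [Complex.mul_conj', sq]; exact_mod_cast h1
  exact mul_left_cancel₀ (h.ne_zero hτ) (h.1.trans h2.symm)

end IsOuterRoot

/-! ### The function `Ψ` in terms of the outer root -/

theorem sq_cpow_half (x : ℂ) : (x ^ (1 / 2 : ℂ)) ^ 2 = x := by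
  rw [← Complex.cpow_nat_mul]; norm_num

/-- The principal square root halves an argument in `(-π, π]`. -/
theorem cpow_half_re_nonneg (x : ℂ) : 0 ≤ (x ^ (1 / 2 : ℂ)).re := by
  rcases eq_or_ne x 0 with rfl | hx
  · simp
  rw [Complex.cpow_def_of_ne_zero hx, Complex.exp_re]
  refine mul_nonneg (Real.exp_pos _).le (Real.cos_nonneg_of_neg_pi_div_two_le_of_le ?_ ?_)
  · have := Complex.neg_pi_lt_arg x
    simp [Complex.log_im]; linarith
  · have := Complex.arg_le_pi x
    simp [Complex.log_im]; linarith

theorem cpow_half_im_nonneg {x : ℂ} (h : 0 ≤ x.im) : 0 ≤ (x ^ (1 / 2 : ℂ)).im := by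
  rcases eq_or_ne x 0 with rfl | hx
  · simp
  rw [Complex.cpow_def_of_ne_zero hx, Complex.exp_im]
  have h1 := Complex.arg_nonneg_iff.2 h
  have h2 := Complex.arg_le_pi x
  refine mul_nonneg (Real.exp_pos _).le (Real.sin_nonneg_of_nonneg_of_le_pi ?_ ?_)
  · simp [Complex.log_im]; linarith
  · simp [Complex.log_im]; linarith

theorem cpow_half_im_nonpos {x : ℂ} (h : x.im < 0) : (x ^ (1 / 2 : ℂ)).im ≤ 0 := by
  have hx : x ≠ 0 := by rintro rfl; simp at h
  rw [Complex.cpow_def_of_ne_zero hx, Complex.exp_im]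
  have h1 := Complex.arg_neg_iff.2 h
  have h2 := Complex.neg_pi_lt_arg x
  refine mul_nonpos_of_nonneg_of_nonpos (Real.exp_pos _).le (Real.sin_nonpos_of_nonpos_of_neg_pi_le ?_ ?_)
  · simp [Complex.log_im]; linarith
  · simp [Complex.log_im]; linarith

/-- With `a`, `b` the principal roots of `z - 2` and `z + 2`, the two solutions are `((a ± b) /
2)²`. Real parts of `a`, `b` are nonnegative, and their imaginary parts have the same sign because
`z ∓ 2` share theirs; so `|a - b| ≤ |a + b|`. -/
theorem isOuterRoot_sqrtBranch (z : ℂ) : IsOuterRoot 1 z ((z + sqrtBranch z) / 2) := by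
  set a := (z - 2) ^ (1 / 2 : ℂ) with ha
  set b := (z + 2) ^ (1 / 2 : ℂ) with hb
  have ha2 : a ^ 2 = z - 2 := sq_cpow_half _
  have hb2 : b ^ 2 = z + 2 := sq_cpow_half _
  have hs : sqrtBranch z = a * b := rfl
  refine ⟨?_, ?_⟩
  · rw [hs]; push_cast
    linear_combination -(1 / 4) * b ^ 2 * ha2 - (1 / 4) * (z - 2) * hb2
  · have e1 : (z + sqrtBranch z) / 2 = ((a + b) / 2) ^ 2 := by
      rw [hs]; linear_combination -(1 / 4) * ha2 - (1 / 4) * hb2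
    have e2 : z - (z + sqrtBranch z) / 2 = ((a - b) / 2) ^ 2 := by
      rw [hs]; linear_combination -(1 / 4) * ha2 - (1 / 4) * hb2
    rw [e2, e1, norm_pow, norm_pow, norm_div, norm_div]
    gcongr
    refine le_of_sq_le_sq ?_ (norm_nonneg _)
    have hre : 0 ≤ a.re * b.re := mul_nonneg (cpow_half_re_nonneg _) (cpow_half_re_nonneg _)
    have him : 0 ≤ a.im * b.im := by
      rcases le_or_gt 0 z.im with h | h
      · exact mul_nonneg (cpow_half_im_nonneg (by simpa using h))
          (cpow_half_im_nonneg (by simpa using h))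
      · exact mul_nonneg_of_nonpos_of_nonpos (cpow_half_im_nonpos (by simpa using h))
          (cpow_half_im_nonpos (by simpa using h))
    simp only [← Complex.normSq_eq_norm_sq, Complex.normSq_apply, Complex.sub_re, Complex.sub_im,
      Complex.add_re, Complex.add_im]
    nlinarith

theorem Psi_eq_sqrtBranch (z : ℂ) : Psi z = Real.log ‖(z + sqrtBranch z) / 2‖ +
    1 / 2 * ((z - (z + sqrtBranch z) / 2) / ((z + sqrtBranch z) / 2)).re := by
  have h := isOuterRoot_sqrtBranch z
  set v := (z + sqrtBranch z) / 2 with hv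
  have hv0 : v ≠ 0 := h.ne_zero one_pos
  have h1 : v * (z - v) = 1 := by simpa using h.1
  have e1 : (z - v) / v = (z - v) ^ 2 := by
    rw [div_eq_iff hv0]; linear_combination -(z - v) * h1
  have e2 : z ^ 2 - z * sqrtBranch z = 2 * (1 + (z - v) ^ 2) := by
    have : sqrtBranch z = 2 * v - z := by rw [hv]; ring
    rw [this]; linear_combination 2 * h1
  rw [Psi, ← hv, e1, e2]
  simp
  ring

/-- The exponential rate `α log |ω| + (α / 2) Re ((z - ω) / ω)` of the heat-evolved monomials. -/
noncomputable def rate (α : ℝ) (z ω : ℂ) : ℝ := α * Real.log ‖ω‖ + α / 2 * ((z - ω) / ω).re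

/-- `outerRoot` is an arbitrary choice when both roots have the same modulus. The rate does not
depend on it, since `Re (a / b)` is symmetric when `|a| = |b|`. -/
theorem IsOuterRoot.rate_eq {τ : ℝ} {z ω ω' : ℂ} (h : IsOuterRoot τ z ω)
    (h' : IsOuterRoot τ z ω') (α : ℝ) : rate α z ω' = rate α z ω := by
  have hn := h.norm_eq h'
  rcases h.eq_or_eq h' with rfl | rfl
  · rfl
  rw [rate, rate, hn, sub_sub_cancel]
  congr 2
  rw [Complex.div_re, Complex.div_re, Complex.normSq_eq_norm_sq, Complex.normSq_eq_norm_sq, hn]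
  ring

theorem Psi_eq {z v : ℂ} (h : IsOuterRoot 1 z v) :
    Psi z = Real.log ‖v‖ + 1 / 2 * ((z - v) / v).re := by
  have := h.rate_eq (isOuterRoot_sqrtBranch z) 1
  rw [rate, rate, one_mul, one_mul] at this
  rw [Psi_eq_sqrtBranch, this]

/-- Dividing by `√(t α)` turns the roots for `τ = t α` into those for `τ = 1`, and the logarithm of
this factor cancels the term `α log √(t α)`. -/
theorem fT_eq {g : ℝ → ℝ} {t α : ℝ} (ht : 0 < t) (hα : 0 ≤ α) {z ω : ℂ}
    (h : IsOuterRoot (t * α) z ω) : fT g t α z = g α + rate α z ω := by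
  rcases hα.eq_or_lt with rfl | hα
  · simp [fT, rate]
  have hτ : 0 < t * α := mul_pos ht hα
  have h0 := Real.sqrt_pos.2 hτ
  have h0' : (Real.sqrt (t * α) : ℂ) ≠ 0 := by exact_mod_cast h0.ne'
  rw [fT, if_neg hα.ne', Psi_eq (h.scale hτ), rate, ← sub_div, div_div_div_cancel_right₀ h0',
    norm_div, Complex.norm_real, Real.norm_of_nonneg h0.le,
    Real.log_div (norm_ne_zero_iff.2 (h.ne_zero hτ)) h0.ne']
  ring

/-! ### Dependence of the rate on `α` -/

theorem HasDerivAt.log_norm {f : ℝ → ℂ} {f' : ℂ} {x : ℝ} (h : HasDerivAt f f' x) (h0 : f x ≠ 0) :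
    HasDerivAt (fun y => Real.log ‖f y‖) (f' / f x).re x := by
  have h1 : HasDerivAt (fun y => Real.log (‖f y‖ ^ 2)) _ x :=
    h.norm_sq.log (by simpa using h0)
  have h2 := h1.const_mul (1 / 2 : ℝ)
  have e : (fun y => 1 / 2 * Real.log (‖f y‖ ^ 2)) = fun y => Real.log ‖f y‖ := by
    funext y; rw [Real.log_pow]; push_cast; ring
  rw [e] at h2
  refine h2.congr_deriv ?_
  rw [Complex.inner, Complex.div_re, ← Complex.normSq_eq_norm_sq]
  simp
  ring

theorem HasDerivAt.complex_re {f : ℝ → ℂ} {f' : ℂ} {x : ℝ} (h : HasDerivAt f f' x) :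
    HasDerivAt (fun y => (f y).re) f'.re x :=
  (Complex.reCLM.hasFDerivAt.comp_hasDerivAt x h)

variable {t α : ℝ} {z ω : ℂ}

/-- Two outer roots for different `τ` are close. -/
theorem IsOuterRoot.sub_mul_sub {τ τ' : ℝ} {ω' : ℂ} (h : IsOuterRoot τ z ω)
    (h' : IsOuterRoot τ' z ω') : (ω' - ω) * (ω' - (z - ω)) = (τ : ℂ) - τ' := by
  linear_combination h.1 - h'.1

/-- Since `ω'` is outer as well, the second factor in `sub_mul_sub` is at least half the gap `|ω| -
|z - ω|`. Off the cut the outer root therefore cannot jump to the other branch. -/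
theorem IsOuterRoot.norm_sub_le {τ τ' : ℝ} {ω' : ℂ} (h : IsOuterRoot τ z ω)
    (h' : IsOuterRoot τ' z ω') : ‖ω' - ω‖ * (‖ω‖ - ‖z - ω‖) ≤ 2 * |τ - τ'| := by
  have e := congrArg norm (h.sub_mul_sub h')
  rw [_root_.norm_mul, ← Complex.ofReal_sub, Complex.norm_real, Real.norm_eq_abs] at e
  have h1 : ‖ω'‖ - ‖z - ω‖ ≤ ‖ω' - (z - ω)‖ := norm_sub_norm_le _ _
  have h2 : ‖ω‖ - ‖z - ω'‖ ≤ ‖ω' - (z - ω)‖ := by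
    have := norm_sub_norm_le ω (z - ω')
    rwa [show ω - (z - ω') = ω' - (z - ω) by ring] at this
  have h3 : ‖ω‖ - ‖z - ω‖ ≤ 2 * ‖ω' - (z - ω)‖ := by linarith [h'.2]
  calc _ ≤ ‖ω' - ω‖ * (2 * ‖ω' - (z - ω)‖) := mul_le_mul_of_nonneg_left h3 (norm_nonneg _)
    _ = _ := by rw [← e]; ring

/-- The factorisation in `sub_mul_sub` gives the difference quotient in closed form, `-t / (W β - (z
- W α))`; only continuity of `W` at `α` is needed to pass to the limit. -/
theorem hasDerivAt_outerRoot {W : ℝ → ℂ} (hW : ∀ β, IsOuterRoot (t * β) z (W β))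
    (hlt : ‖z - W α‖ < ‖W α‖) : HasDerivAt W (-t / (2 * W α - z)) α := by
  have hd : 0 < ‖W α‖ - ‖z - W α‖ := sub_pos.2 hlt
  have hcont : Tendsto W (𝓝 α) (𝓝 (W α)) := by
    rw [tendsto_iff_norm_sub_tendsto_zero]
    have hlim : Tendsto (fun β => 2 * |t * α - t * β| / (‖W α‖ - ‖z - W α‖)) (𝓝 α) (𝓝 0) := by
      have : Continuous fun β => 2 * |t * α - t * β| / (‖W α‖ - ‖z - W α‖) := by fun_prop
      simpa using this.tendsto α
    refine squeeze_zero (fun _ => norm_nonneg _) (fun β => ?_) hlim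
    rw [le_div_iff₀ hd]
    exact (hW α).norm_sub_le (hW β)
  have hne : 2 * W α - z ≠ 0 := fun h => by
    have : z - W α = W α := by linear_combination -h
    rw [this] at hlt
    exact lt_irrefl _ hlt
  rw [hasDerivAt_iff_tendsto_slope]
  have hlim : Tendsto (fun β => -(t : ℂ) / (W β - (z - W α))) (𝓝[≠] α) (𝓝 (-t / (2 * W α - z))) := by
    have h1 : Tendsto (fun β => W β - (z - W α)) (𝓝[≠] α) (𝓝 (2 * W α - z)) := by
      have := (hcont.mono_left (nhdsWithin_le_nhds (s := {α}ᶜ))).sub_const (z - W α)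
      convert this using 2
      ring
    exact tendsto_const_nhds.div h1 hne
  refine hlim.congr' ?_
  have hev : ∀ᶠ β in 𝓝[≠] α, W β - (z - W α) ≠ 0 := by
    have h1 : Tendsto (fun β => W β - (z - W α)) (𝓝[≠] α) (𝓝 (2 * W α - z)) := by
      have := (hcont.mono_left (nhdsWithin_le_nhds (s := {α}ᶜ))).sub_const (z - W α)
      convert this using 2
      ring
    exact h1.eventually_ne hne
  filter_upwards [hev, self_mem_nhdsWithin] with β hβ hβα
  have hβα' : ((β - α : ℝ) : ℂ) ≠ 0 := by exact_mod_cast sub_ne_zero.2 hβα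
  have e := (hW α).sub_mul_sub (hW β)
  rw [slope_def_module, Complex.real_smul, Complex.ofReal_inv, eq_inv_mul_iff_mul_eq₀ hβα',
    mul_div_assoc', div_eq_iff hβ, e]
  push_cast
  ring

/-- The motion of the root and the explicit factor `α / 2` contribute terms that cancel by `ω (z -
ω) = t α` and `ω' (2 ω - z) = -t`. Only `log |ω|` remains; this drives both the maximization of
`f_t` and the computation of the potential. -/
theorem hasDerivAt_rate {W : ℝ → ℂ} (hW : ∀ β, IsOuterRoot (t * β) z (W β))
    (hlt : ‖z - W α‖ < ‖W α‖) :
    HasDerivAt (fun β => rate β z (W β)) (Real.log ‖W α‖) α := by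
  have hd := hasDerivAt_outerRoot hW hlt
  have h0 : W α ≠ 0 := norm_pos_iff.1 ((norm_nonneg _).trans_lt hlt)
  have hne : 2 * W α - z ≠ 0 := fun h => by
    have : z - W α = W α := by linear_combination -h
    rw [this] at hlt
    exact lt_irrefl _ hlt
  have h1 := (hasDerivAt_id' α).fun_mul (HasDerivAt.log_norm hd h0)
  have h2 := ((hasDerivAt_id' α).div_const 2).fun_mul
    (HasDerivAt.complex_re ((hd.const_sub z).fun_div hd h0))
  have h3 := h1.fun_add h2
  unfold rate
  refine h3.congr_deriv ?_
  set D := -(t : ℂ) / (2 * W α - z) with hD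
  have hDe : D * (2 * W α - z) = -t := div_mul_cancel₀ _ hne
  have hroot := (hW α).1
  push_cast at hroot
  -- All terms of the derivative other than `log |ω|`, before taking real parts.
  have key : (α : ℂ) * (D / W α) + 1 / 2 * ((z - W α) / W α)
      + α / 2 * ((-D * W α - (z - W α) * D) / W α ^ 2) = 0 := by
    field_simp
    linear_combination α * hDe + hroot
  have hre := congrArg Complex.re key
  have e1 : ((α : ℂ) * (D / W α)).re = α * (D / W α).re := Complex.re_ofReal_mul _ _
  have e2 : ((1 : ℂ) / 2 * ((z - W α) / W α)).re = 1 / 2 * ((z - W α) / W α).re := by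
    rw [← Complex.re_ofReal_mul]; push_cast; rfl
  have e3 : ((α : ℂ) / 2 * ((-D * W α - (z - W α) * D) / W α ^ 2)).re
      = α / 2 * ((-D * W α - (z - W α) * D) / W α ^ 2).re := by
    rw [← Complex.re_ofReal_mul]; push_cast; rfl
  rw [Complex.add_re, Complex.add_re, e1, e2, e3, Complex.zero_re] at hre
  linarith

/-- The rate on the cut. -/
theorem IsOuterRoot.rate_of_norm_eq (ht : 0 < t) (hα : 0 < α) (h : IsOuterRoot (t * α) z ω)
    (heq : ‖z - ω‖ = ‖ω‖) :
    rate α z ω = α / 2 * Real.log (t * α) + z.re ^ 2 / (4 * t) - α / 2 := by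
  have hτ := mul_pos ht hα
  have hc := h.sub_eq_conj hτ heq
  have h1 := h.norm_mul hτ.le
  rw [heq] at h1
  have hz : z.re = 2 * ω.re := by
    have := congrArg Complex.re hc
    simp at this; linarith
  have hlog : Real.log (t * α) = 2 * Real.log ‖ω‖ := by
    rw [← h1, ← sq, Real.log_pow]; norm_num
  have hsq : ω.re * ω.re + ω.im * ω.im = t * α := by
    rw [← Complex.normSq_apply, Complex.normSq_eq_norm_sq, sq, h1]
  rw [rate, hc, hlog, hz, Complex.div_re, Complex.normSq_apply, hsq, Complex.conj_re,
    Complex.conj_im]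
  field_simp
  linear_combination -4 * hsq

/-- The two roots have equal modulus only if `z` lies on the cut. -/
theorem IsOuterRoot.norm_eq_iff (hτ : 0 < τ) (h : IsOuterRoot τ z ω) :
    ‖z - ω‖ = ‖ω‖ ↔ z.im = 0 ∧ z.re ^ 2 ≤ 4 * τ := by
  constructor
  · intro heq
    have hc := h.sub_eq_conj hτ heq
    have hre := congrArg Complex.re hc
    have him := congrArg Complex.im hc
    simp only [Complex.sub_re, Complex.sub_im, Complex.conj_re, Complex.conj_im] at hre him
    refine ⟨by linarith, ?_⟩
    have h1 := h.norm_mul hτ.le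
    rw [heq, ← sq, ← Complex.normSq_eq_norm_sq, Complex.normSq_apply] at h1
    have : z.re = 2 * ω.re := by linarith
    rw [this]; nlinarith [mul_self_nonneg ω.im]
  · rintro ⟨him, hle⟩
    have hs : Real.sqrt (4 * τ - z.re ^ 2) ^ 2 = 4 * τ - z.re ^ 2 :=
      Real.sq_sqrt (by linarith)
    set b := Real.sqrt (4 * τ - z.re ^ 2)
    set v : ℂ := ⟨z.re / 2, b / 2⟩ with hv
    have hzv : z - v = (starRingEnd ℂ) v := by
      apply Complex.ext
      · simp [hv]; ring
      · simp [hv, him]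
    have hv' : IsOuterRoot τ z v := by
      refine ⟨?_, by rw [hzv, RCLike.norm_conj]⟩
      rw [hzv, Complex.mul_conj, Complex.normSq_apply]
      simp only [hv]
      have : z.re / 2 * (z.re / 2) + b / 2 * (b / 2) = τ := by nlinarith
      rw [this]
    rcases hv'.eq_or_eq h with rfl | rfl
    · rw [hzv, RCLike.norm_conj]
    · rw [sub_sub_cancel, hzv, RCLike.norm_conj]

/-- On the cut `W` may jump between the two conjugate roots. For `β` near `α` it is close to one of
them, and the rate has the same value at both. -/
theorem continuousAt_rate {W : ℝ → ℂ} (hW : ∀ β, IsOuterRoot (t * β) z (W β)) (ht : 0 < t)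
    (hα : 0 < α) : ContinuousAt (fun β => rate β z (W β)) α := by
  have hτ := mul_pos ht hα
  rcases (hW α).2.lt_or_eq with hlt | heq
  · exact (hasDerivAt_rate hW hlt).continuousAt
  have h0 : W α ≠ 0 := (hW α).ne_zero hτ
  have h0' : z - W α ≠ 0 := norm_pos_iff.1 (heq ▸ norm_pos_iff.2 h0)
  have hother : IsOuterRoot (t * α) z (z - W α) :=
    ⟨by rw [← (hW α).1]; ring, by rw [sub_sub_cancel, heq]⟩
  have hG : ∀ v : ℂ, v ≠ 0 → ContinuousAt (fun q : ℝ × ℂ => rate q.1 z q.2) (α, v) := by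
    intro v hv
    unfold rate
    have h1 : ContinuousAt (fun q : ℝ × ℂ => Real.log ‖q.2‖) (α, v) :=
      ContinuousAt.log (by fun_prop) (by simpa using hv)
    have h2 : ContinuousAt (fun q : ℝ × ℂ => ((z - q.2) / q.2).re) (α, v) :=
      Complex.continuous_re.continuousAt.comp
        (ContinuousAt.div (by fun_prop) (by fun_prop) hv)
    exact (continuousAt_fst.mul h1).add ((continuousAt_fst.div_const 2).mul h2)
  rw [Metric.continuousAt_iff]
  intro ε hε
  obtain ⟨δ₁, hδ₁, H1⟩ := Metric.continuousAt_iff.1 (hG _ h0) ε hε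
  obtain ⟨δ₂, hδ₂, H2⟩ := Metric.continuousAt_iff.1 (hG _ h0') ε hε
  set δ := min δ₁ δ₂ with hδ
  have hδ0 : 0 < δ := lt_min hδ₁ hδ₂
  -- The product of the distances from `W β` to the two roots is `t |β - α|`; if this is below `δ²`,
  -- one distance is below `δ`.
  refine ⟨min δ (δ ^ 2 / t), lt_min hδ0 (by positivity), fun {β} hβ => ?_⟩
  have hb1 : |β - α| < δ := hβ.trans_le (min_le_left _ _)
  have hb2 : |β - α| < δ ^ 2 / t := hβ.trans_le (min_le_right _ _)
  rw [lt_div_iff₀ ht] at hb2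
  have e := congrArg norm ((hW α).sub_mul_sub (hW β))
  rw [_root_.norm_mul, ← Complex.ofReal_sub, Complex.norm_real, Real.norm_eq_abs, ← mul_sub,
    abs_mul, abs_of_pos ht, abs_sub_comm] at e
  have hor : ‖W β - W α‖ < δ ∨ ‖W β - (z - W α)‖ < δ := by
    by_contra hcon
    push Not at hcon
    have := mul_le_mul hcon.1 hcon.2 hδ0.le (norm_nonneg _)
    nlinarith
  rcases hor with h | h
  · exact H1 (x := (β, W β)) (by
      rw [Prod.dist_eq]
      exact max_lt (hb1.trans_le (min_le_left _ _))
        (by rw [dist_eq_norm]; exact h.trans_le (min_le_left _ _)))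
  · have := H2 (x := (β, W β)) (by
      rw [Prod.dist_eq]
      exact max_lt (hb1.trans_le (min_le_right _ _))
        (by rw [dist_eq_norm]; exact h.trans_le (min_le_right _ _)))
    simpa only [(hW α).rate_eq hother α] using this

/-- From `t β ≤ |ω|²` and `|ω| ≤ |z| + √(t β)` the term `β log |ω|` is squeezed between quantities
of order `β log β` and `β`. -/
theorem tendsto_rate_zero {W : ℝ → ℂ} (hW : ∀ β, IsOuterRoot (t * β) z (W β)) (ht : 0 < t) :
    Tendsto (fun β => rate β z (W β)) (𝓝[>] 0) (𝓝 0) := by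
  have hre : ∀ β, |((z - W β) / W β).re| ≤ 1 := fun β =>
    (Complex.abs_re_le_norm _).trans (by
      rw [norm_div]; exact div_le_one_of_le₀ (hW β).2 (norm_nonneg _))
  have hid : Tendsto (fun β : ℝ => β) (𝓝[>] 0) (𝓝 0) := tendsto_id.mono_left nhdsWithin_le_nhds
  have hlow : Tendsto (fun β : ℝ => β / 2 * Real.log t + 1 / 2 * (Real.log β * β) - β / 2)
      (𝓝[>] 0) (𝓝 0) := by
    have h1 : Tendsto (fun β : ℝ => Real.log β * β) (𝓝[>] 0) (𝓝 0) := by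
      simpa only [Real.rpow_one] using tendsto_log_mul_rpow_nhdsGT_zero zero_lt_one
    have := (((hid.div_const 2).mul_const (Real.log t)).add (h1.const_mul (1 / 2))).sub
      (hid.div_const 2)
    simpa using this
  have hup : Tendsto (fun β : ℝ => β * (‖z‖ + Real.sqrt (t * β)) + β / 2) (𝓝[>] 0) (𝓝 0) := by
    have : Continuous fun β : ℝ => β * (‖z‖ + Real.sqrt (t * β)) + β / 2 := by fun_prop
    have h := this.tendsto 0
    simp only [zero_mul, zero_div, add_zero] at h
    exact h.mono_left nhdsWithin_le_nhds
  refine tendsto_of_tendsto_of_tendsto_of_le_of_le' hlow hup ?_ ?_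
  · filter_upwards [self_mem_nhdsWithin] with β hβ
    have hβ : 0 < β := hβ
    have hτ := mul_pos ht hβ
    have h1 := Real.log_le_log hτ ((hW β).le_norm_sq hτ.le)
    rw [Real.log_mul ht.ne' hβ.ne', Real.log_pow] at h1
    push_cast at h1
    have h2 := (abs_le.1 (hre β)).1
    unfold rate
    nlinarith
  · filter_upwards [self_mem_nhdsWithin] with β hβ
    have hβ : 0 < β := hβ
    have hτ := mul_pos ht hβ
    have h1 := Real.log_le_self (norm_nonneg (W β))
    have h2 := (abs_le.1 (hre β)).2
    have h3 := (hW β).norm_le hτ.le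
    unfold rate
    nlinarith

theorem continuousOn_rate {W : ℝ → ℂ} (hW : ∀ β, IsOuterRoot (t * β) z (W β)) (ht : 0 < t) :
    ContinuousOn (fun β => rate β z (W β)) (Ici 0) := by
  intro β hβ
  rcases (mem_Ici.1 hβ).eq_or_lt with rfl | hβ
  · rw [← continuousWithinAt_Ioi_iff_Ici, ContinuousWithinAt]
    simpa [rate] using tendsto_rate_zero hW ht
  · exact (continuousAt_rate hW ht hβ).continuousWithinAt

/-! ### Ellipses -/

/-- The quadratic form `u² / A² + v² / B²` at `z = u + i v`. -/
noncomputable def ellipseNorm (A B : ℝ) (z : ℂ) : ℝ := z.re ^ 2 / A ^ 2 + z.im ^ 2 / B ^ 2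

theorem ellipseNorm_smaller {A B A' B' x y : ℝ} {z : ℂ} (hxy : x ^ 2 + y ^ 2 = 1)
    (hre : z.re = x * A') (him : z.im = y * B') (hA' : 0 ≤ A') (hB' : 0 ≤ B') (hA : A' < A)
    (hB : B' < B) : ellipseNorm A B z < 1 := by
  have hA0 : 0 < A := hA'.trans_lt hA
  have hB0 : 0 < B := hB'.trans_lt hB
  have h1 : A' ^ 2 / A ^ 2 < 1 := by
    rw [div_lt_one (by positivity)]; exact pow_lt_pow_left₀ hA hA' two_ne_zero
  have h2 : B' ^ 2 / B ^ 2 < 1 := by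
    rw [div_lt_one (by positivity)]; exact pow_lt_pow_left₀ hB hB' two_ne_zero
  rw [ellipseNorm, hre, him, mul_pow, mul_pow, mul_div_assoc, mul_div_assoc]
  rcases (sq_nonneg x).eq_or_lt with hx | hx
  · have : y ^ 2 = 1 := by linarith
    rw [← hx, this]; linarith
  · nlinarith [sq_nonneg y]

theorem ellipseNorm_larger {A B A' B' x y : ℝ} {z : ℂ} (hxy : x ^ 2 + y ^ 2 = 1)
    (hre : z.re = x * A') (him : z.im = y * B') (hA0 : 0 < A) (hB0 : 0 < B) (hA : A < A')
    (hB : B < B') : 1 < ellipseNorm A B z := by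
  have h1 : 1 < A' ^ 2 / A ^ 2 := by
    rw [one_lt_div (by positivity)]; exact pow_lt_pow_left₀ hA hA0.le two_ne_zero
  have h2 : 1 < B' ^ 2 / B ^ 2 := by
    rw [one_lt_div (by positivity)]; exact pow_lt_pow_left₀ hB hB0.le two_ne_zero
  rw [ellipseNorm, hre, him, mul_pow, mul_pow, mul_div_assoc, mul_div_assoc]
  rcases (sq_nonneg x).eq_or_lt with hx | hx
  · have : y ^ 2 = 1 := by linarith
    rw [← hx, this]; linarith
  · nlinarith [sq_nonneg y]

theorem ellipseNorm_eq_one {A B x y : ℝ} {z : ℂ} (hxy : x ^ 2 + y ^ 2 = 1)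
    (hre : z.re = x * A) (him : z.im = y * B) (hA0 : 0 < A) (hB0 : 0 < B) :
    ellipseNorm A B z = 1 := by
  rw [ellipseNorm, hre, him, mul_pow, mul_pow, mul_div_assoc, mul_div_assoc,
    div_self (by positivity), div_self (by positivity)]
  linarith

theorem re_div_norm_sq_add {w : ℂ} (hw : w ≠ 0) : (w.re / ‖w‖) ^ 2 + (w.im / ‖w‖) ^ 2 = 1 := by
  have h : 0 < ‖w‖ ^ 2 := by positivity
  rw [div_pow, div_pow, ← add_div, div_eq_one_iff_eq h.ne', ← Complex.normSq_eq_norm_sq,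
    Complex.normSq_apply]
  ring

/-- The map `w ↦ w + c/w` takes the circle of radius `s` to the ellipse with half-axes `s ± c/s` and
keeps the direction cosines as parameters. -/
theorem re_add_mul_div {w : ℂ} (hw : w ≠ 0) (c : ℝ) :
    (w + c / w).re = w.re / ‖w‖ * (‖w‖ + c / ‖w‖) ∧
    (w + c / w).im = w.im / ‖w‖ * (‖w‖ - c / ‖w‖) := by
  have h : ‖w‖ ≠ 0 := norm_ne_zero_iff.2 hw
  rw [Complex.add_re, Complex.add_im, Complex.div_re, Complex.div_im, Complex.normSq_eq_norm_sq]
  simp only [Complex.ofReal_re, Complex.ofReal_im]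
  constructor <;> field_simp <;> ring

theorem transport_eq (g : ℝ → ℝ) (t : ℝ) (w : ℂ) :
    transport g t w = w + ((t * alphaZero g w : ℝ) : ℂ) / w := by
  rw [transport]; push_cast; ring

variable {g : ℝ → ℝ} {L t : ℝ}

/-- The ellipse parametrised by the circle of radius `s` under the transport map. -/
noncomputable def semiAxis (g : ℝ → ℝ) (t s : ℝ) : ℝ := s + t * ratio g s

theorem transport_re_im {w : ℂ} (hw : w ≠ 0) :
    (transport g t w).re = w.re / ‖w‖ * semiAxis g t ‖w‖ ∧
    (transport g t w).im = w.im / ‖w‖ * semiAxis g (-t) ‖w‖ := by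
  rw [transport_eq]
  obtain ⟨h1, h2⟩ := re_add_mul_div hw (t * alphaZero g w)
  rw [h1, h2, semiAxis, semiAxis, ratio, alphaZero_norm]
  constructor <;> ring

namespace IsProfile

/-- Both signs of `t` are allowed because the second half-axis is `semiAxis g (-t)`. Strict growth
of the two half-axes makes the image ellipses nested. -/
theorem semiAxis_sub_ge (hg : IsProfile g) (hL : IsSlopeBound g L) {r s : ℝ} (hr : 0 ≤ r)
    (hrs : r ≤ s) : (1 - |t| * L) * (s - r) ≤ semiAxis g t s - semiAxis g t r := by
  have h := hg.abs_ratio_sub_le hL r s hr hrs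
  have h2 : |t * (ratio g s - ratio g r)| ≤ |t| * (L * (s - r)) := by
    rw [abs_mul]; exact mul_le_mul_of_nonneg_left h (abs_nonneg t)
  have := (abs_le.1 h2).1
  unfold semiAxis
  linarith

theorem semiAxis_lt (hg : IsProfile g) (hL : IsSlopeBound g L) (htL : |t| * L < 1) {r s : ℝ}
    (hr : 0 ≤ r) (hrs : r < s) : semiAxis g t r < semiAxis g t s := by
  have := hg.semiAxis_sub_ge hL (t := t) hr hrs.le
  nlinarith

theorem semiAxis_pos (hg : IsProfile g) (hL : IsSlopeBound g L) (htL : |t| * L < 1) {s : ℝ}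
    (hs : 0 < s) : 0 < semiAxis g t s := by
  simpa [semiAxis] using hg.semiAxis_lt hL htL le_rfl hs

theorem ellipseNorm_transport_lt (hg : IsProfile g) (hL : IsSlopeBound g L) (ht : 0 ≤ t)
    (htL : t * L < 1) {w : ℂ} {s : ℝ} (h : ‖w‖ < s) :
    ellipseNorm (semiAxis g t s) (semiAxis g (-t) s) (transport g t w) < 1 := by
  have h1 : |t| * L < 1 := by rwa [abs_of_nonneg ht]
  have h2 : |-t| * L < 1 := by rwa [abs_neg]
  rcases eq_or_ne w 0 with rfl | hw
  · simp [ellipseNorm]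
  obtain ⟨hre, him⟩ := transport_re_im (g := g) (t := t) hw
  exact ellipseNorm_smaller (re_div_norm_sq_add hw) hre him
    (hg.semiAxis_pos hL h1 (norm_pos_iff.2 hw)).le (hg.semiAxis_pos hL h2 (norm_pos_iff.2 hw)).le
    (hg.semiAxis_lt hL h1 (norm_nonneg _) h) (hg.semiAxis_lt hL h2 (norm_nonneg _) h)

theorem ellipseNorm_transport_gt (hg : IsProfile g) (hL : IsSlopeBound g L) (ht : 0 ≤ t)
    (htL : t * L < 1) {w : ℂ} {s : ℝ} (hs : 0 < s) (h : s < ‖w‖) :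
    1 < ellipseNorm (semiAxis g t s) (semiAxis g (-t) s) (transport g t w) := by
  have h1 : |t| * L < 1 := by rwa [abs_of_nonneg ht]
  have h2 : |-t| * L < 1 := by rwa [abs_neg]
  have hw : w ≠ 0 := norm_pos_iff.1 (hs.trans h)
  obtain ⟨hre, him⟩ := transport_re_im (g := g) (t := t) hw
  exact ellipseNorm_larger (re_div_norm_sq_add hw) hre him
    (hg.semiAxis_pos hL h1 hs) (hg.semiAxis_pos hL h2 hs)
    (hg.semiAxis_lt hL h1 hs.le h) (hg.semiAxis_lt hL h2 hs.le h)

theorem ellipseNorm_transport_eq (hg : IsProfile g) (hL : IsSlopeBound g L) (ht : 0 ≤ t)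
    (htL : t * L < 1) {w : ℂ} {s : ℝ} (hs : 0 < s) (h : ‖w‖ = s) :
    ellipseNorm (semiAxis g t s) (semiAxis g (-t) s) (transport g t w) = 1 := by
  have h1 : |t| * L < 1 := by rwa [abs_of_nonneg ht]
  have h2 : |-t| * L < 1 := by rwa [abs_neg]
  subst h
  have hw : w ≠ 0 := norm_pos_iff.1 hs
  obtain ⟨hre, him⟩ := transport_re_im (g := g) (t := t) hw
  exact ellipseNorm_eq_one (re_div_norm_sq_add hw) hre him
    (hg.semiAxis_pos hL h1 hs) (hg.semiAxis_pos hL h2 hs)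

theorem transport_mem_ellipse_iff (hg : IsProfile g) (hL : IsSlopeBound g L) (ht : 0 ≤ t)
    (htL : t * L < 1) {w : ℂ} {s : ℝ} (hs : 0 < s) :
    transport g t w ∈ ellipse g s t ↔ ‖w‖ ≤ s := by
  have e : transport g t w ∈ ellipse g s t ↔
      ellipseNorm (semiAxis g t s) (semiAxis g (-t) s) (transport g t w) ≤ 1 := by
    simp only [ellipse, ellipseNorm, semiAxis, ratio, mem_ofPred_eq, neg_mul, ← sub_eq_add_neg]
  rw [e]
  rcases lt_trichotomy ‖w‖ s with h | h | h
  · exact iff_of_true (hg.ellipseNorm_transport_lt hL ht htL h).le h.le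
  · exact iff_of_true (hg.ellipseNorm_transport_eq hL ht htL hs h).le h.le
  · exact iff_of_false (not_le.2 (hg.ellipseNorm_transport_gt hL ht htL hs h)) (not_le.2 h)

theorem transport_of_norm_le_innerRadius (hg : IsProfile g) {w : ℂ} (hw : ‖w‖ ≤ innerRadius g) :
    transport g t w = w := by
  simp [transport, hg.alphaZero_of_norm_le_innerRadius hw]

theorem transport_mem_domain_iff (hg : IsProfile g) (hL : IsSlopeBound g L) (ht : 0 ≤ t)
    (htL : t * L < 1) {w : ℂ} :
    transport g t w ∈ domain g t ↔ ‖w‖ ∈ Ioo (innerRadius g) (outerRadius g) := by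
  have h1 : |-t| * L < 1 := by rwa [abs_neg, abs_of_nonneg ht]
  have hro := hg.outerRadius_pos
  have e : transport g t w ∈ domain g t ↔ innerRadius g ^ 2 < ‖transport g t w‖ ^ 2 ∧
      ellipseNorm (semiAxis g t (outerRadius g)) (semiAxis g (-t) (outerRadius g))
        (transport g t w) < 1 := by
    simp only [domain, ellipseNorm, semiAxis, hg.ratio_of_outerRadius_le le_rfl, mem_ofPred_eq,
      neg_mul, ← sub_eq_add_neg, one_div]
    rw [← Complex.normSq_eq_norm_sq, Complex.normSq_apply, sq (transport g t w).re,
      sq (transport g t w).im]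
  have hsq : innerRadius g ^ 2 < ‖transport g t w‖ ^ 2 ↔ innerRadius g < ‖transport g t w‖ :=
    pow_lt_pow_iff_left₀ hg.innerRadius_nonneg (norm_nonneg _) two_ne_zero
  rw [e, hsq]
  constructor
  · rintro ⟨ha, hb⟩
    constructor
    · by_contra hcon
      rw [not_lt] at hcon
      rw [hg.transport_of_norm_le_innerRadius hcon] at ha
      exact absurd ha (not_lt.2 hcon)
    · by_contra hcon
      rcases (not_lt.1 hcon).eq_or_lt with h | h
      · exact absurd (hg.ellipseNorm_transport_eq hL ht htL hro h.symm) hb.ne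
      · exact absurd (hg.ellipseNorm_transport_gt hL ht htL hro h) (not_lt.2 hb.le)
  · rintro ⟨ha, hb⟩
    refine ⟨?_, hg.ellipseNorm_transport_lt hL ht htL hb⟩
    -- The modulus of `T_t(w)` is at least the shorter half-axis at `|w|`. This exceeds the shorter
    -- half-axis at the inner radius, which is the inner radius itself because `α₀` vanishes there.
    have h2 := hg.semiAxis_lt hL h1 hg.innerRadius_nonneg ha
    rw [semiAxis, semiAxis, hg.ratio_of_le_innerRadius hg.innerRadius_nonneg le_rfl, ratio,
      alphaZero_norm] at h2
    have h3 : ‖w‖ - ‖(t : ℂ) * ((alphaZero g w : ℂ) / w)‖ ≤ ‖transport g t w‖ := by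
      have := norm_sub_norm_le w (-((t : ℂ) * ((alphaZero g w : ℂ) / w)))
      rwa [norm_neg, sub_neg_eq_add] at this
    rw [norm_mul, Complex.norm_real, Real.norm_of_nonneg ht, norm_div, Complex.norm_real,
      Real.norm_of_nonneg (hg.alphaZero_mem w).1] at h3
    linarith

/-! ### Outer roots along the transport map -/

/-- The circle of radius `radius α` stays outside the critical circle `|ω| = √(t α)`, so that its
image under `ω ↦ ω + t α/ω` is a nondegenerate ellipse. -/
theorem mul_lt_radius_sq (hg : IsProfile g) (hL : IsSlopeBound g L) (htL : t * L < 1) (ht : 0 ≤ t)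
    {α : ℝ} (hα : α ∈ Ioo (0 : ℝ) 1) : t * α < radius g α ^ 2 := by
  have h := mul_le_mul_of_nonneg_left (hg.le_slopeBound_mul_radius hL hα) ht
  have := radius_pos g α
  have h2 : 0 < radius g α ^ 2 := by positivity
  nlinarith

theorem semiAxis_radius (hg : IsProfile g) {α : ℝ} (hα : α ∈ Ioo (0 : ℝ) 1) :
    semiAxis g t (radius g α) = radius g α + t * α / radius g α := by
  rw [semiAxis, hg.ratio_radius hα, mul_div_assoc]

end IsProfile

theorem joukowski_lt {τ r s : ℝ} (hr : 0 < r) (hτ : τ ≤ r ^ 2) (hrs : r < s) :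
    r + τ / r < s + τ / s := by
  have hs := hr.trans hrs
  rw [← sub_pos]
  have : s + τ / s - (r + τ / r) = (s - r) * (r * s - τ) / (r * s) := by field_simp; ring
  rw [this]
  have : τ < r * s := by nlinarith
  exact div_pos (mul_pos (sub_pos.2 hrs) (sub_pos.2 this)) (by positivity)

namespace IsOuterRoot

variable {τ s : ℝ} {z ω : ℂ}

theorem ellipseNorm_lt (h : IsOuterRoot τ z ω) (hτ : 0 ≤ τ) (hlt : ‖ω‖ < s) :
    ellipseNorm (s + τ / s) (s - τ / s) z < 1 := by
  have hs : 0 < s := (norm_nonneg _).trans_lt hlt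
  rcases eq_or_ne ω 0 with rfl | hω
  · have : z = 0 := by simpa using h.2
    simp [this, ellipseNorm]
  obtain ⟨hre, him⟩ := re_add_mul_div hω τ
  rw [← h.eq_add_div hω] at hre him
  have hp := norm_pos_iff.2 hω
  have hsq := h.le_norm_sq hτ
  have h1 : τ / ‖ω‖ ≤ ‖ω‖ := by rw [div_le_iff₀ hp]; linarith
  refine ellipseNorm_smaller (re_div_norm_sq_add hω) hre him (by positivity) (by linarith)
    (joukowski_lt hp hsq hlt) ?_
  have : τ / s ≤ τ / ‖ω‖ := div_le_div_of_nonneg_left hτ hp hlt.le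
  linarith

theorem ellipseNorm_gt (h : IsOuterRoot τ z ω) (hτ : 0 ≤ τ) (hs : 0 < s) (hτs : τ < s ^ 2)
    (hlt : s < ‖ω‖) : 1 < ellipseNorm (s + τ / s) (s - τ / s) z := by
  have hp : 0 < ‖ω‖ := hs.trans hlt
  have hω : ω ≠ 0 := norm_pos_iff.1 hp
  obtain ⟨hre, him⟩ := re_add_mul_div hω τ
  rw [← h.eq_add_div hω] at hre him
  have h1 : τ / s < s := by rw [div_lt_iff₀ hs]; linarith
  refine ellipseNorm_larger (re_div_norm_sq_add hω) hre him (by positivity) (by linarith)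
    (joukowski_lt hs hτs.le hlt) ?_
  have : τ / ‖ω‖ ≤ τ / s := div_le_div_of_nonneg_left hτ hs hlt.le
  linarith

theorem ellipseNorm_eq (h : IsOuterRoot τ z ω) (hτ : 0 ≤ τ) (hs : 0 < s) (hτs : τ < s ^ 2)
    (heq : ‖ω‖ = s) : ellipseNorm (s + τ / s) (s - τ / s) z = 1 := by
  subst heq
  have hω : ω ≠ 0 := norm_pos_iff.1 hs
  obtain ⟨hre, him⟩ := re_add_mul_div hω τ
  rw [← h.eq_add_div hω] at hre him
  have h1 : τ / ‖ω‖ < ‖ω‖ := by rw [div_lt_iff₀ hs]; linarith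
  exact ellipseNorm_eq_one (re_div_norm_sq_add hω) hre him (by positivity) (by linarith)

end IsOuterRoot

/-! ### Comparison of the outer root with the preimage under the transport map -/

namespace IsProfile

/-- On the circle of radius `radius α` one has `α₀ = α`, so `T_t` and `ω ↦ ω + t α/ω` have the same
ellipse as image. Whether `z = T_t(w)` lies inside, on or outside it can be read off from `|w|` or
from `|ω|`, with the same answer. -/
theorem norm_outerRoot_cmp (hg : IsProfile g) (hL : IsSlopeBound g L) (ht : 0 ≤ t)
    (htL : t * L < 1) {α : ℝ} (hα : α ∈ Ioo (0 : ℝ) 1) {w ω : ℂ}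
    (hω : IsOuterRoot (t * α) (transport g t w) ω) :
    (‖ω‖ < radius g α ↔ ‖w‖ < radius g α) ∧ (radius g α < ‖ω‖ ↔ radius g α < ‖w‖) := by
  have hs := radius_pos g α
  have hτ : 0 ≤ t * α := mul_nonneg ht hα.1.le
  have hτs := hg.mul_lt_radius_sq hL htL ht hα
  have e1 := hg.semiAxis_radius (t := t) hα
  have e2 := hg.semiAxis_radius (t := -t) hα
  rw [neg_mul, neg_div, ← sub_eq_add_neg] at e2
  have A1 := hω.ellipseNorm_lt hτ (s := radius g α)
  have A2 := hω.ellipseNorm_gt hτ hs hτs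
  have A3 := hω.ellipseNorm_eq hτ hs hτs
  have B1 := hg.ellipseNorm_transport_lt hL ht htL (w := w) (s := radius g α)
  have B2 := hg.ellipseNorm_transport_gt hL ht htL (w := w) hs
  have B3 := hg.ellipseNorm_transport_eq hL ht htL (w := w) hs
  rw [e1, e2] at B1 B2 B3
  rcases lt_trichotomy ‖ω‖ (radius g α) with h | h | h <;>
  rcases lt_trichotomy ‖w‖ (radius g α) with h' | h' | h'
  · exact ⟨iff_of_true h h', iff_of_false h.not_gt h'.not_gt⟩
  · have := A1 h; have := B3 h'; exfalso; linarith
  · have := A1 h; have := B2 h'; exfalso; linarith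
  · have := A3 h; have := B1 h'; exfalso; linarith
  · exact ⟨iff_of_false h.not_lt h'.not_lt, iff_of_false h.not_gt h'.not_gt⟩
  · have := A3 h; have := B2 h'; exfalso; linarith
  · have := A2 h; have := B1 h'; exfalso; linarith
  · have := A2 h; have := B3 h'; exfalso; linarith
  · exact ⟨iff_of_false h.not_gt h'.not_gt, iff_of_true h h'⟩

theorem lt_alphaZero_iff_outerRoot (hg : IsProfile g) (hL : IsSlopeBound g L) (ht : 0 ≤ t)
    (htL : t * L < 1) {α : ℝ} (hα : α ∈ Ioo (0 : ℝ) 1) {w ω : ℂ}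
    (hω : IsOuterRoot (t * α) (transport g t w) ω) :
    α < alphaZero g w ↔ radius g α < ‖ω‖ := by
  rw [hg.lt_alphaZero_iff w hα, (hg.norm_outerRoot_cmp hL ht htL hα hω).2]

theorem alphaZero_lt_iff_outerRoot (hg : IsProfile g) (hL : IsSlopeBound g L) (ht : 0 ≤ t)
    (htL : t * L < 1) {α : ℝ} (hα : α ∈ Ioo (0 : ℝ) 1) {w ω : ℂ}
    (hω : IsOuterRoot (t * α) (transport g t w) ω) :
    alphaZero g w < α ↔ ‖ω‖ < radius g α := by
  rw [hg.alphaZero_lt_iff w hα, (hg.norm_outerRoot_cmp hL ht htL hα hω).1]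

theorem outerRoot_strict (hg : IsProfile g) (hL : IsSlopeBound g L) (ht : 0 ≤ t)
    (htL : t * L < 1) {α : ℝ} (hα : α ∈ Ioo (0 : ℝ) 1) {w ω : ℂ}
    (hω : IsOuterRoot (t * α) (transport g t w) ω) (h : α < alphaZero g w) :
    ‖transport g t w - ω‖ < ‖ω‖ := by
  have h1 := (hg.lt_alphaZero_iff_outerRoot hL ht htL hα hω).1 h
  have h2 := hω.norm_sub_sq_le (mul_nonneg ht hα.1.le)
  have h3 := hg.mul_lt_radius_sq hL htL ht hα
  exact (lt_of_pow_lt_pow_left₀ 2 (radius_pos g α).le (h2.trans_lt h3)).trans h1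

/-- The point `w` itself is an outer root at `α₀(w)`. -/
theorem isOuterRoot_self (hg : IsProfile g) (hL : IsSlopeBound g L) (ht : 0 ≤ t)
    (htL : t * L < 1) (w : ℂ) : IsOuterRoot (t * alphaZero g w) (transport g t w) w := by
  rcases eq_or_ne w 0 with rfl | hw
  · simp [IsOuterRoot]
  refine IsOuterRoot.of_eq_add_div (mul_nonneg ht (hg.alphaZero_mem w).1) hw (transport_eq g t w) ?_
  have h1 := mul_le_mul_of_nonneg_left (hg.alphaZero_le hL w) ht
  nlinarith [sq_nonneg ‖w‖]

theorem alphaZero_mul_lt (hg : IsProfile g) (hL : IsSlopeBound g L) (ht : 0 ≤ t)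
    (htL : t * L < 1) {w : ℂ} (hw : w ≠ 0) : t * alphaZero g w < ‖w‖ ^ 2 := by
  have h1 := mul_le_mul_of_nonneg_left (hg.alphaZero_le hL w) ht
  have : 0 < ‖w‖ ^ 2 := by positivity
  nlinarith

end IsProfile

/-! ### Maximizers of `f_t` -/

/-- For real `z` the derivative of `f_t` in `α` is not computed at the level `α = (Re z)² / (4 t)`,
where `z` is an endpoint of the cut. Continuity bridges this one point. -/
theorem strictAntiOn_of_hasDerivAt_neg_off_point {F : ℝ → ℝ} {a b c : ℝ}
    (hF : ContinuousOn F (Icc a b))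
    (hd : ∀ x ∈ Ioo a b, x ≠ c → ∃ d < 0, HasDerivAt F d x) : StrictAntiOn F (Icc a b) := by
  have main : ∀ a' b', a ≤ a' → b' ≤ b → c ∉ Ioo a' b' → StrictAntiOn F (Icc a' b') := by
    intro a' b' ha hb hc
    refine strictAntiOn_of_deriv_neg (convex_Icc _ _) (hF.mono (Icc_subset_Icc ha hb)) ?_
    intro x hx
    rw [interior_Icc] at hx
    obtain ⟨d, hd0, hd⟩ := hd x ⟨ha.trans_lt hx.1, hx.2.trans_le hb⟩ (fun h => hc (h ▸ hx))
    rwa [hd.deriv]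
  by_cases hc : c ∈ Ioo a b
  · rw [← Icc_union_Icc_eq_Icc hc.1.le hc.2.le]
    exact (main a c le_rfl hc.2.le (by simp)).union (main c b hc.1.le le_rfl (by simp))
      (isGreatest_Icc hc.1.le) (isLeast_Icc hc.2.le)
  · exact main a b le_rfl le_rfl hc

namespace IsProfile

theorem fT_continuousOn (hg : IsProfile g) (ht : 0 < t) (z : ℂ) :
    ContinuousOn (fun α => fT g t α z) (Icc 0 1) := by
  have h := hg.continuousOn.add ((continuousOn_rate (W := fun β => outerRoot (t * β) z)
    (fun β => outerRoot_spec _ _) ht).mono fun x (hx : x ∈ Icc (0 : ℝ) 1) => hx.1)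
  exact h.congr fun α hα => fT_eq ht hα.1 (outerRoot_spec _ _)

/-- Off the cut this is `hasDerivAt_rate`. If `z` is interior to the cut, it stays on the cut for
all nearby levels, where `rate_of_norm_eq` gives the rate explicitly; there `log |ω| = (1/2) log (t
α)`. -/
theorem hasDerivAt_fT (hg : IsProfile g) (ht : 0 < t) {z : ℂ} {α : ℝ} (hα : α ∈ Ioo (0 : ℝ) 1)
    (hor : ‖z - outerRoot (t * α) z‖ < ‖outerRoot (t * α) z‖ ∨ α ≠ z.re ^ 2 / (4 * t)) :
    HasDerivAt (fun α => fT g t α z) (deriv g α + Real.log ‖outerRoot (t * α) z‖) α := by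
  have hev : (fun α => fT g t α z) =ᶠ[𝓝 α] fun β => g β + rate β z (outerRoot (t * β) z) := by
    filter_upwards [lt_mem_nhds hα.1] with β hβ using fT_eq ht hβ.le (outerRoot_spec _ _)
  refine HasDerivAt.congr_of_eventuallyEq ?_ hev
  refine (hg.hasDerivAt hα).fun_add ?_
  have hτ : 0 < t * α := mul_pos ht hα.1
  rcases (outerRoot_spec (t * α) z).2.lt_or_eq with hlt | heq
  · exact hasDerivAt_rate (W := fun β => outerRoot (t * β) z) (fun β => outerRoot_spec _ _) hlt
  · have hne := hor.resolve_left heq.not_lt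
    obtain ⟨him, hle⟩ := ((outerRoot_spec (t * α) z).norm_eq_iff hτ).1 heq
    have hlt : z.re ^ 2 / (4 * t) < α := by
      refine lt_of_le_of_ne ?_ hne.symm
      rw [div_le_iff₀ (by positivity)]; linarith
    have hev2 : (fun β => rate β z (outerRoot (t * β) z)) =ᶠ[𝓝 α]
        fun β => β / 2 * Real.log (t * β) + z.re ^ 2 / (4 * t) - β / 2 := by
      filter_upwards [lt_mem_nhds hα.1, lt_mem_nhds hlt] with β hβ hβ'
      refine (outerRoot_spec (t * β) z).rate_of_norm_eq ht hβ ?_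
      refine ((outerRoot_spec (t * β) z).norm_eq_iff (mul_pos ht hβ)).2 ⟨him, ?_⟩
      rw [div_lt_iff₀ (by positivity)] at hβ'
      linarith
    refine HasDerivAt.congr_of_eventuallyEq ?_ hev2
    have h1 : HasDerivAt (fun β => Real.log (t * β)) (t * 1 / (t * α)) α :=
      ((hasDerivAt_id' α).const_mul t).log hτ.ne'
    have h2 := ((((hasDerivAt_id' α).div_const 2).fun_mul h1).add_const
      (z.re ^ 2 / (4 * t))).fun_sub ((hasDerivAt_id' α).div_const 2)
    refine h2.congr_deriv ?_
    have h3 := (outerRoot_spec (t * α) z).norm_mul hτ.le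
    rw [heq] at h3
    rw [← h3, ← sq, Real.log_pow, sq, h3]
    have := hα.1.ne'
    field_simp
    push_cast
    ring

/-- The derivative in `α` is `log (|ω| / radius α)`, and by `norm_outerRoot_cmp` it is positive for
`α < α₀(w)` and negative for `α > α₀(w)`. -/
theorem isUniqueMaximizer_fT (hg : IsProfile g) (hL : IsSlopeBound g L) (ht : 0 < t)
    (htL : t * L < 1) (w : ℂ) :
    IsUniqueMaximizer (fun α => fT g t α (transport g t w)) (alphaZero g w) := by
  set z := transport g t w with hz
  have hm := hg.alphaZero_mem w
  have hc := hg.fT_continuousOn ht z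
  refine isUniqueMaximizer_of_monotone hm ?_ ?_
  · refine strictMonoOn_of_deriv_pos (convex_Icc _ _) (hc.mono (Icc_subset_Icc le_rfl hm.2)) ?_
    intro α hα
    rw [interior_Icc] at hα
    have hα' : α ∈ Ioo (0 : ℝ) 1 := ⟨hα.1, hα.2.trans_le hm.2⟩
    have hω := outerRoot_spec (t * α) z
    rw [(hg.hasDerivAt_fT ht hα' (Or.inl (hg.outerRoot_strict hL ht.le htL hα' hω hα.2))).deriv]
    have := Real.log_lt_log (radius_pos g α)
      ((hg.lt_alphaZero_iff_outerRoot hL ht.le htL hα' hω).1 hα.2)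
    rw [log_radius] at this
    linarith
  · refine strictAntiOn_of_hasDerivAt_neg_off_point (c := z.re ^ 2 / (4 * t))
      (hc.mono (Icc_subset_Icc hm.1 le_rfl)) ?_
    intro α hα hne
    have hα' : α ∈ Ioo (0 : ℝ) 1 := ⟨hm.1.trans_lt hα.1, hα.2⟩
    have hω := outerRoot_spec (t * α) z
    refine ⟨_, ?_, hg.hasDerivAt_fT ht hα' (Or.inr hne)⟩
    have := Real.log_lt_log (norm_pos_iff.2 (hω.ne_zero (mul_pos ht hα'.1)))
      ((hg.alphaZero_lt_iff_outerRoot hL ht.le htL hα' hω).1 hα.1)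
    rw [log_radius] at this
    linarith

theorem alphaT_transport (hg : IsProfile g) (hL : IsSlopeBound g L) (ht : 0 < t)
    (htL : t * L < 1) (w : ℂ) : alphaT g t (transport g t w) = alphaZero g w :=
  (hg.isUniqueMaximizer_fT hL ht htL w).argmaxUnit_eq

theorem UT_transport (hg : IsProfile g) (hL : IsSlopeBound g L) (ht : 0 < t)
    (htL : t * L < 1) (w : ℂ) :
    UT g t (transport g t w) = g (alphaZero g w) + rate (alphaZero g w) (transport g t w) w - g 1 := by
  rw [UT, (hg.isUniqueMaximizer_fT hL ht htL w).iSup_eq,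
    fT_eq ht (hg.alphaZero_mem w).1 (hg.isOuterRoot_self hL ht.le htL w)]

theorem UZero_eq (hg : IsProfile g) {w : ℂ} (hw : w ≠ 0) :
    UZero g w = g (alphaZero g w) + alphaZero g w * Real.log ‖w‖ - g 1 := by
  rw [UZero, (hg.isUniqueMaximizer_alphaZero hw).iSup_eq]

theorem rate_transport (w : ℂ) : rate (alphaZero g w) (transport g t w) w =
    alphaZero g w * Real.log ‖w‖ + alphaZero g w ^ 2 / 2 * ((t : ℂ) / w ^ 2).re := by
  have e : (transport g t w - w) / w = ((alphaZero g w : ℝ) : ℂ) * ((t : ℂ) / w ^ 2) := by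
    rw [transport]
    rcases eq_or_ne w 0 with rfl | hw
    · simp
    · field_simp; ring
  rw [rate, e, Complex.re_ofReal_mul]
  ring

end IsProfile

/-! ### Measures with bounded density and bounded support -/

/-- `ν` is a probability measure with density at most `C`, carried by the ball of radius `R`. -/
structure IsBoundedDensity (ν : Measure ℂ) (C : ℝ) (R : ℝ) : Prop where
  prob : IsProbabilityMeasure ν
  nonneg : 0 ≤ C
  le_volume : ν ≤ ENNReal.ofReal C • volume
  support : ν (Metric.closedBall 0 R)ᶜ = 0

/-- In polar coordinates the Jacobian cancels the singularity. -/
theorem lintegral_ball_inv_norm {δ : ℝ} (hδ : 0 ≤ δ) :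
    ∫⁻ y in Metric.ball (0 : ℂ) δ, ENNReal.ofReal ‖y‖⁻¹ = ENNReal.ofReal (2 * Real.pi * δ) := by
  rw [← lintegral_indicator Metric.isOpen_ball.measurableSet,
    ← Complex.lintegral_comp_polarCoord_symm]
  have h : ∀ p ∈ polarCoord.target, ENNReal.ofReal p.1 •
      (Metric.ball (0 : ℂ) δ).indicator (fun y => ENNReal.ofReal ‖y‖⁻¹) (Complex.polarCoord.symm p)
      = (Ioo 0 δ ×ˢ Ioo (-Real.pi) Real.pi).indicator (fun _ => (1 : ℝ≥0∞)) p := by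
    intro p hp
    rw [polarCoord_target] at hp
    have hp1 : 0 < p.1 := hp.1
    have hn : ‖Complex.polarCoord.symm p‖ = p.1 := by
      rw [Complex.norm_polarCoord_symm, abs_of_pos hp1]
    by_cases h : p.1 < δ
    · rw [indicator_of_mem, indicator_of_mem, hn, smul_eq_mul, ← ENNReal.ofReal_mul hp1.le,
        mul_inv_cancel₀ hp1.ne', ENNReal.ofReal_one]
      · exact ⟨⟨hp1, h⟩, hp.2⟩
      · simpa only [Metric.mem_ball, dist_zero_right, hn] using h
    · rw [indicator_of_notMem, indicator_of_notMem, smul_zero]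
      · exact fun hh => h hh.1.2
      · simpa only [Metric.mem_ball, dist_zero_right, hn] using h
  rw [setLIntegral_congr_fun polarCoord.open_target.measurableSet h,
    lintegral_indicator (measurableSet_Ioo.prod measurableSet_Ioo), setLIntegral_one,
    Measure.restrict_apply (measurableSet_Ioo.prod measurableSet_Ioo), inter_eq_left.2,
    Measure.volume_eq_prod, Measure.prod_prod, Real.volume_Ioo, Real.volume_Ioo,
    ← ENNReal.ofReal_mul (by linarith)]
  · congr 1; ring
  · rw [polarCoord_target]
    exact prod_mono Ioo_subset_Ioi_self subset_rfl

namespace IsBoundedDensity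

variable {ν : Measure ℂ} {C R : ℝ}

theorem lintegral_near (h : IsBoundedDensity ν C R) (z : ℂ) {δ : ℝ} (hδ : 0 ≤ δ) :
    ∫⁻ y in Metric.ball z δ, ENNReal.ofReal ‖z - y‖⁻¹ ∂ν ≤ ENNReal.ofReal (2 * Real.pi * C * δ) := by
  calc ∫⁻ y in Metric.ball z δ, ENNReal.ofReal ‖z - y‖⁻¹ ∂ν
      ≤ ∫⁻ y in Metric.ball z δ, ENNReal.ofReal ‖z - y‖⁻¹ ∂(ENNReal.ofReal C • volume) :=
        lintegral_mono' (Measure.restrict_mono le_rfl h.le_volume) le_rfl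
    _ = ENNReal.ofReal C * ∫⁻ y in Metric.ball z δ, ENNReal.ofReal ‖z - y‖⁻¹ := by
        rw [Measure.restrict_smul, lintegral_smul_measure, smul_eq_mul]
    _ = ENNReal.ofReal C * ENNReal.ofReal (2 * Real.pi * δ) := by
        rw [← lintegral_ball_inv_norm hδ, ← lintegral_indicator Metric.isOpen_ball.measurableSet,
          ← lintegral_indicator Metric.isOpen_ball.measurableSet,
          ← lintegral_sub_left_eq_self _ z]
        congr 2
        funext y
        simp only [indicator, Metric.mem_ball, dist_eq_norm, sub_sub_cancel, sub_sub_cancel_left,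
          norm_neg, sub_zero]
    _ = _ := by rw [← ENNReal.ofReal_mul h.nonneg]; congr 1; ring

/-- The unit disc about `z` contributes at most `2 π C` and its complement at most the total mass.
Uniformity in `z` is what later allows limits under the kernel. -/
theorem lintegral_inv_norm (h : IsBoundedDensity ν C R) (z : ℂ) :
    ∫⁻ y, ENNReal.ofReal ‖z - y‖⁻¹ ∂ν ≤ ENNReal.ofReal (2 * Real.pi * C + 1) := by
  have := h.prob
  have hC : 0 ≤ 2 * Real.pi * C := mul_nonneg Real.two_pi_pos.le h.nonneg
  rw [← lintegral_add_compl _ (Metric.isOpen_ball (x := z) (ε := 1)).measurableSet,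
    ENNReal.ofReal_add hC zero_le_one]
  refine add_le_add (by simpa using h.lintegral_near z zero_le_one) ?_
  calc ∫⁻ y in (Metric.ball z 1)ᶜ, ENNReal.ofReal ‖z - y‖⁻¹ ∂ν
      ≤ ∫⁻ y in (Metric.ball z 1)ᶜ, 1 ∂ν := by
        refine setLIntegral_mono' Metric.isOpen_ball.measurableSet.compl fun y hy => ?_
        rw [← ENNReal.ofReal_one]
        refine ENNReal.ofReal_le_ofReal (inv_le_one_of_one_le₀ ?_)
        rw [mem_compl_iff, Metric.mem_ball, not_lt, dist_comm, dist_eq_norm] at hy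
        exact hy
    _ ≤ _ := by
        rw [setLIntegral_one, ENNReal.ofReal_one]; exact prob_le_one

theorem integrable_inv_norm (h : IsBoundedDensity ν C R) (z : ℂ) :
    Integrable (fun y => ‖z - y‖⁻¹) ν := by
  refine ⟨by fun_prop, ?_⟩
  rw [hasFiniteIntegral_iff_ofReal (Eventually.of_forall fun y => by positivity)]
  exact (h.lintegral_inv_norm z).trans_lt ENNReal.ofReal_lt_top

theorem integral_inv_norm_le (h : IsBoundedDensity ν C R) (z : ℂ) :
    ∫ y, ‖z - y‖⁻¹ ∂ν ≤ 2 * Real.pi * C + 1 := by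
  have hC : 0 ≤ 2 * Real.pi * C := mul_nonneg Real.two_pi_pos.le h.nonneg
  rw [integral_eq_lintegral_of_nonneg_ae (Eventually.of_forall fun y => by positivity)
    (by fun_prop)]
  exact ENNReal.toReal_le_of_le_ofReal (by positivity) (h.lintegral_inv_norm z)

theorem integrable_cauchy (h : IsBoundedDensity ν C R) (z : ℂ) :
    Integrable (fun y => 1 / (z - y)) ν := by
  refine (h.integrable_inv_norm z).mono
    ((measurable_const.div (measurable_const.sub measurable_id)).aestronglyMeasurable) (Eventually.of_forall fun y => ?_)
  simp

theorem ae_norm_le (h : IsBoundedDensity ν C R) : ∀ᵐ y ∂ν, ‖y‖ ≤ R := by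
  filter_upwards [mem_ae_iff.2 h.support] with y hy
  simpa using hy

theorem integrable_of_continuous (h : IsBoundedDensity ν C R) {E : Type*} [NormedAddCommGroup E]
    [NormedSpace ℝ E] [SecondCountableTopology E]
    {f : ℂ → E} (hf : Continuous f) : Integrable f ν := by
  have := h.prob
  obtain ⟨M, hM⟩ := (isCompact_closedBall (0 : ℂ) R).exists_bound_of_continuousOn hf.continuousOn
  refine Integrable.of_bound (hf.aestronglyMeasurable) M ?_
  filter_upwards [h.ae_norm_le] with y hy
  exact hM y (by simpa using hy)

theorem abs_log_norm_le (x : ℂ) : |Real.log ‖x‖| ≤ ‖x‖ + ‖x‖⁻¹ := by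
  rcases eq_or_ne x 0 with rfl | hx
  · simp
  have hp := norm_pos_iff.2 hx
  rw [abs_le]
  have h1 := Real.log_le_self hp.le
  have h2 := Real.log_le_self (inv_pos.2 hp).le
  rw [Real.log_inv] at h2
  have := inv_pos.2 hp
  constructor <;> linarith

theorem measurable_log_norm_sub (z : ℂ) : Measurable fun y : ℂ => Real.log ‖z - y‖ :=
  Real.measurable_log.comp (by fun_prop)

theorem integrable_log (h : IsBoundedDensity ν C R) (z : ℂ) :
    Integrable (fun y => Real.log ‖z - y‖) ν := by
  have h1 : Integrable (fun y => ‖z - y‖) ν := h.integrable_of_continuous (by fun_prop)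
  refine (h1.add (h.integrable_inv_norm z)).mono'
    (measurable_log_norm_sub z).aestronglyMeasurable (Eventually.of_forall fun y => ?_)
  exact abs_log_norm_le _

end IsBoundedDensity

/-- The logarithmic potential of `ν`. -/
noncomputable def logPotential (ν : Measure ℂ) (z : ℂ) : ℝ := ∫ y, Real.log ‖z - y‖ ∂ν

/-- The real-linear functional `v ↦ Re (m v)`, depending linearly on `m`. -/
noncomputable def reMul : ℂ →L[ℝ] ℂ →L[ℝ] ℝ :=
  (ContinuousLinearMap.compL ℝ ℂ ℂ ℝ Complex.reCLM).comp (ContinuousLinearMap.mul ℝ ℂ)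

@[simp] theorem reMul_apply (m v : ℂ) : reMul m v = (m * v).re := rfl

theorem norm_reMul_le (m : ℂ) : ‖reMul m‖ ≤ ‖m‖ :=
  ContinuousLinearMap.opNorm_le_bound _ (norm_nonneg _) fun v => by
    rw [reMul_apply, Real.norm_eq_abs, ← norm_mul]
    exact Complex.abs_re_le_norm _

/-- A bounded continuous approximation of the Cauchy kernel. -/
noncomputable def smoothCauchy (η : ℝ) (x : ℂ) : ℂ :=
  (starRingEnd ℂ) x / ((η ^ 4 + ‖x‖ ^ 2 : ℝ) : ℂ)

/-- The error has modulus `η⁴ / (|x| (η⁴ + |x|²))`. It is always at most `1 / |x|`, and for `|x| ≥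
η` at most `η⁴ / |x|³ ≤ η`, which is the reason for the fourth power. -/
theorem norm_smoothCauchy_sub_le {η : ℝ} (hη : 0 < η) (x : ℂ) :
    ‖smoothCauchy η x - 1 / x‖ ≤ η + if ‖x‖ < η then ‖x‖⁻¹ else 0 := by
  rcases eq_or_ne x 0 with rfl | hx
  · simp [smoothCauchy, hη.le]
  have hp := norm_pos_iff.2 hx
  have hq : 0 < η ^ 4 + ‖x‖ ^ 2 := by positivity
  have e : smoothCauchy η x - 1 / x = ((-η ^ 4 / (η ^ 4 + ‖x‖ ^ 2) : ℝ) : ℂ) * x⁻¹ := by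
    have hc : (starRingEnd ℂ) x = (‖x‖ : ℂ) ^ 2 * x⁻¹ := by
      rw [← Complex.conj_mul', mul_assoc, mul_inv_cancel₀ hx, mul_one]
    have hq' : ((η : ℂ) ^ 4 + (‖x‖ : ℂ) ^ 2) ≠ 0 := by exact_mod_cast hq.ne'
    rw [smoothCauchy, hc]
    push_cast
    field_simp
    ring
  rw [e, norm_mul, Complex.norm_real, norm_inv, Real.norm_eq_abs, abs_div, abs_neg,
    abs_of_pos hq, abs_of_pos (by positivity : 0 < η ^ 4)]
  split_ifs with h
  · have : η ^ 4 / (η ^ 4 + ‖x‖ ^ 2) ≤ 1 := by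
      rw [div_le_one hq]; nlinarith [sq_nonneg ‖x‖]
    have := mul_le_mul_of_nonneg_right this (inv_pos.2 hp).le
    linarith
  · rw [not_lt] at h
    rw [add_zero, ← div_eq_mul_inv, div_div, div_le_iff₀ (by positivity)]
    have h3 : η ^ 3 ≤ ‖x‖ ^ 3 := pow_le_pow_left₀ hη.le h 3
    nlinarith [pow_pos hη 5, mul_pos hη hp, pow_pos hη 4, mul_le_mul_of_nonneg_left h3 hη.le,
      mul_pos (mul_pos hη hp) (pow_pos hη 4)]

theorem continuous_smoothCauchy {η : ℝ} (hη : 0 < η) : Continuous (smoothCauchy η) := by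
  unfold smoothCauchy
  refine Continuous.div (by fun_prop) (by fun_prop) fun x => ?_
  have : 0 < η ^ 4 + ‖x‖ ^ 2 := by positivity
  exact_mod_cast this.ne'

theorem norm_smoothCauchy_le {η : ℝ} (hη : 0 < η) (x : ℂ) : ‖smoothCauchy η x‖ ≤ 1 / η ^ 2 := by
  have hq : 0 < η ^ 4 + ‖x‖ ^ 2 := by positivity
  rw [smoothCauchy, norm_div, RCLike.norm_conj, Complex.norm_real, Real.norm_of_nonneg hq.le,
    div_le_div_iff₀ hq (by positivity)]
  nlinarith [sq_nonneg (η ^ 2 - ‖x‖), norm_nonneg x]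

theorem hasFDerivAt_smoothLog {η : ℝ} (hη : 0 < η) (y z : ℂ) :
    HasFDerivAt (fun z : ℂ => 1 / 2 * Real.log (η ^ 4 + ‖z - y‖ ^ 2))
      (reMul (smoothCauchy η (z - y))) z := by
  have hq : 0 < η ^ 4 + ‖z - y‖ ^ 2 := by positivity
  have h1 : HasFDerivAt (fun z : ℂ => η ^ 4 + ‖z - y‖ ^ 2) _ z :=
    (((hasFDerivAt_id z).sub_const y).norm_sq).const_add (η ^ 4)
  have h2 := (h1.log hq.ne').const_mul (1 / 2 : ℝ)
  refine h2.congr_fderiv ?_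
  ext v
  have e : (reMul (smoothCauchy η (z - y))) v
      = ((starRingEnd ℂ) (z - y) * v).re / (η ^ 4 + ‖z - y‖ ^ 2) := by
    rw [reMul_apply, smoothCauchy, div_mul_eq_mul_div, Complex.div_ofReal_re]
  rw [e]
  simp [Complex.inner]
  ring

/-! ### Regularity of the Stieltjes transform and of the potential -/

namespace IsBoundedDensity

variable {ν : Measure ℂ} {C R : ℝ}

theorem norm_integral_smoothCauchy_sub_le (h : IsBoundedDensity ν C R) {η : ℝ} (hη : 0 < η) (z : ℂ) :
    ‖(∫ y, smoothCauchy η (z - y) ∂ν) - stieltjes ν z‖ ≤ (2 * Real.pi * C + 1) * η := by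
  have := h.prob
  have hC : 0 ≤ 2 * Real.pi * C := mul_nonneg Real.two_pi_pos.le h.nonneg
  rw [stieltjes, ← integral_sub (h.integrable_of_continuous
    (f := fun y => smoothCauchy η (z - y))
    ((continuous_smoothCauchy hη).comp (by fun_prop))) (h.integrable_cauchy z)]
  have hind : (fun y => if ‖z - y‖ < η then ‖z - y‖⁻¹ else 0) =
      (Metric.ball z η).indicator fun y => ‖z - y‖⁻¹ := by
    funext y
    simp only [indicator, Metric.mem_ball, dist_comm y z, dist_eq_norm z y]
  have hint : Integrable (fun y => if ‖z - y‖ < η then ‖z - y‖⁻¹ else 0) ν := by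
    rw [hind]; exact (h.integrable_inv_norm z).indicator Metric.isOpen_ball.measurableSet
  calc _ ≤ ∫ y, (η + if ‖z - y‖ < η then ‖z - y‖⁻¹ else 0) ∂ν :=
        norm_integral_le_of_norm_le ((integrable_const η).add hint)
          (Eventually.of_forall fun y => norm_smoothCauchy_sub_le hη _)
    _ = η + ∫ y in Metric.ball z η, ‖z - y‖⁻¹ ∂ν := by
        rw [integral_add (integrable_const η) hint, integral_const, hind,
          integral_indicator Metric.isOpen_ball.measurableSet]
        simp
    _ ≤ η + 2 * Real.pi * C * η := by
        gcongr
        rw [integral_eq_lintegral_of_nonneg_ae (Eventually.of_forall fun y => by positivity)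
          (by fun_prop)]
        exact ENNReal.toReal_le_of_le_ofReal (by positivity) (h.lintegral_near z hη.le)
    _ = _ := by ring

/-- Near `z` the kernel has small integral by the density bound, uniformly in `z`. Continuity of the
Stieltjes transform and differentiability of the potential both rest on this. -/
theorem tendstoUniformly_smoothCauchy (h : IsBoundedDensity ν C R) :
    TendstoUniformly (fun (n : ℕ) z => ∫ y, smoothCauchy (1 / ((n : ℝ) + 1)) (z - y) ∂ν)
      (stieltjes ν) atTop := by
  rw [Metric.tendstoUniformly_iff]
  intro ε hε
  have hlim : Tendsto (fun n : ℕ => (2 * Real.pi * C + 1) * (1 / ((n : ℝ) + 1))) atTop (𝓝 0) := by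
    simpa using tendsto_one_div_add_atTop_nhds_zero_nat.const_mul (2 * Real.pi * C + 1)
  filter_upwards [hlim.eventually_lt_const hε] with n hn z
  rw [dist_comm, dist_eq_norm]
  exact (h.norm_integral_smoothCauchy_sub_le (by positivity) z).trans_lt hn

theorem continuous_stieltjes (h : IsBoundedDensity ν C R) : Continuous (stieltjes ν) := by
  have := h.prob
  refine h.tendstoUniformly_smoothCauchy.continuous (Frequently.of_forall fun n => ?_)
  have hn : (0 : ℝ) < 1 / ((n : ℝ) + 1) := by positivity
  refine continuous_of_dominated (bound := fun _ => 1 / (1 / ((n : ℝ) + 1)) ^ 2)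
    (fun z => ((continuous_smoothCauchy hn).comp (by fun_prop)).aestronglyMeasurable)
    (fun z => Eventually.of_forall fun y => norm_smoothCauchy_le hn _) (integrable_const _)
    (Eventually.of_forall fun y => (continuous_smoothCauchy hn).comp (by fun_prop))

theorem smoothLog_sub_log_mem {η : ℝ} (hη : 0 < η) {x : ℂ} (hx : x ≠ 0) :
    0 ≤ 1 / 2 * Real.log (η ^ 4 + ‖x‖ ^ 2) - Real.log ‖x‖ ∧
    1 / 2 * Real.log (η ^ 4 + ‖x‖ ^ 2) - Real.log ‖x‖ ≤ η ^ 2 * ‖x‖⁻¹ := by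
  have hp := norm_pos_iff.2 hx
  have h0 : Real.log (‖x‖ ^ 2) = 2 * Real.log ‖x‖ := by rw [Real.log_pow]; norm_num
  constructor
  · have := Real.log_le_log (by positivity) (show ‖x‖ ^ 2 ≤ η ^ 4 + ‖x‖ ^ 2 from le_add_of_nonneg_left (by positivity))
    linarith
  · have h1 : Real.log (η ^ 4 + ‖x‖ ^ 2) ≤ Real.log ((‖x‖ * (1 + η ^ 2 * ‖x‖⁻¹)) ^ 2) := by
      refine Real.log_le_log (by positivity) ?_
      have : ‖x‖ * (1 + η ^ 2 * ‖x‖⁻¹) = ‖x‖ + η ^ 2 := by field_simp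
      rw [this]
      nlinarith [mul_pos hp (pow_pos hη 2)]
    rw [Real.log_pow, Real.log_mul hp.ne' (by positivity)] at h1
    have h2 := Real.log_le_sub_one_of_pos (show 0 < 1 + η ^ 2 * ‖x‖⁻¹ by positivity)
    push_cast at h1
    linarith

theorem ae_ne (h : IsBoundedDensity ν C R) (z : ℂ) : ∀ᵐ y ∂ν, z - y ≠ 0 := by
  have h1 : ν {z} = 0 := le_antisymm (by
    have := h.le_volume {z}
    simpa using this) zero_le
  filter_upwards [(measure_eq_zero_iff_ae_notMem).1 h1] with y hy
  rw [sub_ne_zero]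
  exact fun e => hy (by simp [e])

theorem tendsto_smoothLog (h : IsBoundedDensity ν C R) (z : ℂ) :
    Tendsto (fun n : ℕ => ∫ y, 1 / 2 * Real.log ((1 / ((n : ℝ) + 1)) ^ 4 + ‖z - y‖ ^ 2) ∂ν) atTop
      (𝓝 (logPotential ν z)) := by
  rw [tendsto_iff_norm_sub_tendsto_zero]
  have hlim : Tendsto (fun n : ℕ => (1 / ((n : ℝ) + 1)) ^ 2 * (2 * Real.pi * C + 1)) atTop (𝓝 0) := by
    simpa using (tendsto_one_div_add_atTop_nhds_zero_nat.pow 2).mul_const (2 * Real.pi * C + 1)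
  refine squeeze_zero (fun _ => norm_nonneg _) (fun n => ?_) hlim
  have hn : (0 : ℝ) < 1 / ((n : ℝ) + 1) := by positivity
  have hcont : Continuous fun y : ℂ =>
      1 / 2 * Real.log ((1 / ((n : ℝ) + 1)) ^ 4 + ‖z - y‖ ^ 2) :=
    continuous_const.mul (Continuous.log (by fun_prop) fun y => by positivity)
  rw [logPotential, ← integral_sub (h.integrable_of_continuous hcont) (h.integrable_log z)]
  refine (norm_integral_le_of_norm_le (g := fun y => (1 / ((n : ℝ) + 1)) ^ 2 * ‖z - y‖⁻¹)
    ((h.integrable_inv_norm z).const_mul _) ?_).trans ?_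
  · filter_upwards [h.ae_ne z] with y hy
    obtain ⟨h1, h2⟩ := smoothLog_sub_log_mem hn hy
    rwa [Real.norm_of_nonneg h1]
  · rw [integral_const_mul]
    exact mul_le_mul_of_nonneg_left (h.integral_inv_norm_le z) (by positivity)

/-- The regularised potentials converge pointwise and their derivatives uniformly, so the limit may
be differentiated. -/
theorem hasFDerivAt_logPotential (h : IsBoundedDensity ν C R) (z : ℂ) :
    HasFDerivAt (logPotential ν) (reMul (stieltjes ν z)) z := by
  have := h.prob
  refine hasFDerivAt_of_tendstoUniformly (l := atTop)
    (f := fun (n : ℕ) z => ∫ y, 1 / 2 * Real.log ((1 / ((n : ℝ) + 1)) ^ 4 + ‖z - y‖ ^ 2) ∂ν)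
    (f' := fun (n : ℕ) z => reMul (∫ y, smoothCauchy (1 / ((n : ℝ) + 1)) (z - y) ∂ν)) (g' := fun z => reMul (stieltjes ν z)) ?_ ?_
    h.tendsto_smoothLog z
  · exact reMul.uniformContinuous.comp_tendstoUniformly h.tendstoUniformly_smoothCauchy
  · intro n z
    have hn : (0 : ℝ) < 1 / ((n : ℝ) + 1) := by positivity
    have hcont : ∀ z : ℂ, Continuous fun y : ℂ =>
        1 / 2 * Real.log ((1 / ((n : ℝ) + 1)) ^ 4 + ‖z - y‖ ^ 2) := fun z =>
      continuous_const.mul (Continuous.log (by fun_prop) fun y => by positivity)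
    have hk : Continuous fun y : ℂ => smoothCauchy (1 / ((n : ℝ) + 1)) (z - y) :=
      (continuous_smoothCauchy hn).comp (by fun_prop)
    rw [← ContinuousLinearMap.integral_comp_comm _ (h.integrable_of_continuous hk)]
    refine hasFDerivAt_integral_of_dominated_of_fderiv_le
      (bound := fun _ => 1 / (1 / ((n : ℝ) + 1)) ^ 2)
      (F' := fun z y => reMul (smoothCauchy (1 / ((n : ℝ) + 1)) (z - y))) univ_mem
      (Eventually.of_forall fun z => (hcont z).aestronglyMeasurable)
      (h.integrable_of_continuous (hcont z)) (reMul.continuous.comp hk).aestronglyMeasurable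
      (Eventually.of_forall fun y z _ => (norm_reMul_le _).trans (norm_smoothCauchy_le hn _))
      (integrable_const _) (Eventually.of_forall fun y z _ => hasFDerivAt_smoothLog hn y z)

theorem contDiff_logPotential (h : IsBoundedDensity ν C R) : ContDiff ℝ 1 (logPotential ν) :=
  contDiff_one_iff_hasFDerivAt.2 ⟨fun z => reMul (stieltjes ν z),
    reMul.continuous.comp h.continuous_stieltjes, h.hasFDerivAt_logPotential⟩

/-- The truncated logarithmic potential is close to the logarithmic potential. -/
theorem integral_log_max_mem (h : IsBoundedDensity ν C R) {δ : ℝ} (hδ : 0 < δ) (z : ℂ) :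
    logPotential ν z ≤ ∫ y, Real.log (max δ ‖z - y‖) ∂ν ∧
    ∫ y, Real.log (max δ ‖z - y‖) ∂ν ≤ logPotential ν z + δ * (2 * Real.pi * C + 1) := by
  have hcont : Continuous fun y : ℂ => Real.log (max δ ‖z - y‖) :=
    Continuous.log (by fun_prop) fun y => (lt_max_of_lt_left hδ).ne'
  have hi := h.integrable_of_continuous hcont
  constructor
  · refine integral_mono_ae (h.integrable_log z) hi ?_
    filter_upwards [h.ae_ne z] with y hy
    exact Real.log_le_log (norm_pos_iff.2 hy) (le_max_right _ _)
  · have h2 : ∫ y, Real.log (max δ ‖z - y‖) ∂ν ≤ ∫ y, (Real.log ‖z - y‖ + δ * ‖z - y‖⁻¹) ∂ν := by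
      refine integral_mono_ae hi ((h.integrable_log z).add ((h.integrable_inv_norm z).const_mul δ)) ?_
      filter_upwards [h.ae_ne z] with y hy
      have hp := norm_pos_iff.2 hy
      have h1 : max δ ‖z - y‖ ≤ ‖z - y‖ * (1 + δ * ‖z - y‖⁻¹) := by
        have : ‖z - y‖ * (1 + δ * ‖z - y‖⁻¹) = ‖z - y‖ + δ := by field_simp
        rw [this]
        exact max_le (by linarith) (by linarith)
      have h3 := Real.log_le_log (lt_max_of_lt_left hδ) h1
      rw [Real.log_mul hp.ne' (by positivity)] at h3
      have h4 := Real.log_le_sub_one_of_pos (show 0 < 1 + δ * ‖z - y‖⁻¹ by positivity)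
      change Real.log (max δ ‖z - y‖) ≤ _
      linarith
    rw [integral_add (h.integrable_log z) ((h.integrable_inv_norm z).const_mul δ),
      integral_const_mul] at h2
    have := mul_le_mul_of_nonneg_left (h.integral_inv_norm_le z) hδ.le
    unfold logPotential
    linarith

end IsBoundedDensity

/-! ### Transformations of measures with bounded density -/

/-- Lebesgue measure is a multiple of two-dimensional Hausdorff measure, which behaves well under
antilipschitz maps; no differentiability of `T_t` is needed. -/
theorem volume_preimage_le_of_antilipschitz {f : ℂ → ℂ} {K : NNReal} (hf : AntilipschitzWith K f)
    (s : Set ℂ) : volume (f ⁻¹' s) ≤ (K : ℝ≥0∞) ^ 2 * volume s := by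
  have h2 : (Module.finrank ℝ ℂ : ℝ) = 2 := by simp
  have hv := Measure.isAddLeftInvariant_eq_smul (volume : Measure ℂ)
    (Measure.hausdorffMeasure (Module.finrank ℝ ℂ : ℝ))
  have h := hf.hausdorffMeasure_preimage_le (d := (Module.finrank ℝ ℂ : ℝ)) (by simp) s
  have h3 : (K : ℝ≥0∞) ^ (Module.finrank ℝ ℂ : ℝ) = (K : ℝ≥0∞) ^ 2 := by
    rw [h2, ENNReal.rpow_two]
  rw [h3] at h
  rw [hv, Measure.smul_apply, Measure.smul_apply, ENNReal.smul_def, ENNReal.smul_def, smul_eq_mul,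
    smul_eq_mul, mul_left_comm]
  gcongr

theorem IsBoundedDensity.exists_density {ν : Measure ℂ} {C R : ℝ} (h : IsBoundedDensity ν C R) :
    ∃ p : ℂ → ℝ, Measurable p ∧ (∃ C : ℝ, ∀ z, 0 ≤ p z ∧ p z ≤ C) ∧
      ν = volume.withDensity (fun z => ENNReal.ofReal (p z)) := by
  have := h.prob
  have hac : ν ≪ volume := Measure.absolutelyContinuous_of_le_smul h.le_volume
  have hle : ν.rnDeriv volume ≤ᵐ[volume] fun _ => ENNReal.ofReal C := by
    refine ae_le_of_forall_setLIntegral_le_of_sigmaFinite (Measure.measurable_rnDeriv _ _)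
      fun s hs _ => ?_
    rw [Measure.setLIntegral_rnDeriv hac, setLIntegral_const]
    simpa using h.le_volume s
  -- Truncation at `C` turns the almost everywhere bound into one at every point.
  refine ⟨fun z => min (ν.rnDeriv volume z).toReal C,
    (Measure.measurable_rnDeriv _ _).ennreal_toReal.min measurable_const,
    ⟨C, fun z => ⟨le_min ENNReal.toReal_nonneg h.nonneg, min_le_right _ _⟩⟩, ?_⟩
  conv_lhs => rw [← Measure.withDensity_rnDeriv_eq ν volume hac]
  refine withDensity_congr_ae ?_
  filter_upwards [hle] with z hz
  have hz' : ν.rnDeriv volume z ≠ ⊤ := (hz.trans_lt ENNReal.ofReal_lt_top).ne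
  rw [min_eq_left, ENNReal.ofReal_toReal hz']
  exact ENNReal.toReal_le_of_le_ofReal h.nonneg hz

/-! ### The limiting zero distributions -/

/-- The uniform distribution of the angle. -/
noncomputable def angleMeasure : Measure ℝ :=
  ENNReal.ofReal (2 * Real.pi)⁻¹ • volume.restrict (Ioo (-Real.pi) Real.pi)

instance : IsProbabilityMeasure angleMeasure := ⟨by
  rw [angleMeasure, Measure.smul_apply, Measure.restrict_apply_univ, Real.volume_Ioo, smul_eq_mul,
    ← ENNReal.ofReal_mul (by positivity), show (2 * Real.pi)⁻¹ * (Real.pi - -Real.pi) = 1 by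
      have := Real.pi_ne_zero; field_simp; norm_num, ENNReal.ofReal_one]⟩

/-- The uniform distribution on `(0, 1)`. -/
noncomputable def levelMeasure : Measure ℝ := volume.restrict (Ioo 0 1)

instance : IsProbabilityMeasure levelMeasure := ⟨by
  rw [levelMeasure, Measure.restrict_apply_univ, Real.volume_Ioo]; simp⟩

/-- The point of modulus `radius g α` and argument `θ`. -/
noncomputable def polarPoint (g : ℝ → ℝ) (p : ℝ × ℝ) : ℂ :=
  (radius g p.1 : ℂ) * Complex.exp (p.2 * Complex.I)

theorem measurable_polarPoint (g : ℝ → ℝ) : Measurable (polarPoint g) := by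
  unfold polarPoint
  have : Measurable fun p : ℝ × ℝ => radius g p.1 := (measurable_radius g).comp measurable_fst
  fun_prop

theorem norm_polarPoint (g : ℝ → ℝ) (p : ℝ × ℝ) : ‖polarPoint g p‖ = radius g p.1 := by
  rw [polarPoint, norm_mul, Complex.norm_exp_ofReal_mul_I, mul_one, Complex.norm_real,
    Real.norm_of_nonneg (radius_pos g _).le]

/-- The rotation invariant distribution whose radial part has distribution function `α₀`. -/
noncomputable def nuZero (g : ℝ → ℝ) : Measure ℂ :=
  (levelMeasure.prod angleMeasure).map (polarPoint g)

/-- The push-forward of `nuZero` under the transport map. -/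
noncomputable def nuT (g : ℝ → ℝ) (t : ℝ) : Measure ℂ := (nuZero g).map (transport g t)

theorem nuT_zero (g : ℝ → ℝ) : nuT g 0 = nuZero g := by
  have : transport g 0 = id := by funext w; simp [transport]
  rw [nuT, this, Measure.map_id]

instance (g : ℝ → ℝ) : IsProbabilityMeasure (nuZero g) :=
  Measure.isProbabilityMeasure_map (measurable_polarPoint g).aemeasurable

theorem nuZero_apply_of_norm (g : ℝ → ℝ) {S : Set ℝ} (hS : MeasurableSet S) :
    nuZero g {w | ‖w‖ ∈ S} = volume ({α | radius g α ∈ S} ∩ Ioo 0 1) := by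
  have hm : MeasurableSet {α | radius g α ∈ S} := measurable_radius g hS
  have hn : MeasurableSet {w : ℂ | ‖w‖ ∈ S} := measurable_norm hS
  rw [nuZero, Measure.map_apply (measurable_polarPoint g) hn]
  have : polarPoint g ⁻¹' {w | ‖w‖ ∈ S} = {α | radius g α ∈ S} ×ˢ univ := by
    ext p; simp [norm_polarPoint]
  rw [this, Measure.prod_prod, measure_univ, mul_one, levelMeasure, Measure.restrict_apply hm]

variable {g : ℝ → ℝ} {L t : ℝ}

/-! ### Masses, supports and density bounds -/

namespace IsProfile

theorem nuZero_closedBall (hg : IsProfile g) (s : ℝ) (hs : 0 < s) :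
    nuZero g {w | ‖w‖ ≤ s} = ENNReal.ofReal (alphaZero g (s : ℂ)) := by
  have hn : ‖(s : ℂ)‖ = s := by simp [abs_of_pos hs]
  have hm := hg.alphaZero_mem (s : ℂ)
  rw [show {w : ℂ | ‖w‖ ≤ s} = {w | ‖w‖ ∈ Iic s} from rfl, nuZero_apply_of_norm g measurableSet_Iic]
  refine le_antisymm ?_ ?_
  · calc _ ≤ volume (Icc 0 (alphaZero g (s : ℂ))) := measure_mono fun α hα => by
          refine ⟨hα.2.1.le, not_lt.1 fun h => ?_⟩
          have := (hg.alphaZero_lt_iff _ hα.2).1 h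
          rw [hn] at this
          exact absurd hα.1 (not_le.2 this)
      _ = _ := by rw [Real.volume_Icc, sub_zero]
  · calc _ = volume (Ioo 0 (alphaZero g (s : ℂ))) := by rw [Real.volume_Ioo, sub_zero]
      _ ≤ _ := measure_mono fun α hα => by
          have hα' : α ∈ Ioo (0 : ℝ) 1 := ⟨hα.1, hα.2.trans_le hm.2⟩
          have := (hg.lt_alphaZero_iff _ hα').1 hα.2
          rw [hn] at this
          exact ⟨this.le, hα'⟩

theorem nuZero_annulus_compl (hg : IsProfile g) :
    nuZero g {w | ‖w‖ ∈ (Ioo (innerRadius g) (outerRadius g))ᶜ} = 0 := by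
  rw [nuZero_apply_of_norm g measurableSet_Ioo.compl]
  convert measure_empty (μ := (volume : Measure ℝ)) using 2
  rw [eq_empty_iff_forall_notMem]
  rintro α ⟨h1, h2⟩
  exact h1 ⟨hg.innerRadius_lt_radius h2, hg.radius_lt_outerRadius h2⟩

/-- The substitution `r = radius α` and polar coordinates show that the density is `α₀'(r) / (2 π
r)`; `one_le_deriv_radius` bounds it by `L / π`. -/
theorem nuZero_le_volume (hg : IsProfile g) (hL : IsSlopeBound g L) :
    nuZero g ≤ ENNReal.ofReal (L / Real.pi) • volume := by
  refine Measure.le_iff.2 fun A hA => ?_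
  set Φ : ℝ → ℝ≥0∞ := fun r => ∫⁻ θ in Ioo (-Real.pi) Real.pi,
    A.indicator 1 ((r : ℂ) * Complex.exp (θ * Complex.I)) with hΦ
  have hind : Measurable (A.indicator (1 : ℂ → ℝ≥0∞)) := measurable_one.indicator hA
  have hmeas : Measurable fun p : ℝ × ℝ =>
      A.indicator (1 : ℂ → ℝ≥0∞) ((p.1 : ℂ) * Complex.exp (p.2 * Complex.I)) :=
    hind.comp (by fun_prop)
  have hΦm : Measurable Φ := hmeas.lintegral_prod_right'
  have h1 : nuZero g A = ENNReal.ofReal (2 * Real.pi)⁻¹ * ∫⁻ α in Ioo 0 1, Φ (radius g α) := by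
    rw [← lintegral_indicator_one hA, nuZero, lintegral_map hind (measurable_polarPoint g),
      lintegral_prod (fun p => A.indicator 1 (polarPoint g p))
        (hind.comp (measurable_polarPoint g)).aemeasurable, levelMeasure,
      ← lintegral_const_mul' _ _ ENNReal.ofReal_ne_top]
    refine lintegral_congr fun α => ?_
    rw [angleMeasure, lintegral_smul_measure, smul_eq_mul]
    rfl
  -- The factor `2 L r · dr/dα ≥ 1` is inserted to supply the Jacobian of the substitution and the
  -- weight `r` of polar coordinates.
  have h2 : ∫⁻ α in Ioo 0 1, Φ (radius g α) ≤
      ENNReal.ofReal (2 * L) * ∫⁻ α in Ioo 0 1, ENNReal.ofReal |radius g α * -deriv (deriv g) α| *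
        (ENNReal.ofReal (radius g α) * Φ (radius g α)) := by
    rw [← lintegral_const_mul' _ _ ENNReal.ofReal_ne_top]
    refine setLIntegral_mono' measurableSet_Ioo fun α hα => ?_
    have h := hg.one_le_deriv_radius hL hα
    have hd := hg.deriv_radius_pos hα
    rw [abs_of_pos hd, ← mul_assoc, ← mul_assoc, ← ENNReal.ofReal_mul (by have := hL.1; positivity),
      ← ENNReal.ofReal_mul (by have := hL.1; positivity)]
    refine le_mul_of_one_le_left zero_le ?_
    rw [← ENNReal.ofReal_one]
    refine ENNReal.ofReal_le_ofReal (h.trans (le_of_eq (by ring)))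
  have h3 := lintegral_image_eq_lintegral_abs_deriv_mul (s := Ioo (0 : ℝ) 1) measurableSet_Ioo
    (fun α hα => (hg.hasDerivAt_radius hα).hasDerivWithinAt) hg.strictMonoOn_radius.injOn
    (fun r => ENNReal.ofReal r * Φ r)
  have h4 : ∫⁻ r in radius g '' Ioo 0 1, ENNReal.ofReal r * Φ r ≤ volume A := by
    calc _ ≤ ∫⁻ r in Ioi 0, ENNReal.ofReal r * Φ r := by
          refine lintegral_mono_set ?_
          rintro _ ⟨α, -, rfl⟩
          exact radius_pos g α
      _ = volume A := by
          rw [← lintegral_indicator_one hA, ← Complex.lintegral_comp_polarCoord_symm,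
            polarCoord_target, Measure.volume_eq_prod, ← Measure.prod_restrict,
            lintegral_prod _ (by
              refine Measurable.aemeasurable ?_
              have : Measurable fun p : ℝ × ℝ => A.indicator (1 : ℂ → ℝ≥0∞)
                (Complex.polarCoord.symm p) := by
                simp only [Complex.polarCoord_symm_apply]
                exact hind.comp (by fun_prop)
              fun_prop)]
          refine setLIntegral_congr_fun measurableSet_Ioi fun r _ => ?_
          rw [hΦ]
          simp only [smul_eq_mul]
          rw [← lintegral_const_mul' _ _ ENNReal.ofReal_ne_top]
          refine lintegral_congr fun θ => ?_
          rw [Complex.polarCoord_symm_apply, Complex.exp_mul_I, Complex.ofReal_cos,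
            Complex.ofReal_sin]
  rw [h1, Measure.smul_apply, smul_eq_mul]
  calc _ ≤ ENNReal.ofReal (2 * Real.pi)⁻¹ * (ENNReal.ofReal (2 * L) * volume A) := by
        gcongr
        refine h2.trans ?_
        rw [← h3]
        gcongr
    _ = _ := by
        rw [← mul_assoc, ← ENNReal.ofReal_mul (by positivity)]
        congr 2
        have := Real.pi_ne_zero
        field_simp

theorem isBoundedDensity_nuZero (hg : IsProfile g) (hL : IsSlopeBound g L) :
    IsBoundedDensity (nuZero g) (L / Real.pi) (outerRadius g) where
  prob := inferInstance
  nonneg := div_nonneg hL.1 Real.pi_pos.le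
  le_volume := hg.nuZero_le_volume hL
  support := measure_mono_null (fun w hw => by
    simp only [mem_compl_iff, Metric.mem_closedBall, dist_zero_right, not_le] at hw
    exact fun h => absurd h.2 (not_lt.2 hw.le)) hg.nuZero_annulus_compl

theorem isBoundedDensity_nuT (hg : IsProfile g) (hL : IsSlopeBound g L) (ht : 0 ≤ t)
    (htL : t * L < 1) : ∃ C R, IsBoundedDensity (nuT g t) C R := by
  have hc : Continuous (transport g t) := hg.continuous_transport hL
  have h0 := hg.isBoundedDensity_nuZero hL
  set K : NNReal := ⟨(1 - t * L)⁻¹, inv_nonneg.2 (sub_nonneg.2 htL.le)⟩ with hK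
  -- The inverse of `T_t` expands lengths by at most `K`, hence areas by at most `K²`; and `|T_t(w)|
  -- ≤ (1 + t L) |w|`.
  refine ⟨L / Real.pi * (K : ℝ) ^ 2, (1 + t * L) * outerRadius g,
    Measure.isProbabilityMeasure_map hc.measurable.aemeasurable,
    mul_nonneg h0.nonneg (by positivity), Measure.le_iff.2 fun A hA => ?_, ?_⟩
  · rw [nuT, Measure.map_apply hc.measurable hA, Measure.smul_apply, smul_eq_mul,
      ENNReal.ofReal_mul h0.nonneg, mul_assoc]
    refine (h0.le_volume _).trans ?_
    rw [Measure.smul_apply, smul_eq_mul]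
    gcongr
    have := volume_preimage_le_of_antilipschitz (hg.antilipschitz_transport hL ht htL) A
    rwa [← hK, ← ENNReal.ofReal_coe_nnreal, ← ENNReal.ofReal_pow K.coe_nonneg] at this
  · rw [nuT, Measure.map_apply hc.measurable Metric.isClosed_closedBall.measurableSet.compl]
    refine measure_mono_null (fun w hw => ?_) h0.support
    simp only [mem_preimage, mem_compl_iff, Metric.mem_closedBall, dist_zero_right, not_le] at hw ⊢
    have h1 : ‖transport g t w‖ ≤ ‖w‖ + t * (L * ‖w‖) := by
      refine (norm_add_le _ _).trans ?_
      rw [norm_mul, Complex.norm_real, Real.norm_of_nonneg ht, hg.norm_alphaZero_div]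
      gcongr
      exact hg.ratio_le hL (norm_nonneg w)
    have h2 : (1 + t * L) * outerRadius g < (1 + t * L) * ‖w‖ := by linarith
    exact lt_of_mul_lt_mul_left h2 (by have := mul_nonneg ht hL.1; linarith)

theorem nuT_domain_compl (hg : IsProfile g) (hL : IsSlopeBound g L) (ht : 0 ≤ t)
    (htL : t * L < 1) : nuT g t (domain g t)ᶜ = 0 := by
  have hc : Continuous (transport g t) := hg.continuous_transport hL
  have hmeas : MeasurableSet (domain g t) := by
    unfold domain
    have h1 : Measurable fun z : ℂ => z.re ^ 2 + z.im ^ 2 := by fun_prop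
    have h2 : Measurable fun z : ℂ => z.re ^ 2 / (outerRadius g + t * (outerRadius g)⁻¹) ^ 2
      + z.im ^ 2 / (outerRadius g - t * (outerRadius g)⁻¹) ^ 2 := by fun_prop
    exact (measurableSet_lt measurable_const h1).inter (measurableSet_lt h2 measurable_const)
  rw [nuT, Measure.map_apply hc.measurable hmeas.compl]
  refine measure_mono_null (fun w hw => ?_) hg.nuZero_annulus_compl
  exact fun h => hw ((hg.transport_mem_domain_iff hL ht htL).2 h)

theorem nuT_ellipse (hg : IsProfile g) (hL : IsSlopeBound g L) (ht : 0 ≤ t)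
    (htL : t * L < 1) {s : ℝ} (hs : 0 < s) :
    nuT g t (ellipse g s t) = ENNReal.ofReal (alphaZero g (s : ℂ)) := by
  have hc : Continuous (transport g t) := hg.continuous_transport hL
  have hmeas : MeasurableSet (ellipse g s t) := by
    unfold ellipse
    exact measurableSet_le (by fun_prop) (by fun_prop)
  rw [nuT, Measure.map_apply hc.measurable hmeas, ← hg.nuZero_closedBall s hs]
  congr 1
  ext w
  exact hg.transport_mem_ellipse_iff hL ht htL hs

end IsProfile

/-! ### Circle averages -/

theorem integral_angleMeasure {E : Type*} [NormedAddCommGroup E] [NormedSpace ℝ E] (F : ℂ → E) :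
    ∫ θ, F (Complex.exp (θ * Complex.I)) ∂angleMeasure = Real.circleAverage F 0 1 := by
  have hper : Function.Periodic (fun θ : ℝ => F (circleMap 0 1 θ)) (2 * Real.pi) := fun θ => by
    simp only [periodic_circleMap 0 1 θ]
  have h := hper.intervalIntegral_add_eq 0 (-Real.pi)
  rw [zero_add, show -Real.pi + 2 * Real.pi = Real.pi by ring] at h
  rw [Real.circleAverage, h, angleMeasure, integral_smul_measure,
    ENNReal.toReal_ofReal (by positivity), intervalIntegral.integral_of_le (by
      linarith [Real.pi_pos]), ← integral_Ioc_eq_integral_Ioo]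
  simp [circleMap]

theorem log_add_posLog_div {r x : ℝ} (hr : 0 < r) (hx : 0 ≤ x) :
    Real.log r + Real.posLog (x / r) = Real.log (max r x) := by
  rcases hx.eq_or_lt with rfl | hx
  · simp [hr.le]
  have hdef : Real.posLog (x / r) = max 0 (Real.log (x / r)) := rfl
  rw [hdef, Real.log_div hx.ne' hr.ne']
  rcases le_total r x with h | h
  · rw [max_eq_right h, max_eq_right (sub_nonneg.2 (Real.log_le_log hr h))]; ring
  · rw [max_eq_left h, max_eq_left (sub_nonpos.2 (Real.log_le_log hx h)), add_zero]

open Polynomial in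
-- Multiplication by `-ζ`, of modulus one, turns the argument into the quadratic polynomial with
-- roots `ω / r` and `(z - ω) / r`, whose Mahler measure is known by Jensen's formula. The second
-- root lies in the unit disc because `|z - ω|² ≤ τ < r²`.
theorem circleAverage_log_joukowski {r τ : ℝ} {z ω : ℂ} (hr : 0 < r) (hτ : 0 ≤ τ)
    (hτr : τ < r ^ 2) (hω : IsOuterRoot τ z ω) :
    Real.circleAverage (fun ζ => Real.log ‖z - ((r : ℂ) * ζ + τ / ((r : ℂ) * ζ))‖) 0 1 =
      Real.log (max r ‖ω‖) := by
  have hr0 : (r : ℂ) ≠ 0 := by exact_mod_cast hr.ne'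
  set p : ℂ[X] := C (r : ℂ) * ((X - C (ω / r)) * (X - C ((z - ω) / r))) with hp
  have h1 : Real.circleAverage (fun ζ => Real.log ‖z - ((r : ℂ) * ζ + τ / ((r : ℂ) * ζ))‖) 0 1 =
      p.logMahlerMeasure := by
    rw [logMahlerMeasure_def]
    refine Real.circleAverage_congr_sphere fun ζ hζ => ?_
    have hζ1 : ‖ζ‖ = 1 := by simpa using hζ
    have hζ0 : ζ ≠ 0 := norm_pos_iff.1 (hζ1 ▸ one_pos)
    have e : p.eval ζ = -ζ * (z - ((r : ℂ) * ζ + τ / ((r : ℂ) * ζ))) := by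
      simp only [hp, eval_mul, eval_C, eval_sub, eval_X]
      field_simp
      linear_combination hω.1
    simp only [e, norm_mul, norm_neg, hζ1, one_mul]
  have hq : (X - C (ω / r)) * (X - C ((z - ω) / r)) ≠ (0 : ℂ[X]) :=
    mul_ne_zero (X_sub_C_ne_zero _) (X_sub_C_ne_zero _)
  rw [h1, hp, logMahlerMeasure_C_mul hr0 hq, logMahlerMeasure_mul_eq_add_logMahlerMeasure hq,
    logMahlerMeasure_X_sub_C, logMahlerMeasure_X_sub_C, Complex.norm_real,
    Real.norm_of_nonneg hr.le, norm_div, norm_div, Complex.norm_real, Real.norm_of_nonneg hr.le,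
    ← add_assoc, log_add_posLog_div hr (norm_nonneg _)]
  have h2 : ‖z - ω‖ / r ≤ 1 := by
    rw [div_le_one hr]
    exact (lt_of_pow_lt_pow_left₀ 2 hr.le ((hω.norm_sub_sq_le hτ).trans_lt hτr)).le
  rw [(Real.posLog_eq_zero_iff _).2 (by rwa [abs_of_nonneg (by positivity)]), add_zero]

/-! ### The logarithmic potential of `nuT` -/

theorem IsOuterRoot.eq_of_zero {z ω : ℂ} (h : IsOuterRoot 0 z ω) : ω = z := by
  have h1 := h.1
  rw [Complex.ofReal_zero, mul_eq_zero] at h1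
  rcases h1 with rfl | h1
  · exact (norm_le_zero_iff.1 (by simpa using h.2)).symm
  · exact (sub_eq_zero.1 h1).symm

theorem continuousOn_rate_outerRoot (ht : 0 ≤ t) (z : ℂ) :
    ContinuousOn (fun β => rate β z (outerRoot (t * β) z)) (Ici 0) := by
  rcases ht.eq_or_lt with rfl | ht
  · have : (fun β => rate β z (outerRoot (0 * β) z)) = fun β => β * Real.log ‖z‖ := by
      funext β
      have h := outerRoot_spec (0 * β) z
      rw [zero_mul] at h ⊢
      rw [h.eq_of_zero, rate]
      simp
    rw [this]
    fun_prop
  · exact continuousOn_rate (W := fun β => outerRoot (t * β) z) (fun β => outerRoot_spec _ _) ht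

namespace IsProfile

theorem transport_polarPoint (hg : IsProfile g) {p : ℝ × ℝ} (hp : p.1 ∈ Ioo (0 : ℝ) 1) :
    transport g t (polarPoint g p) = (radius g p.1 : ℂ) * Complex.exp (p.2 * Complex.I) +
      ((t * p.1 : ℝ) : ℂ) / ((radius g p.1 : ℂ) * Complex.exp (p.2 * Complex.I)) := by
  rw [transport_eq, hg.alphaZero_of_norm_eq_radius hp (norm_polarPoint g p), polarPoint]

/-- By Fubini the potential is the integral over levels of `log max (radius α) |ω_α|`. Below `α₀(w)`
the maximum is `|ω_α|`, whose logarithm is the derivative of the rate; above it is `radius α`, whose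
logarithm is `-g'`. Both integrals are evaluated by the fundamental theorem of calculus. -/
theorem logPotential_nuT (hg : IsProfile g) (hL : IsSlopeBound g L) (ht : 0 ≤ t)
    (htL : t * L < 1) (w : ℂ) :
    logPotential (nuT g t) (transport g t w) =
      g (alphaZero g w) + rate (alphaZero g w) (transport g t w) w - g 1 := by
  obtain ⟨C, R, hν⟩ := hg.isBoundedDensity_nuT hL ht htL
  have hc : Continuous (transport g t) := hg.continuous_transport hL
  set z := transport g t w with hz
  set a := alphaZero g w with ha
  have ham := hg.alphaZero_mem w
  set W : ℝ → ℂ := fun β => outerRoot (t * β) z with hWdef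
  have hW : ∀ β, IsOuterRoot (t * β) z (W β) := fun β => outerRoot_spec _ _
  have hTm : AEMeasurable (transport g t) ((levelMeasure.prod angleMeasure).map (polarPoint g)) :=
    hc.measurable.aemeasurable
  have hPm : AEMeasurable (polarPoint g) (levelMeasure.prod angleMeasure) :=
    (measurable_polarPoint g).aemeasurable
  have hlm : ∀ {μ : Measure ℂ}, AEStronglyMeasurable (fun y => Real.log ‖z - y‖) μ :=
    (IsBoundedDensity.measurable_log_norm_sub z).aestronglyMeasurable
  have hint : Integrable (fun p => Real.log ‖z - transport g t (polarPoint g p)‖)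
      (levelMeasure.prod angleMeasure) := by
    have h := hν.integrable_log z
    rw [nuT, nuZero, integrable_map_measure hlm hTm,
      integrable_map_measure (by
        exact ((IsBoundedDensity.measurable_log_norm_sub z).comp hc.measurable).aestronglyMeasurable)
        hPm] at h
    exact h
  have hU : logPotential (nuT g t) z =
      ∫ α, ∫ θ, Real.log ‖z - transport g t (polarPoint g (α, θ))‖ ∂angleMeasure ∂levelMeasure := by
    rw [logPotential, nuT, nuZero, integral_map hTm hlm, integral_map hPm
      (f := fun x => Real.log ‖z - transport g t x‖) ((IsBoundedDensity.measurable_log_norm_sub z).comp hc.measurable).aestronglyMeasurable,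
      integral_prod _ hint]
  have hinner : ∀ α ∈ Ioo (0 : ℝ) 1,
      ∫ θ, Real.log ‖z - transport g t (polarPoint g (α, θ))‖ ∂angleMeasure =
        Real.log (max (radius g α) ‖W α‖) := fun α hα => by
    rw [← circleAverage_log_joukowski (radius_pos g α) (mul_nonneg ht hα.1.le)
      (hg.mul_lt_radius_sq hL htL ht hα) (hW α), ← integral_angleMeasure]
    refine integral_congr_ae (Eventually.of_forall fun θ => ?_)
    simp only [hg.transport_polarPoint (p := (α, θ)) hα]
  have hI : IntegrableOn (fun α => Real.log (max (radius g α) ‖W α‖)) (Ioo 0 1) := by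
    refine (hint.integral_prod_left).congr ?_
    filter_upwards [ae_restrict_mem measurableSet_Ioo] with α hα
    exact hinner α hα
  have hI' : IntervalIntegrable (fun α => Real.log (max (radius g α) ‖W α‖)) volume 0 1 :=
    (intervalIntegrable_iff_integrableOn_Ioo_of_le zero_le_one).2 hI
  have hsplit : logPotential (nuT g t) z = (∫ α in (0 : ℝ)..a, Real.log (max (radius g α) ‖W α‖)) +
      ∫ α in a..1, Real.log (max (radius g α) ‖W α‖) := by
    rw [intervalIntegral.integral_add_adjacent_intervals, hU,
      intervalIntegral.integral_of_le zero_le_one, integral_Ioc_eq_integral_Ioo]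
    · exact setIntegral_congr_fun measurableSet_Ioo hinner
    · exact hI'.mono_set (by rw [uIcc_of_le ham.1, uIcc_of_le zero_le_one]; exact Icc_subset_Icc le_rfl ham.2)
    · exact hI'.mono_set (by rw [uIcc_of_le ham.2, uIcc_of_le zero_le_one]; exact Icc_subset_Icc ham.1 le_rfl)
  have h1 : ∫ α in (0 : ℝ)..a, Real.log (max (radius g α) ‖W α‖) = rate a z (W a) - rate 0 z (W 0) := by
    refine intervalIntegral.integral_eq_sub_of_hasDerivAt_of_le ham.1
      ((continuousOn_rate_outerRoot ht z).mono Icc_subset_Ici_self) (fun α hα => ?_)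
      (hI'.mono_set (by rw [uIcc_of_le ham.1, uIcc_of_le zero_le_one]; exact Icc_subset_Icc le_rfl ham.2))
    have hα' : α ∈ Ioo (0 : ℝ) 1 := ⟨hα.1, hα.2.trans_le ham.2⟩
    have := hasDerivAt_rate hW (hg.outerRoot_strict hL ht htL hα' (hW α) hα.2)
    rwa [max_eq_right ((hg.lt_alphaZero_iff_outerRoot hL ht htL hα' (hW α)).1 hα.2).le]
  have h2 : ∫ α in a..1, Real.log (max (radius g α) ‖W α‖) = -g 1 - -g a := by
    refine intervalIntegral.integral_eq_sub_of_hasDerivAt_of_le (f := fun α => -g α) ham.2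
      ((hg.continuousOn.mono (Icc_subset_Icc ham.1 le_rfl)).neg) (fun α hα => ?_)
      (hI'.mono_set (by rw [uIcc_of_le ham.2, uIcc_of_le zero_le_one]; exact Icc_subset_Icc ham.1 le_rfl))
    have hα' : α ∈ Ioo (0 : ℝ) 1 := ⟨ham.1.trans_lt hα.1, hα.2⟩
    rw [max_eq_left ((hg.alphaZero_lt_iff_outerRoot hL ht htL hα' (hW α)).1 hα.1).le, log_radius]
    exact (hg.hasDerivAt hα').fun_neg
  rw [hsplit, h1, h2, (hg.isOuterRoot_self hL ht htL w).rate_eq (hW a)]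
  simp [rate]
  ring

theorem logPotential_nuT_eq_UT (hg : IsProfile g) (hL : IsSlopeBound g L) (ht : 0 < t)
    (htL : t * L < 1) (z : ℂ) : logPotential (nuT g t) z = UT g t z := by
  obtain ⟨w, rfl⟩ := hg.surjective_transport hL ht.le htL z
  rw [hg.logPotential_nuT hL ht.le htL, hg.UT_transport hL ht htL]

theorem logPotential_nuZero (hg : IsProfile g) (hL : IsSlopeBound g L) {w : ℂ} (hw : w ≠ 0) :
    logPotential (nuZero g) w = UZero g w := by
  have h := hg.logPotential_nuT hL le_rfl (by simp) w
  rw [nuT_zero, show transport g 0 w = w by simp [transport]] at h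
  rw [h, hg.UZero_eq hw, rate]
  simp

/-- Every level gives a lower bound for the potential. -/
theorem le_logPotential_nuT (hg : IsProfile g) (hL : IsSlopeBound g L) (ht : 0 ≤ t)
    (htL : t * L < 1) {z ω : ℂ} (hz : 0 < t ∨ z ≠ 0) {α : ℝ} (hα : α ∈ Icc (0 : ℝ) 1)
    (hω : IsOuterRoot (t * α) z ω) : g α + rate α z ω - g 1 ≤ logPotential (nuT g t) z := by
  rcases ht.eq_or_lt with rfl | ht
  · have hz0 : z ≠ 0 := by simpa using hz
    rw [zero_mul] at hω
    rw [nuT_zero, hg.logPotential_nuZero hL hz0, hg.UZero_eq hz0, hω.eq_of_zero, rate]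
    have := (hg.isUniqueMaximizer_alphaZero hz0).le hα
    simp only [sub_self, zero_div, Complex.zero_re, mul_zero, add_zero]
    linarith
  · obtain ⟨w, rfl⟩ := hg.surjective_transport hL ht.le htL z
    rw [hg.logPotential_nuT_eq_UT hL ht htL, UT, (hg.isUniqueMaximizer_fT hL ht htL w).iSup_eq,
      ← fT_eq ht hα.1 hω]
    exact sub_le_sub_right ((hg.isUniqueMaximizer_fT hL ht htL w).le hα) _

/-- The Stieltjes transform along the transport map. -/
theorem stieltjes_nuT (hg : IsProfile g) (hL : IsSlopeBound g L) (ht : 0 ≤ t)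
    (htL : t * L < 1) {w : ℂ} (hw : w ≠ 0) :
    stieltjes (nuT g t) (transport g t w) = (alphaZero g w : ℂ) / w := by
  obtain ⟨C, R, hν⟩ := hg.isBoundedDensity_nuT hL ht htL
  set α := alphaZero g w with hα
  have hαm := hg.alphaZero_mem w
  set τ : ℝ := t * α with hτ
  have hτ0 : 0 ≤ τ := mul_nonneg ht hαm.1
  have hlt : τ < ‖w‖ ^ 2 := hg.alphaZero_mul_lt hL ht htL hw
  set m := stieltjes (nuT g t) (transport g t w) with hm
  -- This is the derivative of `ω ↦ ω + τ/ω` at `w`, nonzero because `τ < |w|²`; the map is thus a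
  -- local chart at `T_t(w)`.
  have hβ : 1 - (τ : ℂ) / w ^ 2 ≠ 0 := fun h => by
    have h1 : (τ : ℂ) = w ^ 2 := by
      rw [sub_eq_zero, eq_comm, div_eq_one_iff_eq (pow_ne_zero 2 hw)] at h
      exact h
    have h2 := congrArg norm h1
    rw [Complex.norm_real, Real.norm_of_nonneg hτ0, norm_pow] at h2
    exact hlt.ne h2
  -- The level `α` is frozen and `z` moves along the image of a line through `w` in the chart. The
  -- derivative of the potential must equal that of the lower bound given by this level.
  have key : ∀ v : ℂ, ((1 - (τ : ℂ) / w ^ 2) * (m - α / w) * v).re = 0 := by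
    intro v
    set ω : ℝ → ℂ := fun s => w + s * v with hω
    have hω0 : ω 0 = w := by simp [hω]
    have hωd : HasDerivAt ω v 0 := by
      have := ((Complex.ofRealCLM.hasDerivAt (x := (0 : ℝ))).mul_const v).const_add w
      exact this.congr_deriv (by simp)
    have hωn : ∀ᶠ s in 𝓝 (0 : ℝ), ω s ≠ 0 ∧ τ < ‖ω s‖ ^ 2 := by
      have h1 : Tendsto ω (𝓝 0) (𝓝 w) := by simpa [hω0] using hωd.continuousAt.tendsto
      refine (h1.eventually_ne hw).and ?_
      exact (h1.norm.pow 2).eventually_const_lt hlt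
    set J : ℝ → ℂ := fun s => ω s + τ / ω s with hJ
    have hJ0 : J 0 = transport g t w := by
      simp only [hJ, hω0]; exact (transport_eq g t w).symm
    have hJd : HasDerivAt J ((1 - (τ : ℂ) / w ^ 2) * v) 0 := by
      have h := hωd.fun_add ((hasDerivAt_const (0 : ℝ) (τ : ℂ)).fun_div hωd (by rwa [hω0]))
      refine h.congr_deriv ?_
      rw [hω0]
      field_simp
      ring
    have hUd : HasDerivAt (fun s => logPotential (nuT g t) (J s))
        (m * ((1 - (τ : ℂ) / w ^ 2) * v)).re 0 := by
      have h := hν.hasFDerivAt_logPotential (J 0)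
      rw [hJ0] at h
      have h2 := HasFDerivAt.comp_hasDerivAt_of_eq (x := (0 : ℝ)) h hJd hJ0.symm
      exact h2
    have hRd : HasDerivAt (fun s => α * Real.log ‖ω s‖ + α / 2 * ((τ : ℂ) / ω s ^ 2).re)
        (α * (v / w).re + α / 2 * (-(τ * (2 * w * v)) / (w ^ 2) ^ 2).re) 0 := by
      have h1 := (HasDerivAt.log_norm hωd (by rwa [hω0])).const_mul α
      have h2 := (HasDerivAt.complex_re ((hasDerivAt_const (0 : ℝ) (τ : ℂ)).fun_div
        (hωd.fun_pow 2) (by rw [hω0]; exact pow_ne_zero 2 hw))).const_mul (α / 2)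
      refine (h1.fun_add h2).congr_deriv ?_
      rw [hω0]
      simp
    -- By `le_logPotential_nuT` the difference is at least `g α - g 1`, with equality at `s = 0`,
    -- where `α` is the optimal level.
    have hmin : IsLocalMin (fun s => logPotential (nuT g t) (J s) -
        (α * Real.log ‖ω s‖ + α / 2 * ((τ : ℂ) / ω s ^ 2).re)) 0 := by
      have hrate : ∀ s, ω s ≠ 0 → rate α (J s) (ω s) =
          α * Real.log ‖ω s‖ + α / 2 * ((τ : ℂ) / ω s ^ 2).re := fun s hs => by
        have : (J s - ω s) / ω s = (τ : ℂ) / ω s ^ 2 := by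
          simp only [hJ]; field_simp; ring
        rw [rate, this]
      have hval : logPotential (nuT g t) (J 0) -
          (α * Real.log ‖ω 0‖ + α / 2 * ((τ : ℂ) / ω 0 ^ 2).re) = g α - g 1 := by
        rw [← hrate 0 (by rwa [hω0]), hJ0, hω0, hg.logPotential_nuT hL ht htL]
        ring
      filter_upwards [hωn] with s hs
      have hroot : IsOuterRoot (t * α) (J s) (ω s) :=
        IsOuterRoot.of_eq_add_div hτ0 hs.1 rfl hs.2.le
      have hz : 0 < t ∨ J s ≠ 0 := by
        rcases ht.eq_or_lt with h | h
        · right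
          have : τ = 0 := by rw [hτ, ← h, zero_mul]
          simp only [hJ, this, Complex.ofReal_zero, zero_div, add_zero]
          exact hs.1
        · exact Or.inl h
      have h := hg.le_logPotential_nuT hL ht htL hz hαm hroot
      rw [hrate s hs.1] at h
      rw [hval]
      linarith
    have hzero := hmin.hasDerivAt_eq_zero (hUd.fun_sub hRd)
    rw [← Complex.re_ofReal_mul α, ← Complex.re_ofReal_mul (α / 2), ← Complex.add_re,
      ← Complex.sub_re] at hzero
    rw [← hzero]
    congr 1
    push_cast
    field_simp
    ring
  -- The direction `v` equal to the conjugate of this number turns `key` into the vanishing of its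
  -- squared modulus.
  have h0 : (1 - (τ : ℂ) / w ^ 2) * (m - α / w) = 0 := by
    set c := (1 - (τ : ℂ) / w ^ 2) * (m - α / w)
    have := key ((starRingEnd ℂ) c)
    rw [Complex.mul_conj, Complex.ofReal_re] at this
    exact Complex.normSq_eq_zero.1 this
  exact sub_eq_zero.1 ((mul_eq_zero.1 h0).resolve_left hβ)

end IsProfile

/-! ### The heat flow on polynomials -/

section HeatFlow

open Polynomial

/-- The range of summation may be lengthened freely, so that sums for polynomials of different
degrees can be compared term by term. -/
theorem heatFlow_eq_sum (s : ℂ) {p : ℂ[X]} {N : ℕ} (h : p.natDegree ≤ N) :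
    heatFlow s p = ∑ j ∈ Finset.range (N + 1),
      C (1 / (j.factorial : ℂ) * (-s / 2) ^ j) * derivative^[2 * j] p := by
  refine Finset.sum_subset (Finset.range_mono (by omega)) fun j _ hj => ?_
  rw [Finset.mem_range, not_lt] at hj
  rw [iterate_derivative_eq_zero (by omega), mul_zero]

theorem heatFlow_add (s : ℂ) (p q : ℂ[X]) : heatFlow s (p + q) = heatFlow s p + heatFlow s q := by
  rw [heatFlow_eq_sum s (natDegree_add_le p q), heatFlow_eq_sum s (le_max_left _ q.natDegree),
    heatFlow_eq_sum s (le_max_right p.natDegree _), ← Finset.sum_add_distrib]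
  refine Finset.sum_congr rfl fun j _ => ?_
  rw [iterate_map_add, mul_add]

theorem heatFlow_zero_right (s : ℂ) : heatFlow s 0 = 0 := by
  simp [heatFlow]

theorem heatFlow_C_mul (s c : ℂ) (p : ℂ[X]) : heatFlow s (C c * p) = C c * heatFlow s p := by
  rw [heatFlow_eq_sum s (natDegree_C_mul_le c p), heatFlow, Finset.mul_sum]
  refine Finset.sum_congr rfl fun j _ => ?_
  rw [iterate_derivative_C_mul]
  ring

theorem heatFlow_sum {ι : Type*} (s : ℂ) (S : Finset ι) (f : ι → ℂ[X]) :
    heatFlow s (∑ i ∈ S, f i) = ∑ i ∈ S, heatFlow s (f i) := by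
  classical
  induction S using Finset.induction_on with
  | empty => simp [heatFlow_zero_right]
  | insert i S hi ih => rw [Finset.sum_insert hi, Finset.sum_insert hi, heatFlow_add, ih]

theorem heatFlow_zero_left (p : ℂ[X]) : heatFlow 0 p = p := by
  rw [heatFlow, Finset.sum_eq_single 0]
  · simp
  · intro j _ hj
    simp [hj]
  · simp

theorem heatFlow_one (s : ℂ) : heatFlow s 1 = 1 := by
  simp [heatFlow]

theorem iterate_derivative_X_mul_succ (p : ℂ[X]) (m : ℕ) :
    derivative^[m + 1] (X * p)
      = X * derivative^[m + 1] p + C ((m : ℂ) + 1) * derivative^[m] p := by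
  induction m with
  | zero => simp; ring
  | succ m ih =>
    rw [Function.iterate_succ_apply', ih]
    simp only [derivative_add, derivative_mul, derivative_X, derivative_C,
      ← Function.iterate_succ_apply']
    simp only [Nat.cast_add, Nat.cast_one, C_add, C_1]
    ring

/-- The commutation relation of `exp (-(s/2) ∂²)` with multiplication by `X`, from Leibniz's rule.
On monomials it becomes the Hermite recursion. -/
theorem heatFlow_X_mul (s : ℂ) (p : ℂ[X]) :
    heatFlow s (X * p) = X * heatFlow s p - C s * heatFlow s (derivative p) := by
  have h1 : (X * p).natDegree ≤ p.natDegree + 1 := by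
    refine natDegree_mul_le.trans ?_
    rw [natDegree_X, add_comm]
  rw [heatFlow_eq_sum s h1, heatFlow_eq_sum s (Nat.le_succ p.natDegree),
    heatFlow_eq_sum s ((natDegree_derivative_le p).trans (Nat.sub_le _ 1)),
    Finset.sum_range_succ', Finset.sum_range_succ' _ (p.natDegree + 1), mul_add, Finset.mul_sum,
    Finset.mul_sum, add_sub_right_comm, ← Finset.sum_sub_distrib]
  congr 1
  · refine Finset.sum_congr rfl fun j _ => ?_
    rw [show 2 * (j + 1) = (2 * j + 1) + 1 by ring, iterate_derivative_X_mul_succ,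
      ← Function.iterate_succ_apply derivative (2 * j) p]
    have hc : (1 / ((j + 1).factorial : ℂ) * (-s / 2) ^ (j + 1)) * (((2 * j + 1 : ℕ) : ℂ) + 1)
        = -(s * (1 / (j.factorial : ℂ) * (-s / 2) ^ j)) := by
      have : (j.factorial : ℂ) ≠ 0 := by exact_mod_cast j.factorial_ne_zero
      have h' : (j : ℂ) + 1 ≠ 0 := by exact_mod_cast j.succ_ne_zero
      rw [Nat.factorial_succ]
      push_cast
      field_simp
      ring
    rw [mul_add, ← mul_assoc (C _) (C _), ← C_mul, hc, C_neg, C_mul (a := s)]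
    ring
  · simp

/-- The heat evolution of `X ^ k`, a rescaled Hermite polynomial. -/
noncomputable def hermiteFlow (s : ℂ) (k : ℕ) : ℂ[X] := heatFlow s (X ^ k)

theorem hermiteFlow_zero (s : ℂ) : hermiteFlow s 0 = 1 := by
  rw [hermiteFlow, pow_zero, heatFlow_one]

theorem hermiteFlow_one (s : ℂ) : hermiteFlow s 1 = X := by
  have := heatFlow_X_mul s 1
  rw [mul_one] at this
  rw [hermiteFlow, pow_one, this, heatFlow_one, derivative_one, heatFlow_zero_right]
  simp

theorem hermiteFlow_add_two (s : ℂ) (k : ℕ) :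
    hermiteFlow s (k + 2)
      = X * hermiteFlow s (k + 1) - C (s * ((k : ℂ) + 1)) * hermiteFlow s k := by
  rw [hermiteFlow, pow_succ', heatFlow_X_mul, derivative_X_pow, Nat.add_sub_cancel]
  rw [heatFlow_C_mul, C_mul, mul_assoc]
  norm_cast

theorem heatFlow_randomPoly (s : ℂ) (x : ℕ → ℂ) (a : ℕ → ℕ → ℂ) (n : ℕ) (z : ℂ) :
    (heatFlow s (randomPoly x a n)).eval z
      = ∑ k ∈ Finset.range (n + 1), a n k * (hermiteFlow s k).eval z * x k := by
  rw [randomPoly, heatFlow_sum, eval_finsetSum]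
  refine Finset.sum_congr rfl fun k _ => ?_
  rw [heatFlow_C_mul, eval_mul, eval_C, hermiteFlow]
  ring

theorem natDegree_heatFlow_le (s : ℂ) (p : ℂ[X]) : (heatFlow s p).natDegree ≤ p.natDegree := by
  refine natDegree_sum_le_of_forall_le _ _ fun j _ => ?_
  exact (natDegree_C_mul_le _ _).trans ((natDegree_iterate_derivative _ _).trans (Nat.sub_le _ _))

theorem natDegree_randomPoly_le (x : ℕ → ℂ) (a : ℕ → ℕ → ℂ) (n : ℕ) :
    (randomPoly x a n).natDegree ≤ n := by
  refine natDegree_sum_le_of_forall_le _ _ fun j hj => ?_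
  refine (natDegree_C_mul_X_pow_le _ _).trans ?_
  rw [Finset.mem_range] at hj
  omega

end HeatFlow

/-! ### Cauchy's formula for the Hermite polynomials -/

/-- The coefficient of `u ^ k` in `exp (p u - q u ^ 2 / 2)`, as a contour integral. -/
noncomputable def gaussCoeff (p q : ℂ) (k : ℤ) : ℂ :=
  Real.circleAverage (fun u : ℂ => Complex.exp (p * u - q * u ^ 2 / 2) * u ^ (-k)) 0 1

theorem circleIntegrable_exp_mul_zpow (p q : ℂ) (k : ℤ) :
    CircleIntegrable (fun u : ℂ => Complex.exp (p * u - q * u ^ 2 / 2) * u ^ k) 0 1 := by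
  refine ContinuousOn.circleIntegrable (by norm_num) ?_
  intro u hu
  have hu0 : u ≠ 0 := by
    rintro rfl
    simp at hu
  refine ContinuousAt.continuousWithinAt ?_
  exact ContinuousAt.mul (by fun_prop) (continuousAt_zpow₀ u k (Or.inl hu0))

theorem gaussCoeff_zero (p q : ℂ) : gaussCoeff p q 0 = 1 := by
  have h : DiffContOnCl ℂ (fun u : ℂ => Complex.exp (p * u - q * u ^ 2 / 2)) (Metric.ball 0 |1|) :=
    Differentiable.diffContOnCl (by fun_prop)
  simpa [gaussCoeff] using h.circleAverage

theorem gaussCoeff_neg_one (p q : ℂ) : gaussCoeff p q (-1) = 0 := by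
  have h : DiffContOnCl ℂ (fun u : ℂ => Complex.exp (p * u - q * u ^ 2 / 2) * u ^ (- -1 : ℤ))
      (Metric.ball 0 |1|) := by
    refine Differentiable.diffContOnCl ?_
    simp only [neg_neg, zpow_one]
    fun_prop
  rw [gaussCoeff, h.circleAverage]
  simp

/-- The derivative of `exp (p u - q u²/2) u^{-(k+1)}` integrates to zero over the circle. -/
theorem gaussCoeff_succ (p q : ℂ) (k : ℤ) :
    ((k : ℂ) + 1) * gaussCoeff p q (k + 1) = p * gaussCoeff p q k - q * gaussCoeff p q (k - 1) := by
  have key : (∮ u in C(0, 1), (Complex.exp (p * u - q * u ^ 2 / 2) * (p - q * u) * u ^ (-(k + 1))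
      + Complex.exp (p * u - q * u ^ 2 / 2)
        * (((-(k + 1) : ℤ) : ℂ) * u ^ (-(k + 1) - 1)))) = 0 := by
    refine circleIntegral.integral_eq_zero_of_hasDerivWithinAt
      (f := fun u => Complex.exp (p * u - q * u ^ 2 / 2) * u ^ (-(k + 1))) zero_le_one ?_
    intro u hu
    have hu0 : u ≠ 0 := by
      rintro rfl
      simp at hu
    have h1 : HasDerivAt (fun u : ℂ => p * u - q * u ^ 2 / 2) (p - q * u) u := by
      have := ((hasDerivAt_id u).const_mul p).fun_sub
        ((((hasDerivAt_id u).fun_pow 2).const_mul q).div_const 2)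
      refine this.congr_deriv ?_
      simp
      ring
    exact (h1.cexp.fun_mul (hasDerivAt_zpow (-(k + 1)) u (Or.inl hu0))).hasDerivWithinAt
  have havg : Real.circleAverage (fun u : ℂ =>
      p * (Complex.exp (p * u - q * u ^ 2 / 2) * u ^ (-k))
      - q * (Complex.exp (p * u - q * u ^ 2 / 2) * u ^ (-(k - 1)))
      - ((k : ℂ) + 1) * (Complex.exp (p * u - q * u ^ 2 / 2) * u ^ (-(k + 1)))) 0 1 = 0 := by
    rw [Real.circleAverage_eq_circleIntegral one_ne_zero]
    refine (congrArg (fun x : ℂ => (2 * Real.pi * Complex.I : ℂ)⁻¹ • x) (Eq.trans ?_ key)).trans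
      (smul_zero _)
    refine circleIntegral.integral_congr zero_le_one fun u hu => ?_
    have hu0 : u ≠ 0 := by
      rintro rfl
      simp at hu
    simp only [sub_zero, smul_eq_mul]
    have e1 : u ^ (-k) = u ^ (-(k + 1)) * u := by
      rw [← zpow_add_one₀ hu0]; congr 1; ring
    have e2 : u ^ (-(k - 1)) = u ^ (-(k + 1)) * u * u := by
      rw [← zpow_add_one₀ hu0, ← zpow_add_one₀ hu0]; congr 1; ring
    have e3 : u ^ (-(k + 1) - 1) = u ^ (-(k + 1)) * u⁻¹ := by
      rw [zpow_sub_one₀ hu0]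
    rw [e1, e2, e3]
    push_cast
    field_simp
    ring
  have i1 := circleIntegrable_exp_mul_zpow p q (-k)
  have i2 := circleIntegrable_exp_mul_zpow p q (-(k - 1))
  have i3 := circleIntegrable_exp_mul_zpow p q (-(k + 1))
  simp only [← smul_eq_mul (a := p), ← smul_eq_mul (a := q), ← smul_eq_mul (a := (k : ℂ) + 1)]
    at havg
  rw [Real.circleAverage_fun_sub, Real.circleAverage_fun_sub, Real.circleAverage_fun_smul,
    Real.circleAverage_fun_smul, Real.circleAverage_fun_smul] at havg
  · simp only [smul_eq_mul] at havg
    simp only [gaussCoeff]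
    linear_combination -havg
  · exact i1.const_smul
  · exact i2.const_smul
  · exact (i1.const_smul).sub (i2.const_smul)
  · exact i3.const_smul

/-- Both sides satisfy the same three-term recursion, whence the induction on pairs of consecutive
indices. The scale `c` is free; the choice `c = k / ω` will place a saddle at `u = 1`. -/
theorem eval_hermiteFlow (s z : ℂ) {c : ℂ} (hc : c ≠ 0) (k : ℕ) :
    (hermiteFlow s k).eval z
      = k.factorial * (c⁻¹) ^ k * gaussCoeff (c * z) (s * c ^ 2) k := by
  suffices h : (hermiteFlow s k).eval z
      = k.factorial * (c⁻¹) ^ k * gaussCoeff (c * z) (s * c ^ 2) k ∧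
      (hermiteFlow s (k + 1)).eval z
      = (k + 1).factorial * (c⁻¹) ^ (k + 1) * gaussCoeff (c * z) (s * c ^ 2) ((k : ℤ) + 1) from h.1
  induction k with
  | zero =>
    have h := gaussCoeff_succ (c * z) (s * c ^ 2) 0
    have h' := gaussCoeff_neg_one (c * z) (s * c ^ 2)
    have h0 := gaussCoeff_zero (c * z) (s * c ^ 2)
    rw [zero_sub, h', h0] at h
    simp only [Int.cast_zero, zero_add, one_mul, mul_one, mul_zero, sub_zero] at h
    refine ⟨by simp [hermiteFlow_zero, h0], ?_⟩
    simp [hermiteFlow_one, h]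
    field_simp
  | succ k ih =>
    refine ⟨by simpa using ih.2, ?_⟩
    have h := gaussCoeff_succ (c * z) (s * c ^ 2) ((k : ℤ) + 1)
    rw [hermiteFlow_add_two, Polynomial.eval_sub, Polynomial.eval_mul, Polynomial.eval_mul,
      Polynomial.eval_X, Polynomial.eval_C, ih.1, ih.2]
    rw [add_sub_cancel_right] at h
    push_cast at h ⊢
    rw [Nat.factorial_succ (k + 1), Nat.factorial_succ k]
    push_cast
    linear_combination (-((k : ℂ) + 1) * k.factorial * c⁻¹ ^ (k + 2)) * h
      - (z * ((k : ℂ) + 1) * k.factorial * gaussCoeff (c * z) (s * c ^ 2) (k + 1) * c⁻¹ ^ (k + 1)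
        - s * ((k : ℂ) + 1) * k.factorial * gaussCoeff (c * z) (s * c ^ 2) k
          * (c⁻¹ ^ k + c⁻¹ ^ (k + 1) * c))
        * (inv_mul_cancel₀ hc)

/-! ### The saddle point integral -/

/-- The integrand of the saddle point representation of the Hermite polynomials. -/
noncomputable def saddleExponent (β : ℂ) (θ : ℝ) : ℂ :=
  (Complex.exp (θ * Complex.I) - 1) - θ * Complex.I
    - β * (Complex.exp (θ * Complex.I) - 1) ^ 2 / 2

/-- The saddle point integral over the unit circle. -/
noncomputable def saddleIntegral (k : ℕ) (β : ℂ) : ℂ :=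
  ((2 * Real.pi)⁻¹ : ℝ) • ∫ θ in (-Real.pi)..Real.pi, Complex.exp (k * saddleExponent β θ)

theorem continuous_saddleExponent (β : ℂ) : Continuous (saddleExponent β) := by
  unfold saddleExponent
  fun_prop

theorem norm_sq_exp_mul_I_sub_one (θ : ℝ) :
    ‖Complex.exp (θ * Complex.I) - 1‖ ^ 2 = 2 * (1 - Real.cos θ) := by
  have h1 : (Complex.exp (θ * Complex.I) - 1).re = Real.cos θ - 1 := by
    rw [Complex.sub_re, Complex.exp_ofReal_mul_I_re, Complex.one_re]
  have h2 : (Complex.exp (θ * Complex.I) - 1).im = Real.sin θ := by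
    rw [Complex.sub_im, Complex.exp_ofReal_mul_I_im, Complex.one_im, sub_zero]
  rw [Complex.sq_norm, Complex.normSq_apply, h1, h2]
  nlinarith [Real.sin_sq_add_cos_sq θ]

/-- The linear part contributes `cos θ - 1`, and the quadratic part costs at most `‖β‖ (1 - cos θ)`
because `|e^{iθ} - 1|² = 2 (1 - cos θ)`. For `‖β‖ ≤ 1` the integrand is largest at the saddle. -/
theorem re_saddleExponent_le (β : ℂ) (θ : ℝ) :
    (saddleExponent β θ).re ≤ -(1 - ‖β‖) * (1 - Real.cos θ) := by
  have h1 : -(β * (Complex.exp (θ * Complex.I) - 1) ^ 2 / 2).re ≤ ‖β‖ * (1 - Real.cos θ) := by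
    refine (neg_le_abs _).trans ((Complex.abs_re_le_norm _).trans ?_)
    rw [norm_div, norm_mul, norm_pow, norm_sq_exp_mul_I_sub_one]
    simp
    exact le_of_eq (by ring)
  have h2 : ((Complex.exp (θ * Complex.I) - 1) - θ * Complex.I).re = Real.cos θ - 1 := by
    simp [Complex.exp_ofReal_mul_I_re]
  rw [saddleExponent, Complex.sub_re, h2]
  linarith

theorem norm_exp_saddleExponent (k : ℕ) (β : ℂ) (θ : ℝ) :
    ‖Complex.exp (k * saddleExponent β θ)‖ = Real.exp (k * (saddleExponent β θ).re) := by
  rw [Complex.norm_exp]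
  simp

theorem norm_saddleIntegral_le (k : ℕ) {β : ℂ} (hβ : ‖β‖ ≤ 1) : ‖saddleIntegral k β‖ ≤ 1 := by
  have h : ‖∫ θ in (-Real.pi)..Real.pi, Complex.exp (k * saddleExponent β θ)‖
      ≤ 1 * |Real.pi - -Real.pi| := by
    refine intervalIntegral.norm_integral_le_of_norm_le_const fun θ _ => ?_
    rw [norm_exp_saddleExponent, Real.exp_le_one_iff]
    refine mul_nonpos_of_nonneg_of_nonpos k.cast_nonneg ((re_saddleExponent_le β θ).trans ?_)
    rw [neg_mul, neg_nonpos]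
    exact mul_nonneg (sub_nonneg.2 hβ) (sub_nonneg.2 (Real.cos_le_one θ))
  rw [saddleIntegral, norm_smul, Real.norm_eq_abs, abs_of_pos (by positivity)]
  rw [abs_of_pos (by linarith [Real.pi_pos])] at h
  refine (mul_le_mul_of_nonneg_left h (by positivity)).trans (le_of_eq ?_)
  field_simp
  ring

/-- For these parameters `u = 1` is a critical point of the exponent, and its value there, `k (1 +
β/2)`, is taken out. -/
theorem gaussCoeff_eq_saddleIntegral (k : ℕ) (β : ℂ) :
    gaussCoeff (k * (1 + β)) (k * β) k
      = Complex.exp (k * (1 + β / 2)) * saddleIntegral k β := by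
  rw [gaussCoeff, Real.circleAverage_eq_integral_add (-Real.pi), saddleIntegral]
  rw [mul_smul_comm, ← intervalIntegral.integral_const_mul]
  rw [intervalIntegral.integral_comp_add_right (fun θ => Complex.exp
      (k * (1 + β) * circleMap 0 1 θ - k * β * circleMap 0 1 θ ^ 2 / 2)
        * circleMap 0 1 θ ^ (-(k : ℤ)))]
  rw [show (0 : ℝ) + -Real.pi = -Real.pi by ring, show 2 * Real.pi + -Real.pi = Real.pi by ring]
  congr 1
  refine intervalIntegral.integral_congr fun θ _ => ?_
  simp only [circleMap, zero_add, Complex.ofReal_one, one_mul]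
  rw [← Complex.exp_int_mul, ← Complex.exp_add, ← Complex.exp_add, saddleExponent]
  congr 1
  push_cast
  ring

theorem tendsto_exp_second_order (x : ℝ) :
    Tendsto (fun h : ℝ => (Complex.exp (x * h * Complex.I) - 1 - x * h * Complex.I) / (h : ℂ) ^ 2)
      (𝓝[≠] 0) (𝓝 (-(x : ℂ) ^ 2 / 2)) := by
  rw [tendsto_iff_norm_sub_tendsto_zero]
  have hb : Tendsto (fun h : ℝ => |x| ^ 3 * |h| * Real.exp (|x| * |h|)) (𝓝[≠] 0) (𝓝 0) := by
    have : Continuous fun h : ℝ => |x| ^ 3 * |h| * Real.exp (|x| * |h|) := by fun_prop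
    have h0 := this.tendsto 0
    simp only [abs_zero, mul_zero, zero_mul] at h0
    exact h0.mono_left nhdsWithin_le_nhds
  refine squeeze_zero' (Eventually.of_forall fun h => norm_nonneg _) ?_ hb
  filter_upwards [self_mem_nhdsWithin] with h hh
  have hh0 : (h : ℂ) ≠ 0 := by exact_mod_cast hh
  have hT := Complex.norm_exp_sub_sum_le_norm_mul_exp (x * h * Complex.I) 3
  have hn : ‖(x * h * Complex.I : ℂ)‖ = |x| * |h| := by simp
  rw [hn] at hT
  have e : (Complex.exp (x * h * Complex.I) - 1 - x * h * Complex.I) / (h : ℂ) ^ 2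
      - -(x : ℂ) ^ 2 / 2
      = (Complex.exp (x * h * Complex.I)
        - ∑ m ∈ Finset.range 3, (x * h * Complex.I) ^ m / m.factorial) / (h : ℂ) ^ 2 := by
    simp [Finset.sum_range_succ, Nat.factorial]
    field_simp
    linear_combination ((x : ℂ) ^ 2 * h ^ 2) * Complex.I_sq
  have hh1 : h ≠ 0 := hh
  rw [e, norm_div, norm_pow, Complex.norm_real, Real.norm_eq_abs, div_le_iff₀ (by positivity)]
  refine hT.trans (le_of_eq ?_)
  ring

theorem tendsto_exp_first_order (x : ℝ) :
    Tendsto (fun h : ℝ => (Complex.exp (x * h * Complex.I) - 1) / (h : ℂ))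
      (𝓝[≠] 0) (𝓝 (x * Complex.I)) := by
  have h1 : Tendsto (fun h : ℝ => (h : ℂ)) (𝓝[≠] 0) (𝓝 0) := by
    have : Continuous fun h : ℝ => (h : ℂ) := Complex.continuous_ofReal
    simpa using (this.tendsto 0).mono_left (nhdsWithin_le_nhds (s := {0}ᶜ))
  have h2 := ((tendsto_exp_second_order x).mul h1).add_const ((x : ℂ) * Complex.I)
  rw [mul_zero, zero_add] at h2
  refine h2.congr' ?_
  filter_upwards [self_mem_nhdsWithin] with h hh
  have hh0 : (h : ℂ) ≠ 0 := by exact_mod_cast hh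
  field_simp
  ring

/-- Laplace's method with `θ = x / √κ`. The bound `cos θ ≤ 1 - 2 θ²/π²` on `[-π, π]` supplies a
Gaussian majorant, uniform in `n` because `‖β n‖` is eventually below `q < 1`. -/
theorem tendsto_sqrt_mul_saddleIntegral {κ : ℕ → ℕ} (hκ : Tendsto κ atTop atTop) {β : ℕ → ℂ}
    {b : ℂ} (hβ : Tendsto β atTop (𝓝 b)) (hb : ‖b‖ < 1) :
    Tendsto (fun n => (Real.sqrt (κ n) : ℂ) * saddleIntegral (κ n) (β n)) atTop
      (𝓝 (((2 * Real.pi)⁻¹ : ℝ) • ∫ x : ℝ, Complex.exp (-((1 - b) / 2) * (x : ℂ) ^ 2))) := by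
  have hκ1 : ∀ᶠ n in atTop, 1 ≤ κ n := hκ.eventually_ge_atTop 1
  set h : ℕ → ℝ := fun n => (Real.sqrt (κ n))⁻¹ with hh
  have hsqrt : Tendsto (fun n => Real.sqrt (κ n)) atTop atTop :=
    Real.tendsto_sqrt_atTop.comp (tendsto_natCast_atTop_atTop.comp hκ)
  have hh0 : Tendsto h atTop (𝓝[≠] 0) := by
    refine tendsto_nhdsWithin_iff.2 ⟨tendsto_inv_atTop_zero.comp hsqrt, ?_⟩
    filter_upwards [hκ1] with n hn
    have : (0 : ℝ) < κ n := by exact_mod_cast hn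
    exact inv_ne_zero (Real.sqrt_pos.2 this).ne'
  set q : ℝ := (1 + ‖b‖) / 2 with hq
  have hq1 : q < 1 := by rw [hq]; linarith
  have hβq : ∀ᶠ n in atTop, ‖β n‖ ≤ q := by
    refine (hβ.norm.eventually_lt_const (u := q) ?_).mono fun n hn => hn.le
    rw [hq]; linarith
  set F : ℕ → ℝ → ℂ := fun n => (Ioc (-Real.pi * Real.sqrt (κ n)) (Real.pi * Real.sqrt (κ n))).indicator
    fun x => Complex.exp (κ n * saddleExponent (β n) (x * h n)) with hF
  have hrep : ∀ᶠ n in atTop, ((2 * Real.pi)⁻¹ : ℝ) • ∫ x, F n x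
      = (Real.sqrt (κ n) : ℂ) * saddleIntegral (κ n) (β n) := by
    filter_upwards [hκ1] with n hn
    have hpos : 0 < Real.sqrt (κ n) := Real.sqrt_pos.2 (by exact_mod_cast hn)
    have hpos' : (Real.sqrt (κ n) : ℂ) ≠ 0 := by exact_mod_cast hpos.ne'
    have hle : -Real.pi * Real.sqrt (κ n) ≤ Real.pi * Real.sqrt (κ n) := by
      gcongr
      linarith [Real.pi_pos]
    rw [hF, integral_indicator measurableSet_Ioc, ← intervalIntegral.integral_of_le hle]
    have := intervalIntegral.integral_comp_mul_right (a := -Real.pi * Real.sqrt (κ n))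
      (b := Real.pi * Real.sqrt (κ n))
      (fun θ => Complex.exp (κ n * saddleExponent (β n) θ)) (c := h n) (inv_ne_zero hpos.ne')
    rw [this, saddleIntegral, hh]
    simp only [inv_inv, mul_assoc, mul_inv_cancel₀ hpos.ne', mul_one]
    rw [Complex.real_smul, Complex.real_smul, Complex.real_smul]
    ring
  refine Tendsto.congr' hrep (Tendsto.const_smul ?_ _)
  refine tendsto_integral_filter_of_dominated_convergence
    (fun x => Real.exp (-((1 - q) * (2 / Real.pi ^ 2)) * x ^ 2)) ?_ ?_ ?_ ?_
  · refine Eventually.of_forall fun n => ?_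
    refine AEStronglyMeasurable.indicator ?_ measurableSet_Ioc
    refine Continuous.aestronglyMeasurable ?_
    exact (continuous_const.mul ((continuous_saddleExponent _).comp
      (continuous_id.mul continuous_const))).cexp
  · filter_upwards [hκ1, hβq] with n hn hbn
    refine Eventually.of_forall fun x => ?_
    have hpos : 0 < Real.sqrt (κ n) := Real.sqrt_pos.2 (by exact_mod_cast hn)
    simp only [hF]
    by_cases hx : x ∈ Ioc (-Real.pi * Real.sqrt (κ n)) (Real.pi * Real.sqrt (κ n))
    · rw [indicator_of_mem hx, norm_exp_saddleExponent]
      refine Real.exp_le_exp.2 ?_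
      have hθ : |x * h n| ≤ Real.pi := by
        simp only [hh]
        rw [← div_eq_mul_inv, abs_le, le_div_iff₀ hpos, div_le_iff₀ hpos]
        exact ⟨hx.1.le, hx.2⟩
      have h1 := re_saddleExponent_le (β n) (x * h n)
      have h2 := Real.cos_le_one_sub_mul_cos_sq hθ
      have h3 : (κ n : ℝ) * (x * h n) ^ 2 = x ^ 2 := by
        simp only [hh]
        rw [mul_pow, inv_pow, Real.sq_sqrt (Nat.cast_nonneg _)]
        have : (κ n : ℝ) ≠ 0 := by
          have : (0 : ℝ) < κ n := by exact_mod_cast hn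
          exact this.ne'
        field_simp
      have h4 : (saddleExponent (β n) (x * h n)).re
          ≤ -((1 - q) * (2 / Real.pi ^ 2)) * (x * h n) ^ 2 := by
        refine h1.trans ?_
        rw [neg_mul, neg_mul, neg_le_neg_iff, mul_assoc]
        have h5 : (0 : ℝ) ≤ 2 / Real.pi ^ 2 * (x * h n) ^ 2 := by positivity
        nlinarith
      refine (mul_le_mul_of_nonneg_left h4 (Nat.cast_nonneg _)).trans (le_of_eq ?_)
      rw [← h3]
      ring
    · rw [indicator_of_notMem hx, norm_zero]
      positivity
  · exact integrable_exp_neg_mul_sq (mul_pos (sub_pos.2 hq1) (by positivity))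
  · refine Eventually.of_forall fun x => ?_
    have hmem : ∀ᶠ n in atTop,
        x ∈ Ioc (-Real.pi * Real.sqrt (κ n)) (Real.pi * Real.sqrt (κ n)) := by
      filter_upwards [hsqrt.eventually_gt_atTop (|x| / Real.pi)] with n hn
      rw [div_lt_iff₀ Real.pi_pos] at hn
      obtain ⟨h1, h2⟩ := abs_lt.1 (hn : |x| < Real.sqrt (κ n) * Real.pi)
      exact ⟨by linarith, by linarith⟩
    have hlim : Tendsto (fun n => (κ n : ℂ) * saddleExponent (β n) (x * h n)) atTop
        (𝓝 (-((1 - b) / 2) * (x : ℂ) ^ 2)) := by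
      have l2 := (tendsto_exp_second_order x).comp hh0
      have l1 := ((tendsto_exp_first_order x).comp hh0).pow 2
      have l := l2.sub ((hβ.mul l1).div_const 2)
      have e : -(x : ℂ) ^ 2 / 2 - b * (x * Complex.I) ^ 2 / 2
          = -((1 - b) / 2) * (x : ℂ) ^ 2 := by
        rw [mul_pow, Complex.I_sq]
        ring
      rw [e] at l
      refine l.congr' ?_
      filter_upwards [hκ1] with n hn
      have hpos : 0 < Real.sqrt (κ n) := Real.sqrt_pos.2 (by exact_mod_cast hn)
      have hκh : (κ n : ℂ) = ((h n : ℂ) ^ 2)⁻¹ := by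
        simp only [hh]
        push_cast
        rw [inv_pow, inv_inv, ← Complex.ofReal_pow, Real.sq_sqrt (Nat.cast_nonneg _)]
        simp
      have hne : (h n : ℂ) ≠ 0 := by
        simp only [hh]
        exact_mod_cast inv_ne_zero hpos.ne'
      simp only [Function.comp_apply, saddleExponent]
      rw [hκh]
      push_cast
      field_simp
    refine Tendsto.congr' ?_ (hlim.cexp)
    filter_upwards [hmem] with n hn
    simp only [hF]
    rw [indicator_of_mem hn]

/-- The limiting Gaussian integral is nonzero, as `Re (1 - b) > 0`. -/
theorem exists_le_norm_saddleIntegral {κ : ℕ → ℕ} (hκ : Tendsto κ atTop atTop) {β : ℕ → ℂ}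
    {b : ℂ} (hβ : Tendsto β atTop (𝓝 b)) (hb : ‖b‖ < 1) :
    ∃ c : ℝ, 0 < c ∧ ∀ᶠ n in atTop, c ≤ Real.sqrt (κ n) * ‖saddleIntegral (κ n) (β n)‖ := by
  have hlim := (tendsto_sqrt_mul_saddleIntegral hκ hβ hb).norm
  set c := ‖((2 * Real.pi)⁻¹ : ℝ) • ∫ x : ℝ, Complex.exp (-((1 - b) / 2) * (x : ℂ) ^ 2)‖ with hc
  have hre : 0 < ((1 - b) / 2).re := by
    have := (Complex.re_le_norm b).trans_lt hb
    simp
    linarith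
  have hc0 : 0 < c := by
    rw [hc, norm_pos_iff, integral_gaussian_complex hre]
    refine smul_ne_zero (by positivity) ?_
    rw [Ne, Complex.cpow_eq_zero_iff, not_and_or]
    left
    refine div_ne_zero (by exact_mod_cast Real.pi_ne_zero) fun h0 => ?_
    rw [h0] at hre
    simp at hre
  refine ⟨c / 2, half_pos hc0, ?_⟩
  filter_upwards [hlim.eventually_const_le (half_lt_self hc0)] with n hn
  rwa [norm_mul, Complex.norm_real, Real.norm_eq_abs, abs_of_nonneg (Real.sqrt_nonneg _)] at hn

/-! ### Exponential rate of the Hermite polynomials -/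

/-- The factor `k! e ^ k / k ^ k`. -/
noncomputable def stirlingFactor (k : ℕ) : ℝ := k.factorial * Real.exp k / (k : ℝ) ^ k

theorem one_le_stirlingFactor (k : ℕ) : 1 ≤ stirlingFactor k := by
  have h := Real.pow_div_factorial_le_exp (k : ℝ) k.cast_nonneg k
  have hk : (0 : ℝ) < (k : ℝ) ^ k := by
    rcases k.eq_zero_or_pos with rfl | hk
    · simp
    · positivity
  rw [div_le_iff₀ (by positivity)] at h
  rw [stirlingFactor, le_div_iff₀ hk]
  linarith

/-- Only subexponential size matters; the monotone Stirling sequence suffices. -/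
theorem stirlingFactor_le (k : ℕ) : stirlingFactor k ≤ Real.exp 1 * (k + 1) := by
  rcases k with _ | k
  · simp [stirlingFactor]
  have h : Stirling.stirlingSeq (k + 1) ≤ Stirling.stirlingSeq (0 + 1) :=
    Stirling.stirlingSeq'_antitone (Nat.zero_le k)
  rw [zero_add, Stirling.stirlingSeq_one, Stirling.stirlingSeq, div_le_iff₀ (by positivity),
    div_pow, ← Real.exp_nat_mul, mul_one] at h
  rw [stirlingFactor, div_le_iff₀ (by positivity)]
  have hs : Real.sqrt (2 * ((k + 1 : ℕ) : ℝ)) ≤ Real.sqrt 2 * ((k + 1 : ℕ) + 1 : ℝ) := by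
    rw [Real.sqrt_mul zero_le_two]
    gcongr
    rw [Real.sqrt_le_left (by positivity)]
    nlinarith [(Nat.cast_nonneg (k + 1) : (0 : ℝ) ≤ ((k + 1 : ℕ) : ℝ))]
  refine (mul_le_mul_of_nonneg_right h (Real.exp_pos _).le).trans ?_
  have e : Real.exp 1 / Real.sqrt 2 * (Real.sqrt (2 * ((k + 1 : ℕ) : ℝ))
      * (((k + 1 : ℕ) : ℝ) ^ (k + 1) / Real.exp ((k + 1 : ℕ) : ℝ))) * Real.exp ((k + 1 : ℕ) : ℝ)
      = Real.exp 1 / Real.sqrt 2 * Real.sqrt (2 * ((k + 1 : ℕ) : ℝ))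
        * ((k + 1 : ℕ) : ℝ) ^ (k + 1) := by
    field_simp
  rw [e]
  refine mul_le_mul_of_nonneg_right ?_ (by positivity)
  rw [div_mul_eq_mul_div, div_le_iff₀ (by positivity)]
  calc _ ≤ Real.exp 1 * (Real.sqrt 2 * ((k + 1 : ℕ) + 1 : ℝ)) := by gcongr
    _ = _ := by ring

/-- The scale `k / ω` gives `β = (z - ω) / ω`, the quadratic coefficient matching because `ω (z - ω)
= t k / n`. The saddle value `exp (k (1 + β/2))`, combined with `|ω|^k`, yields `exp k` times the
exponential of `n` times the rate. -/
theorem norm_eval_hermiteFlow {t : ℝ} {n k : ℕ} (hn : n ≠ 0) (hk : k ≠ 0) {z ω : ℂ}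
    (hω : IsOuterRoot (t * (k / n)) z ω) (h0 : ω ≠ 0) :
    ‖(hermiteFlow ((t : ℂ) / n) k).eval z‖
      = stirlingFactor k * Real.exp (n * rate (k / n) z ω)
        * ‖saddleIntegral k ((z - ω) / ω)‖ := by
  have hk' : (k : ℂ) ≠ 0 := by exact_mod_cast hk
  have hn' : (n : ℂ) ≠ 0 := by exact_mod_cast hn
  have hnr : (n : ℝ) ≠ 0 := by exact_mod_cast hn
  have h1 := hω.1
  push_cast at h1
  rw [eval_hermiteFlow _ _ (div_ne_zero hk' h0)]
  have e1 : (k : ℂ) / ω * z = k * (1 + (z - ω) / ω) := by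
    field_simp
    ring
  have e2 : (t : ℂ) / n * (k / ω) ^ 2 = k * ((z - ω) / ω) := by
    have : z - ω = (t * k / n) / ω := by
      rw [eq_div_iff h0]
      linear_combination h1
    rw [this]
    field_simp
  rw [e1, e2, gaussCoeff_eq_saddleIntegral, norm_mul, norm_mul, norm_mul, Complex.norm_exp,
    norm_pow, inv_div, norm_div, Complex.norm_natCast, Complex.norm_natCast]
  have e3 : ((k : ℂ) * (1 + (z - ω) / ω / 2)).re = k + k / 2 * ((z - ω) / ω).re := by
    have : (k : ℂ) * (1 + (z - ω) / ω / 2) = k + ((k / 2 : ℝ) : ℂ) * ((z - ω) / ω) := by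
      push_cast
      ring
    rw [this, Complex.add_re, Complex.re_ofReal_mul]
    simp
  have e4 : (n : ℝ) * rate (k / n) z ω = k * Real.log ‖ω‖ + k / 2 * ((z - ω) / ω).re := by
    rw [rate]
    field_simp
  rw [e3, e4, Real.exp_add, Real.exp_add, stirlingFactor, ← Real.log_pow,
    Real.exp_log (by positivity), div_pow]
  ring

theorem norm_eval_hermiteFlow_le {t : ℝ} (ht : 0 ≤ t) {n k : ℕ} (hn : n ≠ 0) {z ω : ℂ}
    (hz : 0 < t ∨ z ≠ 0) (hω : IsOuterRoot (t * (k / n)) z ω) :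
    ‖(hermiteFlow ((t : ℂ) / n) k).eval z‖
      ≤ Real.exp 1 * (k + 1) * Real.exp (n * rate (k / n) z ω) := by
  rcases eq_or_ne k 0 with rfl | hk
  · simp [hermiteFlow_zero, rate]
  have h0 : ω ≠ 0 := by
    rcases ht.eq_or_lt with rfl | ht
    · rw [zero_mul] at hω
      rw [hω.eq_of_zero]
      exact hz.resolve_left (lt_irrefl _)
    · exact hω.ne_zero (by positivity)
  rw [norm_eval_hermiteFlow hn hk hω h0]
  have hβ : ‖(z - ω) / ω‖ ≤ 1 := by
    rw [norm_div]
    exact div_le_one_of_le₀ hω.2 (norm_nonneg _)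
  calc _ ≤ Real.exp 1 * (k + 1) * Real.exp (n * rate (k / n) z ω) * 1 := by
        gcongr
        · exact stirlingFactor_le k
        · exact norm_saddleIntegral_le k hβ
    _ = _ := mul_one _

theorem continuousAt_outerRoot {t α : ℝ} {z : ℂ}
    (hlt : ‖z - outerRoot (t * α) z‖ < ‖outerRoot (t * α) z‖) :
    ContinuousAt (fun β => outerRoot (t * β) z) α :=
  (hasDerivAt_outerRoot (W := fun β => outerRoot (t * β) z) (fun _ => outerRoot_spec _ _)
    hlt).continuousAt

/-- Off the cut `β` tends to a point of the open unit disc, so the saddle integral is at least of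
order `1 / √κ`, a subexponential loss. -/
theorem eventually_le_norm_eval_hermiteFlow {t : ℝ} {z : ℂ} {α : ℝ} (hα : 0 < α)
    (hlt : ‖z - outerRoot (t * α) z‖ < ‖outerRoot (t * α) z‖) {κ : ℕ → ℕ}
    (hκ : Tendsto (fun n => (κ n : ℝ) / n) atTop (𝓝 α)) {ε : ℝ} (hε : 0 < ε) :
    ∀ᶠ n : ℕ in atTop, Real.exp (n * (rate α z (outerRoot (t * α) z) - ε))
      ≤ ‖(hermiteFlow ((t : ℂ) / n) (κ n)).eval z‖ := by
  set W : ℝ → ℂ := fun β => outerRoot (t * β) z with hW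
  have hWs : ∀ β, IsOuterRoot (t * β) z (W β) := fun _ => outerRoot_spec _ _
  have h0 : W α ≠ 0 := norm_pos_iff.1 ((norm_nonneg _).trans_lt hlt)
  have hκtop : Tendsto κ atTop atTop := by
    have h1 : Tendsto (fun n : ℕ => (κ n : ℝ) / n * n) atTop atTop :=
      hκ.pos_mul_atTop hα tendsto_natCast_atTop_atTop
    refine tendsto_natCast_atTop_iff.1 (h1.congr' ?_)
    filter_upwards [eventually_ne_atTop 0] with n hn
    have : (n : ℝ) ≠ 0 := by exact_mod_cast hn
    field_simp
  have hWlim : Tendsto (fun n => W ((κ n : ℝ) / n)) atTop (𝓝 (W α)) :=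
    (continuousAt_outerRoot hlt).tendsto.comp hκ
  have hβ : Tendsto (fun n => (z - W ((κ n : ℝ) / n)) / W ((κ n : ℝ) / n)) atTop
      (𝓝 ((z - W α) / W α)) := (tendsto_const_nhds.sub hWlim).div hWlim h0
  have hb : ‖(z - W α) / W α‖ < 1 := by
    rw [norm_div, div_lt_one (norm_pos_iff.2 h0)]
    exact hlt
  obtain ⟨c, hc, hcI⟩ := exists_le_norm_saddleIntegral hκtop hβ hb
  have hrate : Tendsto (fun n => rate ((κ n : ℝ) / n) z (W ((κ n : ℝ) / n))) atTop
      (𝓝 (rate α z (W α))) := (hasDerivAt_rate hWs hlt).continuousAt.tendsto.comp hκ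
  have hbig : ∀ᶠ n : ℕ in atTop, (α + 1) * n ≤ c * Real.exp (n * (ε / 2)) := by
    have h1 : Tendsto (fun n : ℕ => Real.exp (n * (ε / 2)) / (n * (ε / 2)) ^ 1) atTop atTop :=
      (Real.tendsto_exp_div_pow_atTop 1).comp
        (tendsto_natCast_atTop_atTop.atTop_mul_const (half_pos hε))
    filter_upwards [h1.eventually_ge_atTop ((α + 1) / c / (ε / 2)), eventually_gt_atTop 0]
      with n hn hn0
    have hn0' : (0 : ℝ) < n := by exact_mod_cast hn0
    rw [pow_one, le_div_iff₀ (by positivity)] at hn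
    have e : (α + 1) / c / (ε / 2) * (n * (ε / 2)) = (α + 1) * n / c := by field_simp
    rw [e, div_le_iff₀ hc] at hn
    linarith
  filter_upwards [hcI, hbig, hrate.eventually_const_lt (u := rate α z (W α) - ε / 2) (by linarith),
    hWlim.eventually_ne h0, hκtop.eventually_ge_atTop 1, eventually_gt_atTop 0,
    hκ.eventually_lt_const (u := α + 1) (by linarith)] with n h1 h2 h3 h4 h5 h6 h7
  have hn0 : (0 : ℝ) < n := by exact_mod_cast h6
  rw [norm_eval_hermiteFlow h6.ne' (by omega) (hWs _) h4]
  rw [div_lt_iff₀ hn0] at h7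
  have hκ1 : (1 : ℝ) ≤ κ n := by exact_mod_cast h5
  have hs : Real.sqrt (κ n) ≤ (α + 1) * n := by
    refine le_trans ?_ h7.le
    rw [Real.sqrt_le_left (by positivity)]
    nlinarith
  set I := ‖saddleIntegral (κ n) ((z - W ((κ n : ℝ) / n)) / W ((κ n : ℝ) / n))‖ with hI
  have hI0 : 0 ≤ I := norm_nonneg _
  have h8 : Real.exp (-(n * (ε / 2))) ≤ I := by
    rw [Real.exp_neg, inv_le_iff_one_le_mul₀' (Real.exp_pos _)]
    have : c ≤ c * (Real.exp (n * (ε / 2)) * I) := by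
      calc c ≤ Real.sqrt (κ n) * I := h1
        _ ≤ c * Real.exp (n * (ε / 2)) * I := by gcongr; exact hs.trans h2
        _ = _ := by ring
    nlinarith
  calc Real.exp (n * (rate α z (W α) - ε))
      = 1 * Real.exp (n * (rate α z (W α) - ε / 2)) * Real.exp (-(n * (ε / 2))) := by
        rw [one_mul, ← Real.exp_add]; congr 1; ring
    _ ≤ _ := by
        have hst := one_le_stirlingFactor (κ n)
        gcongr

/-! ### Truncated logarithmic kernels -/

/-- The logarithm of the norm, truncated from below at scale `δ`. -/
noncomputable def logCutoff (δ : ℝ) (v : ℂ) : ℝ := Real.log (max δ ‖v‖)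

section LogCutoff

variable {δ r : ℝ}

theorem continuous_logCutoff (hδ : 0 < δ) : Continuous (logCutoff δ) :=
  Continuous.log (by fun_prop) fun _ => (lt_max_of_lt_left hδ).ne'

theorem logCutoff_le_add (hδ : 0 < δ) (v w : ℂ) :
    logCutoff δ v ≤ logCutoff δ w + ‖v - w‖ / δ := by
  have hw : 0 < max δ ‖w‖ := lt_max_of_lt_left hδ
  have hv : 0 < max δ ‖v‖ := lt_max_of_lt_left hδ
  have h1 : max δ ‖v‖ ≤ max δ ‖w‖ + ‖v - w‖ := by
    refine max_le ((le_max_left _ _).trans (le_add_of_nonneg_right (norm_nonneg _))) ?_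
    have := norm_le_norm_add_norm_sub' v w
    linarith [le_max_right δ ‖w‖]
  have h2 : max δ ‖v‖ ≤ max δ ‖w‖ * Real.exp (‖v - w‖ / δ) := by
    have h3 := Real.add_one_le_exp (‖v - w‖ / δ)
    have h4 : ‖v - w‖ ≤ max δ ‖w‖ * (‖v - w‖ / δ) := by
      rw [mul_div_assoc', le_div_iff₀ hδ, mul_comm]
      exact mul_le_mul_of_nonneg_right (le_max_left _ _) (norm_nonneg _)
    nlinarith
  calc logCutoff δ v ≤ Real.log (max δ ‖w‖ * Real.exp (‖v - w‖ / δ)) := Real.log_le_log hv h2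
    _ = _ := by rw [Real.log_mul hw.ne' (Real.exp_pos _).ne', Real.log_exp, logCutoff]

theorem log_norm_le_logCutoff {v : ℂ} (hv : v ≠ 0) : Real.log ‖v‖ ≤ logCutoff δ v :=
  Real.log_le_log (norm_pos_iff.2 hv) (le_max_right _ _)

/-- Jensen's formula: truncating the logarithm at scale `r` is the same as averaging it over circles
of radius `r`. -/
theorem circleAverage_log_norm_sub (hr : 0 < r) (z y : ℂ) :
    Real.circleAverage (fun w => Real.log ‖w - y‖) z r = logCutoff r (z - y) := by
  rw [circleAverage_log_norm_sub_const_eq_log_radius_add_posLog hr.ne', inv_mul_eq_div, log_add_posLog_div hr (norm_nonneg _), logCutoff]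

/-- Countably many exceptions are needed at zeros, where `Real.log 0 = 0` breaks the pointwise
inequality. -/
theorem circleAverage_le_of_countable {f₁ f₂ : ℂ → ℝ} {z : ℂ} (hr : 0 < r)
    (h₁ : CircleIntegrable f₁ z r) (h₂ : CircleIntegrable f₂ z r) {s : Set ℂ} (hs : s.Countable)
    (h : ∀ w ∈ Metric.sphere z r, w ∉ s → f₁ w ≤ f₂ w) :
    Real.circleAverage f₁ z r ≤ Real.circleAverage f₂ z r := by
  refine smul_le_smul_of_nonneg_left ?_ (by positivity)
  refine intervalIntegral.integral_mono_ae (by positivity) h₁ h₂ ?_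
  have hnull : volume (circleMap z r ⁻¹' s) = 0 :=
    (hs.preimage_circleMap z hr.ne').measure_zero _
  filter_upwards [compl_mem_ae_iff.2 hnull] with θ hθ
  exact h _ (circleMap_mem_sphere z hr.le θ) hθ

theorem logCutoff_le_circleAverage (hδ : 0 < δ) (hr : 0 < r) (z y : ℂ) :
    logCutoff r (z - y) ≤ Real.circleAverage (fun w => logCutoff δ (w - y)) z r := by
  rw [← circleAverage_log_norm_sub hr]
  refine circleAverage_le_of_countable hr (circleIntegrable_log_norm_sub_const r) ?_
    (countable_singleton y) fun w _ hw => ?_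
  · exact (((continuous_logCutoff hδ).comp (by fun_prop)).continuousOn).circleIntegrable hr.le
  · exact log_norm_le_logCutoff (sub_ne_zero.2 hw)

/-- The cutoff is at most `(1/2) log (δ² + |w - y|²)`. Along the circle, `δ² + |w - y|²` is the
squared distance from a point of the circle of radius `M` about `0` to a fixed point `-X` with `|X|
≤ M`. Jensen's formula then gives the average `log M`, and `M ≤ max r |v| + δ`. -/
theorem circleAverage_logCutoff_le (hδ : 0 < δ) (hr : 0 < r) (z y : ℂ) :
    Real.circleAverage (fun w => logCutoff δ (w - y)) z r ≤ logCutoff r (z - y) + δ / r := by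
  set v := z - y with hv
  -- `A` and `B` are `M + |X|` and `M - |X|`, which solve `M² + |X|² = |v|² + r² + δ²` and `M |X| =
  -- r |v|`.
  set A := Real.sqrt ((‖v‖ + r) ^ 2 + δ ^ 2) with hA
  set B := Real.sqrt ((‖v‖ - r) ^ 2 + δ ^ 2) with hB
  have hA2 : A ^ 2 = (‖v‖ + r) ^ 2 + δ ^ 2 := Real.sq_sqrt (by positivity)
  have hB2 : B ^ 2 = (‖v‖ - r) ^ 2 + δ ^ 2 := Real.sq_sqrt (by positivity)
  have hA0 : 0 < A := Real.sqrt_pos.2 (by positivity)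
  have hB0 : 0 < B := Real.sqrt_pos.2 (by positivity)
  set M := (A + B) / 2 with hM
  have hM0 : 0 < M := by positivity
  have hm : r / M * ‖v‖ = (A - B) / 2 := by
    rw [div_mul_eq_mul_div, div_eq_iff hM0.ne', hM]
    linear_combination (hB2 - hA2) / 4
  have hAle : A ≤ ‖v‖ + r + δ := by
    rw [hA, Real.sqrt_le_left (by positivity)]
    nlinarith [norm_nonneg v, mul_nonneg (norm_nonneg v) hδ.le, mul_pos hr hδ]
  have hBle : B ≤ |‖v‖ - r| + δ := by
    rw [hB, Real.sqrt_le_left (by positivity)]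
    nlinarith [abs_nonneg (‖v‖ - r), mul_nonneg (abs_nonneg (‖v‖ - r)) hδ.le,
      sq_abs (‖v‖ - r)]
  have hMle : M ≤ max r ‖v‖ + δ := by
    rw [hM]
    rcases le_total r ‖v‖ with h | h
    · rw [max_eq_right h]
      rw [abs_of_nonneg (sub_nonneg.2 h)] at hBle
      linarith
    · rw [max_eq_left h]
      rw [abs_of_nonpos (sub_nonpos.2 h)] at hBle
      linarith
  set X : ℂ := ((r / M : ℝ) : ℂ) * v with hX
  have hXn : ‖X‖ = r / M * ‖v‖ := by
    rw [hX, norm_mul, Complex.norm_real, Real.norm_eq_abs, abs_of_pos (by positivity)]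
  have hpt : ∀ θ : ℝ, ‖circleMap 0 M θ - -X‖ ^ 2 = δ ^ 2 + ‖circleMap z r θ - y‖ ^ 2 := by
    intro θ
    have e1 : circleMap 0 M θ - -X
        = ((r / M : ℝ) : ℂ) * v + (M : ℂ) * Complex.exp (θ * Complex.I) := by
      rw [circleMap, hX]; ring
    have e2 : circleMap z r θ - y = v + (r : ℂ) * Complex.exp (θ * Complex.I) := by
      rw [circleMap, hv]; ring
    have hnv : v.re ^ 2 + v.im ^ 2 = ‖v‖ ^ 2 := by
      rw [Complex.sq_norm, Complex.normSq_apply]; ring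
    have hkey : (r / M) ^ 2 * ‖v‖ ^ 2 + M ^ 2 = ‖v‖ ^ 2 + r ^ 2 + δ ^ 2 := by
      rw [← mul_pow, hm, hM]
      linear_combination (hA2 + hB2) / 2
    have hrM : r / M * M = r := div_mul_cancel₀ _ hM0.ne'
    rw [e1, e2, Complex.sq_norm, Complex.sq_norm, Complex.normSq_apply, Complex.normSq_apply]
    simp only [Complex.add_re, Complex.add_im, Complex.re_ofReal_mul, Complex.im_ofReal_mul,
      Complex.exp_ofReal_mul_I_re, Complex.exp_ofReal_mul_I_im]
    have hcs := Real.sin_sq_add_cos_sq θ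
    linear_combination ((r / M) ^ 2 - 1) * hnv + hkey + (M ^ 2 - r ^ 2) * hcs
      + 2 * (v.re * Real.cos θ + v.im * Real.sin θ) * hrM
  have hupper : Real.circleAverage (fun w => logCutoff δ (w - y)) z r
      ≤ Real.circleAverage (fun w => 1 / 2 * Real.log (δ ^ 2 + ‖w - y‖ ^ 2)) z r := by
    refine Real.circleAverage_mono ?_ ?_ fun w _ => ?_
    · exact (((continuous_logCutoff hδ).comp (by fun_prop)).continuousOn).circleIntegrable hr.le
    · refine ContinuousOn.circleIntegrable hr.le (Continuous.continuousOn ?_)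
      exact continuous_const.mul (Continuous.log (by fun_prop) fun w => by positivity)
    · have h0 : 0 < max δ ‖w - y‖ := lt_max_of_lt_left hδ
      have h1 : (max δ ‖w - y‖) ^ 2 ≤ δ ^ 2 + ‖w - y‖ ^ 2 := by
        rcases max_cases δ ‖w - y‖ with h | h <;> rw [h.1] <;> nlinarith [norm_nonneg (w - y)]
      have h2 := Real.log_le_log (by positivity) h1
      rw [Real.log_pow] at h2
      simp only [logCutoff]
      push_cast at h2
      linarith
  have heq : Real.circleAverage (fun w => 1 / 2 * Real.log (δ ^ 2 + ‖w - y‖ ^ 2)) z r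
      = Real.circleAverage (fun w => Real.log ‖w - -X‖) 0 M := by
    simp only [Real.circleAverage_def]
    congr 1
    refine intervalIntegral.integral_congr fun θ _ => ?_
    rw [← hpt, Real.log_pow]
    push_cast
    ring
  rw [heq, circleAverage_log_norm_sub hM0] at hupper
  refine hupper.trans ?_
  have hmax : 0 < max r ‖v‖ := lt_max_of_lt_left hr
  have hXM : ‖(0 : ℂ) - -X‖ ≤ M := by
    rw [zero_sub, neg_neg, hXn, hm, hM]
    linarith
  rw [logCutoff, max_eq_left hXM, logCutoff]
  have h1 : M ≤ max r ‖v‖ * Real.exp (δ / r) := by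
    have h3 := Real.add_one_le_exp (δ / r)
    have h4 : δ ≤ max r ‖v‖ * (δ / r) := by
      rw [mul_div_assoc', le_div_iff₀ hr, mul_comm]
      exact mul_le_mul_of_nonneg_right (le_max_left _ _) hδ.le
    nlinarith
  calc Real.log M ≤ Real.log (max r ‖v‖ * Real.exp (δ / r)) := Real.log_le_log hM0 h1
    _ = _ := by rw [Real.log_mul hmax.ne' (Real.exp_pos _).ne', Real.log_exp]

end LogCutoff

/-! ### Compactly supported measures -/

section CompactSupport

variable {σ : Measure ℂ} [IsFiniteMeasure σ] {R δ r : ℝ}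

theorem integrable_of_compactSupport (hσ : σ (Metric.closedBall 0 R)ᶜ = 0) {f : ℂ → ℝ}
    (hf : Continuous f) : Integrable f σ := by
  obtain ⟨M, hM⟩ := (isCompact_closedBall (0 : ℂ) R).exists_bound_of_continuousOn hf.continuousOn
  refine Integrable.of_bound hf.aestronglyMeasurable M ?_
  filter_upwards [compl_mem_ae_iff.2 hσ] with y hy
  exact hM y (by simpa using hy)

/-- The truncated logarithmic potential. -/
noncomputable def cutoffPotential (σ : Measure ℂ) (δ : ℝ) (z : ℂ) : ℝ :=
  ∫ y, logCutoff δ (z - y) ∂σ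

theorem integrable_logCutoff (hσ : σ (Metric.closedBall 0 R)ᶜ = 0) (hδ : 0 < δ) (z : ℂ) :
    Integrable (fun y => logCutoff δ (z - y)) σ :=
  integrable_of_compactSupport hσ ((continuous_logCutoff hδ).comp (by fun_prop))

theorem cutoffPotential_le_add (hσ : σ (Metric.closedBall 0 R)ᶜ = 0) (hδ : 0 < δ) (z w : ℂ) :
    cutoffPotential σ δ z ≤ cutoffPotential σ δ w + ‖z - w‖ / δ * σ.real univ := by
  have h1 := integrable_logCutoff hσ hδ w
  have : cutoffPotential σ δ w + ‖z - w‖ / δ * σ.real univ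
      = ∫ y, (logCutoff δ (w - y) + ‖z - w‖ / δ) ∂σ := by
    rw [integral_add h1 (integrable_const _), integral_const, smul_eq_mul, mul_comm (σ.real univ)]
    rfl
  rw [this]
  refine integral_mono (integrable_logCutoff hσ hδ z) (h1.add (integrable_const _)) fun y => ?_
  have := logCutoff_le_add hδ (z - y) (w - y)
  rwa [sub_sub_sub_cancel_right] at this

theorem continuous_cutoffPotential (hσ : σ (Metric.closedBall 0 R)ᶜ = 0) (hδ : 0 < δ) :
    Continuous (cutoffPotential σ δ) := by
  have : LipschitzWith (Real.toNNReal (σ.real univ / δ)) (cutoffPotential σ δ) := by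
    refine LipschitzWith.of_le_add_mul _ fun z w => ?_
    rw [Real.coe_toNNReal _ (by positivity), dist_eq_norm]
    refine (cutoffPotential_le_add hσ hδ z w).trans (le_of_eq ?_)
    ring
  exact this.continuous

theorem circleAverage_integral (hσ : σ (Metric.closedBall 0 R)ᶜ = 0) {K : ℂ → ℝ}
    (hK : Continuous K) (z : ℂ) (r : ℝ) :
    Real.circleAverage (fun w => ∫ y, K (w - y) ∂σ) z r
      = ∫ y, Real.circleAverage (fun w => K (w - y)) z r ∂σ := by
  simp only [Real.circleAverage_def]
  rw [integral_smul]
  congr 1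
  simp only [intervalIntegral.integral_of_le Real.two_pi_pos.le]
  refine integral_integral_swap (f := fun θ y => K (circleMap z r θ - y)) ?_
  have hcont : Continuous fun q : ℝ × ℂ => K (circleMap z r q.1 - q.2) :=
    hK.comp (((continuous_circleMap z r).comp continuous_fst).sub continuous_snd)
  obtain ⟨M, hM⟩ := (isCompact_Icc.prod (isCompact_closedBall (0 : ℂ) R)).exists_bound_of_continuousOn
    (s := Icc 0 (2 * Real.pi) ×ˢ Metric.closedBall (0 : ℂ) R) hcont.continuousOn
  refine Integrable.of_bound hcont.aestronglyMeasurable M ?_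
  have h1 : ∀ᵐ q ∂((volume.restrict (Ioc 0 (2 * Real.pi))).prod σ), q.1 ∈ Ioc 0 (2 * Real.pi) :=
    Measure.quasiMeasurePreserving_fst.ae (ae_restrict_mem measurableSet_Ioc)
  have h2 : ∀ᵐ q ∂((volume.restrict (Ioc 0 (2 * Real.pi))).prod σ),
      q.2 ∈ Metric.closedBall (0 : ℂ) R :=
    Measure.quasiMeasurePreserving_snd.ae (mem_ae_iff.2 hσ)
  filter_upwards [h1, h2] with q hq1 hq2
  exact hM q ⟨Ioc_subset_Icc_self hq1, hq2⟩

theorem continuous_circleAverage_sub {K : ℂ → ℝ} (hK : Continuous K) (z : ℂ) (r : ℝ) :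
    Continuous fun y : ℂ => Real.circleAverage (fun w => K (w - y)) z r := by
  have h : Continuous (Function.uncurry fun (y : ℂ) (θ : ℝ) => K (circleMap z r θ - y)) :=
    hK.comp (((continuous_circleMap z r).comp continuous_snd).sub continuous_fst)
  exact (intervalIntegral.continuous_parametric_intervalIntegral_of_continuous' (μ := volume) h 0
    (2 * Real.pi)).const_smul ((2 * Real.pi)⁻¹)

theorem cutoffPotential_le_circleAverage (hσ : σ (Metric.closedBall 0 R)ᶜ = 0) (hδ : 0 < δ)
    (hr : 0 < r) (z : ℂ) :
    cutoffPotential σ r z ≤ Real.circleAverage (cutoffPotential σ δ) z r := by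
  rw [show cutoffPotential σ δ = fun w => ∫ y, logCutoff δ (w - y) ∂σ from rfl,
    circleAverage_integral hσ (continuous_logCutoff hδ)]
  exact integral_mono (integrable_logCutoff hσ hr z)
    (integrable_of_compactSupport hσ (continuous_circleAverage_sub (continuous_logCutoff hδ) z r))
    fun y => logCutoff_le_circleAverage hδ hr z y

theorem circleAverage_cutoffPotential_le (hσ : σ (Metric.closedBall 0 R)ᶜ = 0) (hδ : 0 < δ)
    (hr : 0 < r) (z : ℂ) :
    Real.circleAverage (cutoffPotential σ δ) z r
      ≤ cutoffPotential σ r z + δ / r * σ.real univ := by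
  have h1 := integrable_logCutoff hσ hr z
  have : cutoffPotential σ r z + δ / r * σ.real univ
      = ∫ y, (logCutoff r (z - y) + δ / r) ∂σ := by
    rw [integral_add h1 (integrable_const _), integral_const, smul_eq_mul, mul_comm (σ.real univ)]
    rfl
  rw [this, show cutoffPotential σ δ = fun w => ∫ y, logCutoff δ (w - y) ∂σ from rfl,
    circleAverage_integral hσ (continuous_logCutoff hδ)]
  exact integral_mono
    (integrable_of_compactSupport hσ (continuous_circleAverage_sub (continuous_logCutoff hδ) z r))
    (h1.add (integrable_const _)) fun y => circleAverage_logCutoff_le hδ hr z y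

/-! ### Comparison of measures through their truncated potentials -/

/-- A bump of height `1`, equal to `1` on the disc of radius `r` and vanishing outside the disc of
radius `e r`. -/
noncomputable def logBump (r : ℝ) (v : ℂ) : ℝ := logCutoff (Real.exp 1 * r) v - logCutoff r v

theorem continuous_logBump (hr : 0 < r) : Continuous (logBump r) :=
  (continuous_logCutoff (by positivity)).sub (continuous_logCutoff hr)

theorem le_exp_one_mul (hr : 0 < r) : r ≤ Real.exp 1 * r :=
  le_mul_of_one_le_left hr.le (Real.one_le_exp zero_le_one)

theorem logBump_mem_Icc (hr : 0 < r) (v : ℂ) : logBump r v ∈ Icc (0 : ℝ) 1 := by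
  have h0 : 0 < max r ‖v‖ := lt_max_of_lt_left hr
  have h1 : 1 ≤ Real.exp 1 := Real.one_le_exp zero_le_one
  refine ⟨sub_nonneg.2 (Real.log_le_log h0 (max_le_max_right _ (le_exp_one_mul hr))), ?_⟩
  rw [logBump, sub_le_iff_le_add]
  calc logCutoff (Real.exp 1 * r) v ≤ Real.log (Real.exp 1 * max r ‖v‖) := by
        refine Real.log_le_log (lt_max_of_lt_left (by positivity)) (max_le ?_ ?_)
        · exact mul_le_mul_of_nonneg_left (le_max_left _ _) (Real.exp_pos _).le
        · exact (le_max_right _ _).trans (le_mul_of_one_le_left h0.le h1)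
    _ = _ := by rw [Real.log_mul (Real.exp_pos _).ne' h0.ne', Real.log_exp, logCutoff]

theorem logBump_zero (hr : 0 < r) : logBump r 0 = 1 := by
  rw [logBump, logCutoff, logCutoff, norm_zero, max_eq_left hr.le,
    max_eq_left (mul_pos (Real.exp_pos 1) hr).le, Real.log_mul (Real.exp_pos _).ne' hr.ne',
    Real.log_exp, add_sub_cancel_right]

theorem logBump_eq_zero (hr : 0 < r) {v : ℂ} (hv : Real.exp 1 * r ≤ ‖v‖) : logBump r v = 0 := by
  rw [logBump, logCutoff, logCutoff, max_eq_right hv,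
    max_eq_right ((le_exp_one_mul hr).trans hv), sub_self]

theorem hasCompactSupport_logBump (hr : 0 < r) : HasCompactSupport (logBump r) := by
  refine HasCompactSupport.of_support_subset_isCompact
    (isCompact_closedBall (0 : ℂ) (Real.exp 1 * r)) fun v hv => ?_
  rw [Metric.mem_closedBall, dist_zero_right]
  by_contra h
  exact hv (logBump_eq_zero hr (not_le.1 h).le)

theorem integral_logBump_pos (hr : 0 < r) : 0 < ∫ v, logBump r v :=
  (continuous_logBump hr).integral_pos_of_hasCompactSupport_nonneg_nonzero
    (hasCompactSupport_logBump hr) (fun v => (logBump_mem_Icc hr v).1) (x := 0)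
    (by rw [logBump_zero hr]; exact one_ne_zero)

theorem integral_logBump_sub (hσ : σ (Metric.closedBall 0 R)ᶜ = 0) (hr : 0 < r) (z : ℂ) :
    ∫ y, logBump r (z - y) ∂σ
      = cutoffPotential σ (Real.exp 1 * r) z - cutoffPotential σ r z :=
  integral_sub (integrable_logCutoff hσ (by positivity) z) (integrable_logCutoff hσ hr z)

/-- Smoothing a test function with the bump changes its integral by little. -/
theorem abs_integral_smoothing_sub_le (hσ : σ (Metric.closedBall 0 R)ᶜ = 0) (hr : 0 < r)
    {f : ℂ → ℝ} (hf : Continuous f) (hfc : HasCompactSupport f) {κ : ℝ}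
    (hκ : ∀ z y, ‖z - y‖ ≤ Real.exp 1 * r → |f z - f y| ≤ κ) :
    |(∫ z, f z * ∫ y, logBump r (z - y) ∂σ) - (∫ v, logBump r v) * ∫ y, f y ∂σ|
      ≤ κ * (∫ v, logBump r v) * σ.real univ := by
  have hfi : Integrable f := hf.integrable_of_hasCompactSupport hfc
  have hcB := continuous_logBump hr
  have hB : Integrable (logBump r) := hcB.integrable_of_hasCompactSupport (hasCompactSupport_logBump hr)
  have hint : Integrable (Function.uncurry fun z y => f z * logBump r (z - y))
      ((volume : Measure ℂ).prod σ) := by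
    refine Integrable.mul_bdd (c := 1) (hfi.comp_fst σ) ?_ (Eventually.of_forall fun q => ?_)
    · exact (hcB.comp (continuous_fst.sub continuous_snd)).aestronglyMeasurable
    · have := logBump_mem_Icc hr (q.1 - q.2)
      rw [Real.norm_eq_abs, abs_of_nonneg this.1]
      exact this.2
  have hswap : (∫ z, f z * ∫ y, logBump r (z - y) ∂σ)
      = ∫ y, (∫ z, f z * logBump r (z - y)) ∂σ := by
    simp_rw [← integral_const_mul]
    exact integral_integral_swap hint
  have hinner : ∀ y, |(∫ z, f z * logBump r (z - y)) - (∫ v, logBump r v) * f y|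
      ≤ κ * ∫ v, logBump r v := by
    intro y
    have hBy : Integrable fun z => logBump r (z - y) := hB.comp_sub_right y
    have hfB : Integrable fun z => f z * logBump r (z - y) := by
      refine Integrable.mul_bdd (c := 1) hfi ?_ (Eventually.of_forall fun z => ?_)
      · exact (hcB.comp (continuous_id.sub continuous_const)).aestronglyMeasurable
      · have := logBump_mem_Icc hr (z - y)
        rw [Real.norm_eq_abs, abs_of_nonneg this.1]
        exact this.2
    have e1 : ∫ v, logBump r v = ∫ z, logBump r (z - y) :=
      (integral_sub_right_eq_self (logBump r) y).symm
    rw [e1, mul_comm _ (f y), ← integral_const_mul, ← integral_sub hfB (hBy.const_mul _),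
      ← integral_const_mul]
    refine abs_integral_le_integral_abs.trans (integral_mono (hfB.sub (hBy.const_mul _)).abs
      (hBy.const_mul κ) fun z => ?_)
    have hm := logBump_mem_Icc hr (z - y)
    simp only
    rw [← sub_mul, abs_mul, abs_of_nonneg hm.1]
    by_cases hz : ‖z - y‖ ≤ Real.exp 1 * r
    · exact mul_le_mul_of_nonneg_right (hκ z y hz) hm.1
    · rw [logBump_eq_zero hr (not_le.1 hz).le]
      simp
  have hint' : Integrable (fun y => ∫ z, f z * logBump r (z - y)) σ := hint.integral_prod_right
  rw [hswap, ← integral_const_mul, ← integral_sub hint'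
    ((integrable_of_compactSupport hσ hf).const_mul _)]
  refine abs_integral_le_integral_abs.trans ?_
  have h2 : ∫ _ : ℂ, κ * (∫ v, logBump r v) ∂σ = κ * (∫ v, logBump r v) * σ.real univ := by
    rw [integral_const, smul_eq_mul, mul_comm]
  rw [← h2]
  exact integral_mono (hint'.sub
    ((integrable_of_compactSupport hσ hf).const_mul _)).abs (integrable_const _) hinner

/-- Two measures whose truncated potentials are close up to a constant have close integrals of a
given test function. -/
theorem abs_integral_sub_le_of_cutoffPotential {ν : Measure ℂ} [IsFiniteMeasure ν] {R' : ℝ}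
    (hσ : σ (Metric.closedBall 0 R)ᶜ = 0) (hν : ν (Metric.closedBall 0 R')ᶜ = 0) (hr : 0 < r)
    {f : ℂ → ℝ} (hf : Continuous f) (hfc : HasCompactSupport f) {κ : ℝ}
    (hκ : ∀ z y, ‖z - y‖ ≤ Real.exp 1 * r → |f z - f y| ≤ κ) (hσ1 : σ.real univ ≤ 1)
    (hν1 : ν.real univ ≤ 1) {a τ : ℝ}
    (hD : ∀ z ∈ tsupport f, ∀ s ∈ Icc r (Real.exp 1 * r),
      |cutoffPotential σ s z + a - cutoffPotential ν s z| ≤ τ) :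
    |(∫ y, f y ∂σ) - ∫ y, f y ∂ν| ≤ 2 * κ + 2 * τ * (∫ z, |f z|) / ∫ v, logBump r v := by
  have hb := integral_logBump_pos hr
  set b := ∫ v, logBump r v with hbdef
  have hκ0 : 0 ≤ κ := (abs_nonneg _).trans (hκ 0 0 (by simpa using by positivity))
  have hfi : Integrable f := hf.integrable_of_hasCompactSupport hfc
  have h1 := abs_integral_smoothing_sub_le hσ hr hf hfc hκ
  have h2 := abs_integral_smoothing_sub_le hν hr hf hfc hκ
  have hle := le_exp_one_mul hr
  have hint : ∀ (ρ : Measure ℂ) [IsFiniteMeasure ρ] (Q : ℝ), ρ (Metric.closedBall 0 Q)ᶜ = 0 →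
      Integrable fun z => f z * ∫ y, logBump r (z - y) ∂ρ := by
    intro ρ _ Q hρ
    simp_rw [integral_logBump_sub hρ hr]
    refine (hf.mul ((continuous_cutoffPotential hρ (by positivity)).sub
      (continuous_cutoffPotential hρ hr))).integrable_of_hasCompactSupport hfc.mul_right
  have h3 : |(∫ z, f z * ∫ y, logBump r (z - y) ∂σ) - ∫ z, f z * ∫ y, logBump r (z - y) ∂ν|
      ≤ 2 * τ * ∫ z, |f z| := by
    rw [← integral_sub (hint σ R hσ) (hint ν R' hν), ← integral_const_mul]
    refine abs_integral_le_integral_abs.trans (integral_mono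
      ((hint σ R hσ).sub (hint ν R' hν)).abs (hfi.abs.const_mul _) fun z => ?_)
    simp only
    rw [← mul_sub, abs_mul, mul_comm]
    by_cases hz : z ∈ tsupport f
    · refine mul_le_mul_of_nonneg_right ?_ (abs_nonneg _)
      -- The bump is a difference of two cutoffs, so the additive constant `a` drops out.
      rw [integral_logBump_sub hσ hr, integral_logBump_sub hν hr]
      have d1 := abs_le.1 (hD z hz r ⟨le_rfl, hle⟩)
      have d2 := abs_le.1 (hD z hz (Real.exp 1 * r) ⟨hle, le_rfl⟩)
      rw [abs_le]
      constructor <;> linarith [d1.1, d1.2, d2.1, d2.2]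
    · rw [image_eq_zero_of_notMem_tsupport hz]
      simp
  have h4 : κ * b * σ.real univ ≤ κ * b := mul_le_of_le_one_right (by positivity) hσ1
  have h5 : κ * b * ν.real univ ≤ κ * b := mul_le_of_le_one_right (by positivity) hν1
  have h6 : b * |(∫ y, f y ∂σ) - ∫ y, f y ∂ν| ≤ b * (2 * κ) + 2 * τ * ∫ z, |f z| := by
    have e : b * |(∫ y, f y ∂σ) - ∫ y, f y ∂ν| = |b * (∫ y, f y ∂σ) - b * ∫ y, f y ∂ν| := by
      rw [← mul_sub, abs_mul, abs_of_pos hb]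
    rw [e]
    rw [abs_le] at h1 h2 h3 ⊢
    constructor <;> linarith [h1.1, h1.2, h2.1, h2.2, h3.1, h3.2]
  rw [← mul_le_mul_iff_right₀ hb, mul_add, mul_div_cancel₀ _ hb.ne']
  exact h6

end CompactSupport

/-! ### Sums of point masses -/

section DiracSum

/-- The sum of the point masses at the elements of a multiset. -/
noncomputable def diracSum (s : Multiset ℂ) : Measure ℂ := (s.map fun z => Measure.dirac z).sum

theorem diracSum_cons (a : ℂ) (s : Multiset ℂ) :
    diracSum (a ::ₘ s) = Measure.dirac a + diracSum s := by
  simp [diracSum]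

theorem diracSum_apply_univ (s : Multiset ℂ) : diracSum s univ = s.card := by
  induction s using Multiset.induction_on with
  | empty => simp [diracSum]
  | cons a s ih => rw [diracSum_cons, Measure.add_apply, ih, Multiset.card_cons]; simp [add_comm]

instance isFiniteMeasure_diracSum (s : Multiset ℂ) : IsFiniteMeasure (diracSum s) :=
  ⟨by rw [diracSum_apply_univ]; exact ENNReal.natCast_lt_top _⟩

theorem integral_diracSum (s : Multiset ℂ) (f : ℂ → ℝ) :
    Integrable f (diracSum s) ∧ ∫ y, f y ∂(diracSum s) = (s.map f).sum := by
  induction s using Multiset.induction_on with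
  | empty => simp [diracSum]
  | cons a s ih =>
    have h1 : Integrable f (Measure.dirac a) := integrable_dirac (by simp)
    rw [diracSum_cons]
    refine ⟨h1.add_measure ih.1, ?_⟩
    rw [integral_add_measure h1 ih.1, ih.2, integral_dirac, Multiset.map_cons, Multiset.sum_cons]

theorem diracSum_closedBall_compl (s : Multiset ℂ) :
    ∃ R : ℝ, diracSum s (Metric.closedBall 0 R)ᶜ = 0 := by
  induction s using Multiset.induction_on with
  | empty => exact ⟨0, by simp [diracSum]⟩
  | cons a s ih =>
    obtain ⟨R, hR⟩ := ih
    refine ⟨max ‖a‖ R, ?_⟩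
    rw [diracSum_cons, Measure.add_apply, add_eq_zero]
    refine ⟨?_, measure_mono_null (compl_subset_compl.2
      (Metric.closedBall_subset_closedBall (le_max_right _ _))) hR⟩
    rw [Measure.dirac_apply' _ Metric.isClosed_closedBall.measurableSet.compl]
    simp

theorem log_norm_prod_sub (s : Multiset ℂ) {w : ℂ} (hw : w ∉ s) :
    Real.log ‖(s.map fun y => w - y).prod‖ = (s.map fun y => Real.log ‖w - y‖).sum := by
  induction s using Multiset.induction_on with
  | empty => simp
  | cons a s ih =>
    rw [Multiset.mem_cons, not_or] at hw
    have h0 : (s.map fun y => w - y).prod ≠ 0 := by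
      refine Multiset.prod_ne_zero fun h => ?_
      obtain ⟨y, hy, h⟩ := Multiset.mem_map.1 h
      exact hw.2 (sub_eq_zero.1 h ▸ hy)
    rw [Multiset.map_cons, Multiset.prod_cons, norm_mul, Real.log_mul
      (norm_ne_zero_iff.2 (sub_ne_zero.2 hw.1)) (norm_ne_zero_iff.2 h0), ih hw.2,
      Multiset.map_cons, Multiset.sum_cons]

theorem circleAverage_sum_log_norm_sub (s : Multiset ℂ) {r : ℝ} (hr : 0 < r) (z : ℂ) :
    CircleIntegrable (fun w => (s.map fun y => Real.log ‖w - y‖).sum) z r ∧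
    Real.circleAverage (fun w => (s.map fun y => Real.log ‖w - y‖).sum) z r
      = (s.map fun y => logCutoff r (z - y)).sum := by
  induction s using Multiset.induction_on with
  | empty => simpa using Real.circleAverage_const (0 : ℝ) z r
  | cons a s ih =>
    have h1 : CircleIntegrable (fun w => Real.log ‖w - a‖) z r :=
      circleIntegrable_log_norm_sub_const r
    simp only [Multiset.map_cons, Multiset.sum_cons]
    refine ⟨h1.add ih.1, ?_⟩
    rw [Real.circleAverage_fun_add h1 ih.1, ih.2, circleAverage_log_norm_sub hr]

end DiracSum

/-! ### Zeros of polynomials with prescribed exponential growth -/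

/-- The zeros of `p`, with mass `1 / n` each. -/
noncomputable def rootMeasure (n : ℕ) (p : Polynomial ℂ) : Measure ℂ :=
  (n : ℝ≥0∞)⁻¹ • diracSum p.roots

section RootMeasure

variable {n : ℕ} {p : Polynomial ℂ}

theorem isFiniteMeasure_rootMeasure (hn : n ≠ 0) : IsFiniteMeasure (rootMeasure n p) :=
  Measure.smul_finite _ (ENNReal.inv_ne_top.2 (by exact_mod_cast hn))

theorem rootMeasure_closedBall_compl (n : ℕ) (p : Polynomial ℂ) :
    ∃ R : ℝ, rootMeasure n p (Metric.closedBall 0 R)ᶜ = 0 := by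
  obtain ⟨R, hR⟩ := diracSum_closedBall_compl p.roots
  exact ⟨R, by rw [rootMeasure, Measure.smul_apply, hR, smul_zero]⟩

theorem integral_rootMeasure (n : ℕ) (p : Polynomial ℂ) (f : ℂ → ℝ) :
    ∫ y, f y ∂(rootMeasure n p) = (n : ℝ)⁻¹ * (p.roots.map f).sum := by
  rw [rootMeasure, integral_smul_measure, (integral_diracSum _ f).2]
  simp

theorem integral_zeroMeasure (p : Polynomial ℂ) (f : ℂ → ℝ) :
    ∫ y, f y ∂(zeroMeasure p) = (p.natDegree : ℝ)⁻¹ * (p.roots.map f).sum :=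
  integral_rootMeasure p.natDegree p f

theorem card_roots_eq (p : Polynomial ℂ) : p.roots.card = p.natDegree :=
  IsAlgClosed.card_roots_eq_natDegree

theorem rootMeasure_real_univ (n : ℕ) (p : Polynomial ℂ) :
    (rootMeasure n p).real univ = p.natDegree / n := by
  rw [measureReal_def, rootMeasure, Measure.smul_apply, diracSum_apply_univ, card_roots_eq]
  simp [inv_mul_eq_div]

theorem log_norm_eval (hp : p ≠ 0) {w : ℂ} (hw : p.eval w ≠ 0) :
    Real.log ‖p.eval w‖
      = Real.log ‖p.leadingCoeff‖ + (p.roots.map fun y => Real.log ‖w - y‖).sum := by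
  have h1 := (IsAlgClosed.splits p).eval_eq_prod_roots w
  have h2 : w ∉ p.roots := fun h => hw ((Polynomial.mem_roots'.1 h).2)
  have h3 : (p.roots.map fun y => w - y).prod ≠ 0 := by
    intro h
    rw [h, mul_zero] at h1
    exact hw h1
  rw [h1, norm_mul, Real.log_mul (norm_ne_zero_iff.2 (Polynomial.leadingCoeff_ne_zero.2 hp))
    (norm_ne_zero_iff.2 h3), log_norm_prod_sub _ h2]

/-- Averaging `log |p|` over a circle turns each root into a truncated logarithm, by Jensen's
formula. -/
theorem cutoffPotential_rootMeasure_le (hn : n ≠ 0) (hp : p ≠ 0) {S : ℂ → ℝ} (hS : Continuous S)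
    (h : ∀ w, ‖p.eval w‖ ≤ Real.exp (n * S w)) {r : ℝ} (hr : 0 < r) (z : ℂ) :
    cutoffPotential (rootMeasure n p) r z + (n : ℝ)⁻¹ * Real.log ‖p.leadingCoeff‖
      ≤ Real.circleAverage S z r := by
  have hn' : (0 : ℝ) < n := by exact_mod_cast Nat.pos_of_ne_zero hn
  obtain ⟨h1, h2⟩ := circleAverage_sum_log_norm_sub p.roots hr z
  have hconst : CircleIntegrable (fun _ : ℂ => Real.log ‖p.leadingCoeff‖) z r :=
    circleIntegrable_const _ _ _
  have h3 : Real.circleAverage (fun w => Real.log ‖p.leadingCoeff‖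
      + (p.roots.map fun y => Real.log ‖w - y‖).sum) z r
      ≤ Real.circleAverage (fun w => (n : ℝ) • S w) z r := by
    refine circleAverage_le_of_countable hr (hconst.add h1)
      ((hS.const_smul (n : ℝ)).continuousOn.circleIntegrable hr.le)
      (p.rootSet_finite ℂ).countable fun w _ hw => ?_
    have hw' : p.eval w ≠ 0 := fun h0 => hw ((Polynomial.mem_rootSet.2 ⟨hp, by simpa using h0⟩))
    rw [← log_norm_eval hp hw', smul_eq_mul, ← Real.log_exp (n * S w)]
    exact Real.log_le_log (norm_pos_iff.2 hw') (h w)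
  rw [Real.circleAverage_fun_add hconst h1, h2, Real.circleAverage_const,
    Real.circleAverage_fun_smul, smul_eq_mul] at h3
  rw [cutoffPotential, integral_rootMeasure, ← mul_add, inv_mul_le_iff₀ hn']
  linarith

theorem le_cutoffPotential_rootMeasure (hn : n ≠ 0) (hp : p ≠ 0) {z : ℂ} {x : ℝ}
    (h : Real.exp (n * x) ≤ ‖p.eval z‖) {r : ℝ} :
    x ≤ cutoffPotential (rootMeasure n p) r z + (n : ℝ)⁻¹ * Real.log ‖p.leadingCoeff‖ := by
  have hn' : (0 : ℝ) < n := by exact_mod_cast Nat.pos_of_ne_zero hn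
  have hz : p.eval z ≠ 0 := norm_pos_iff.1 ((Real.exp_pos _).trans_le h)
  have h1 := Real.log_le_log (Real.exp_pos _) h
  rw [Real.log_exp, log_norm_eval hp hz] at h1
  rw [cutoffPotential, integral_rootMeasure, ← mul_add, ← div_eq_inv_mul, le_div_iff₀ hn', mul_comm]
  refine h1.trans ?_
  rw [add_comm]
  refine add_le_add_left (Multiset.sum_map_le_sum_map _ _ fun y hy => ?_) _
  refine log_norm_le_logCutoff (sub_ne_zero.2 ?_)
  rintro rfl
  exact hz (Polynomial.mem_roots'.1 hy).2

end RootMeasure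

/-- The polynomial `p` of degree at most `n` grows like `exp (n (S + o(1)))`, where `S` is the
logarithmic potential of `ν` up to a constant: from above everywhere, from below on `Z`. -/
structure GrowthClose (ν : Measure ℂ) (c ε : ℝ) (Z : Set ℂ) (n : ℕ) (p : Polynomial ℂ) : Prop where
  natDegree_le : p.natDegree ≤ n
  le_exp : ∀ z, ‖p.eval z‖ ≤ Real.exp (n * (logPotential ν z + c + ε))
  exp_le : ∀ z ∈ Z, Real.exp (n * (logPotential ν z + c - ε)) ≤ ‖p.eval z‖

theorem GrowthClose.mono {ν : Measure ℂ} {c ε ε' : ℝ} {Z Z' : Set ℂ} {n : ℕ} {p : Polynomial ℂ}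
    (h : GrowthClose ν c ε Z n p) (hε : ε ≤ ε') (hZ : Z' ⊆ Z) : GrowthClose ν c ε' Z' n p where
  natDegree_le := h.natDegree_le
  le_exp z := (h.le_exp z).trans (Real.exp_le_exp.2 (by gcongr))
  exp_le z hz := (Real.exp_le_exp.2 (by gcongr)).trans (h.exp_le z (hZ hz))

theorem exists_finite_net {A : Set ℂ} (hA : Dense A) {K : Set ℂ} (hK : IsCompact K) {δ : ℝ}
    (hδ : 0 < δ) : ∃ Z : Set ℂ, Z ⊆ A ∧ Z.Finite ∧ ∀ z ∈ K, ∃ y ∈ Z, ‖z - y‖ ≤ δ := by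
  obtain ⟨Z, hZA, hZ, hcov⟩ := hK.elim_finite_subcover_image (b := A)
    (c := fun a => Metric.ball a δ) (fun a _ => Metric.isOpen_ball) fun z _ => by
      obtain ⟨a, ha, had⟩ := Metric.dense_iff.1 hA z δ hδ
      rw [mem_iUnion₂]
      exact ⟨a, had, by rw [Metric.mem_ball, dist_comm]; exact ha⟩
  refine ⟨Z, hZA, hZ, fun z hz => ?_⟩
  obtain ⟨y, hy, hzy⟩ := mem_iUnion₂.1 (hcov hz)
  exact ⟨y, hy, by rw [← dist_eq_norm]; exact (Metric.mem_ball.1 hzy).le⟩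

/-! ### From growth bounds to the location of zeros -/

section Zeros

variable {ν : Measure ℂ} {C R : ℝ}

/-- The potential lies below its truncation at scale `ε r`, whose average over the circle exceeds
the truncation at scale `r` by at most `ε`. -/
theorem IsBoundedDensity.circleAverage_logPotential_le (h : IsBoundedDensity ν C R) {r : ℝ}
    (hr : 0 < r) (z : ℂ) : Real.circleAverage (logPotential ν) z r ≤ cutoffPotential ν r z := by
  have := h.prob
  refine le_of_forall_pos_le_add fun ε hε => ?_
  have h1 : Real.circleAverage (logPotential ν) z r
      ≤ Real.circleAverage (cutoffPotential ν (ε * r)) z r := by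
    refine Real.circleAverage_mono
      (h.contDiff_logPotential.continuous.continuousOn.circleIntegrable hr.le)
      ((continuous_cutoffPotential h.support (by positivity)).continuousOn.circleIntegrable hr.le)
      fun w _ => (h.integral_log_max_mem (by positivity) w).1
  refine h1.trans ((circleAverage_cutoffPotential_le h.support (by positivity) hr z).trans ?_)
  simp [hr.ne']

/-- The upper bound follows from Jensen's formula. For the lower bound, finitely many points are
enough: potentials truncated at `δ` are Lipschitz with constant `1 / δ`, so a net carries the bound
to a whole disc, and averaging over circles replaces the scale `δ` by `s`. -/
theorem IsBoundedDensity.exists_cutoffPotential_close (h : IsBoundedDensity ν C R) (c : ℝ)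
    {A : Set ℂ} (hA : Dense A) {r : ℝ} (hr : 0 < r) (ρ : ℝ) {τ : ℝ} (hτ : 0 < τ) :
    ∃ ε : ℝ, 0 < ε ∧ ∃ Z ⊆ A, Z.Finite ∧ ∀ (n : ℕ) (p : Polynomial ℂ), n ≠ 0 →
      GrowthClose ν c ε Z n p → ∃ a : ℝ, ∀ z ∈ Metric.closedBall (0 : ℂ) ρ,
        ∀ s ∈ Icc r (Real.exp 1 * r),
          |cutoffPotential (rootMeasure n p) s z + a - cutoffPotential ν s z| ≤ τ := by
  have := h.prob
  set K := 2 * Real.pi * C + 1 with hK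
  have hK0 : 0 < K := by have := h.nonneg; positivity
  -- The errors are `K δ` from truncating the potential of `ν`, twice `δ` from the net, and `δ / r`
  -- from the circle average.
  set δ := τ / 2 / (K + 2 + 1 / r) with hδdef
  have hδ : 0 < δ := by positivity
  have hδτ : (K + 2 + 1 / r) * δ = τ / 2 := by rw [hδdef]; field_simp
  -- The larger disc contains all circles of radius at most `e r` centred in the given one. The
  -- maximum keeps it nonempty for negative `ρ`.
  set ρ' := max 0 ρ + Real.exp 1 * r with hρ'
  -- The mesh `δ²` costs only `δ` for functions with Lipschitz constant `1 / δ`.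
  obtain ⟨Z, hZA, hZ, hnet⟩ := exists_finite_net hA (isCompact_closedBall (0 : ℂ) ρ')
    (δ := δ ^ 2) (by positivity)
  refine ⟨τ / 2, half_pos hτ, Z, hZA, hZ, fun n p hn hp => ?_⟩
  have hp0 : p ≠ 0 := by
    rintro rfl
    obtain ⟨y, hy, -⟩ := hnet 0 (by simp; positivity)
    have := hp.exp_le y hy
    simp only [Polynomial.eval_zero, norm_zero] at this
    exact (Real.exp_pos _).not_ge this
  have hfin := isFiniteMeasure_rootMeasure (p := p) hn
  obtain ⟨R', hR'⟩ := rootMeasure_closedBall_compl n p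
  have hmass : (rootMeasure n p).real univ ≤ 1 := by
    rw [rootMeasure_real_univ]
    exact div_le_one_of_le₀ (by exact_mod_cast hp.natDegree_le) (Nat.cast_nonneg _)
  have hmassν : ν.real univ = 1 := by simp
  set a := (n : ℝ)⁻¹ * Real.log ‖p.leadingCoeff‖ - c with ha
  have hScont : Continuous fun w => logPotential ν w + c + τ / 2 := by
    have := h.contDiff_logPotential.continuous
    fun_prop
  have hupper : ∀ z, ∀ s, 0 < s →
      cutoffPotential (rootMeasure n p) s z + a ≤ cutoffPotential ν s z + τ / 2 := by
    intro z s hs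
    have h1 := cutoffPotential_rootMeasure_le hn hp0 hScont hp.le_exp hs z
    have hi : CircleIntegrable (logPotential ν) z s :=
      h.contDiff_logPotential.continuous.continuousOn.circleIntegrable hs.le
    have h2 : Real.circleAverage (fun w => logPotential ν w + c + τ / 2) z s
        = Real.circleAverage (logPotential ν) z s + (c + τ / 2) := by
      simp_rw [add_assoc]
      rw [Real.circleAverage_fun_add hi (circleIntegrable_const _ _ _), Real.circleAverage_const]
    have h3 := h.circleAverage_logPotential_le hs z
    rw [h2] at h1
    rw [ha]
    linarith
  have hlower : ∀ w ∈ Metric.closedBall (0 : ℂ) ρ',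
      cutoffPotential ν δ w - (τ / 2 + (K + 2) * δ)
        ≤ cutoffPotential (rootMeasure n p) δ w + a := by
    intro w hw
    obtain ⟨y, hy, hwy⟩ := hnet w hw
    have h1 := le_cutoffPotential_rootMeasure hn hp0 (hp.exp_le y hy) (r := δ)
    have h2 := (h.integral_log_max_mem hδ y).2
    have h3 := cutoffPotential_le_add h.support hδ w y
    have h4 := cutoffPotential_le_add hR' hδ y w
    have h5 : ‖w - y‖ / δ ≤ δ := by
      rw [div_le_iff₀ hδ, ← sq]
      exact hwy
    have h5' : ‖y - w‖ / δ ≤ δ := by rwa [norm_sub_rev]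
    have h6 : ‖y - w‖ / δ * (rootMeasure n p).real univ ≤ δ :=
      (mul_le_of_le_one_right (by positivity) hmass).trans h5'
    rw [hmassν, mul_one] at h3
    change cutoffPotential ν δ y ≤ _ at h2
    rw [ha]
    linarith
  refine ⟨a, fun z hz s hs => ?_⟩
  have hs0 : 0 < s := hr.trans_le hs.1
  have hc1 := continuous_cutoffPotential hR' hδ
  have hc2 := continuous_cutoffPotential h.support hδ
  have h1 := cutoffPotential_le_circleAverage h.support hδ hs0 z
  have h2 := circleAverage_cutoffPotential_le hR' hδ hs0 z
  have h3 : Real.circleAverage (fun w => cutoffPotential ν δ w + -(τ / 2 + (K + 2) * δ)) z s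
      ≤ Real.circleAverage (fun w => cutoffPotential (rootMeasure n p) δ w + a) z s := by
    refine Real.circleAverage_mono ((hc2.add continuous_const).continuousOn.circleIntegrable hs0.le)
      ((hc1.add continuous_const).continuousOn.circleIntegrable hs0.le) fun w hw => ?_
    rw [← sub_eq_add_neg]
    refine hlower w ?_
    rw [abs_of_pos hs0] at hw
    have hw1 : ‖w - z‖ = s := by rw [← dist_eq_norm]; exact hw
    rw [Metric.mem_closedBall, dist_zero_right] at hz ⊢
    calc ‖w‖ ≤ ‖z‖ + ‖w - z‖ := by simpa using norm_add_le z (w - z)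
      _ ≤ max 0 ρ + Real.exp 1 * r := by
        rw [hw1]
        exact add_le_add (hz.trans (le_max_right _ _)) hs.2
  rw [Real.circleAverage_fun_add (hc2.continuousOn.circleIntegrable hs0.le)
    (circleIntegrable_const _ _ _), Real.circleAverage_fun_add
    (hc1.continuousOn.circleIntegrable hs0.le) (circleIntegrable_const _ _ _),
    Real.circleAverage_const, Real.circleAverage_const] at h3
  have h4 : δ / s * (rootMeasure n p).real univ ≤ 1 / r * δ := by
    refine (mul_le_of_le_one_right (by positivity) hmass).trans ?_
    rw [div_eq_mul_one_div, mul_comm]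
    gcongr
    exact hs.1
  rw [abs_le]
  constructor
  · linarith
  · linarith [hupper z s hs0]

theorem IsBoundedDensity.exists_integral_close_of_hasCompactSupport (h : IsBoundedDensity ν C R)
    (c : ℝ) {A : Set ℂ} (hA : Dense A) {f : ℂ → ℝ} (hf : Continuous f) (hfc : HasCompactSupport f)
    {η : ℝ} (hη : 0 < η) :
    ∃ ε : ℝ, 0 < ε ∧ ∃ Z ⊆ A, Z.Finite ∧ ∀ (n : ℕ) (p : Polynomial ℂ), n ≠ 0 →
      GrowthClose ν c ε Z n p → |(∫ y, f y ∂(rootMeasure n p)) - ∫ y, f y ∂ν| ≤ η := by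
  have := h.prob
  obtain ⟨r₀, hr₀, huc⟩ := Metric.uniformContinuous_iff.1 (hfc.uniformContinuous_of_continuous hf)
    (η / 4) (by positivity)
  -- The support of the bump, of radius `e r`, must fit into the modulus of continuity `r₀`.
  set r := r₀ / (2 * Real.exp 1) with hr
  have hr0 : 0 < r := by positivity
  have her : Real.exp 1 * r < r₀ := by
    rw [hr, mul_div_assoc', div_lt_iff₀ (by positivity)]
    nlinarith [mul_pos hr₀ (Real.exp_pos 1)]
  have hκ : ∀ z y, ‖z - y‖ ≤ Real.exp 1 * r → |f z - f y| ≤ η / 4 := fun z y hzy => by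
    rw [← Real.dist_eq]
    exact (huc (by rw [dist_eq_norm]; exact hzy.trans_lt her)).le
  have hb := integral_logBump_pos hr0
  set b := ∫ v, logBump r v with hbdef
  set I := ∫ z, |f z| with hI
  have hI0 : 0 ≤ I := integral_nonneg fun z => abs_nonneg _
  set τ := η * b / (4 * (I + 1)) with hτdef
  have hτ : 0 < τ := by positivity
  obtain ⟨ρ, hρ⟩ := hfc.isCompact.isBounded.subset_closedBall 0
  obtain ⟨ε, hε, Z, hZA, hZ, H⟩ := h.exists_cutoffPotential_close c hA hr0 ρ hτ
  refine ⟨ε, hε, Z, hZA, hZ, fun n p hn hp => ?_⟩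
  obtain ⟨a, ha⟩ := H n p hn hp
  have hfin := isFiniteMeasure_rootMeasure (p := p) hn
  obtain ⟨R', hR'⟩ := rootMeasure_closedBall_compl n p
  have hmass : (rootMeasure n p).real univ ≤ 1 := by
    rw [rootMeasure_real_univ]
    exact div_le_one_of_le₀ (by exact_mod_cast hp.natDegree_le) (Nat.cast_nonneg _)
  refine (abs_integral_sub_le_of_cutoffPotential hR' h.support hr0 hf hfc hκ hmass (by simp)
    (a := a) (τ := τ) fun z hz => ha z (hρ hz)).trans ?_
  have h1 : 2 * τ * I / b ≤ η / 2 := by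
    rw [div_le_iff₀ hb, hτdef]
    have : 2 * (η * b / (4 * (I + 1))) * I = η / 2 * b * (I / (I + 1)) := by field_simp; ring
    rw [this]
    exact mul_le_of_le_one_right (by positivity) (div_le_one_of_le₀ (by linarith) (by positivity))
  linarith

/-- Convergence of zeros: if `(1 / n) log |p|` is close to the logarithmic potential of `ν` up to a
constant, then the empirical distribution of the zeros of `p` is close to `ν`. -/
theorem IsBoundedDensity.exists_zeroMeasure_close (h : IsBoundedDensity ν C R) (c : ℝ)
    {A : Set ℂ} (hA : Dense A) (f : BoundedContinuousFunction ℂ ℝ) {η : ℝ} (hη : 0 < η) :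
    ∃ ε : ℝ, 0 < ε ∧ ∃ Z ⊆ A, Z.Finite ∧ ∀ (n : ℕ) (p : Polynomial ℂ), n ≠ 0 →
      GrowthClose ν c ε Z n p → |(∫ y, f y ∂(zeroMeasure p)) - ∫ y, f y ∂ν| ≤ η := by
  have := h.prob
  -- Testing with `χ`, equal to `1` on the support of `ν`, shows that almost all of the mass stays
  -- in a compact set and that the degree is nearly `n`.
  set χ : ℂ → ℝ := fun z => max 0 (min 1 (R + 1 - ‖z‖)) with hχ
  have hχc : Continuous χ := by fun_prop
  have hχ0 : ∀ z, 0 ≤ χ z := fun z => le_max_left _ _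
  have hχ1 : ∀ z, χ z ≤ 1 := fun z => max_le zero_le_one (min_le_left _ _)
  have hχs : HasCompactSupport χ := by
    refine HasCompactSupport.of_support_subset_isCompact (isCompact_closedBall (0 : ℂ) (R + 1))
      fun z hz => ?_
    rw [Metric.mem_closedBall, dist_zero_right]
    by_contra hlt
    refine hz (max_eq_left ((min_le_right _ _).trans ?_))
    linarith [not_le.1 hlt]
  have hχν : ∀ᵐ y ∂ν, χ y = 1 := by
    filter_upwards [h.ae_norm_le] with y hy
    simp only [hχ]
    rw [min_eq_left (by linarith), max_eq_right zero_le_one]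
  have hI1 : ∫ y, χ y ∂ν = 1 := by
    rw [integral_congr_ae hχν]
    simp
  have hIf : ∫ y, f y * χ y ∂ν = ∫ y, f y ∂ν := by
    refine integral_congr_ae ?_
    filter_upwards [hχν] with y hy
    rw [hy, mul_one]
  set M := ‖f‖ with hM
  have hM0 : 0 ≤ M := norm_nonneg f
  set η' := min (1 / 2) (η / (2 * M + 1)) with hη'
  have hη'0 : 0 < η' := lt_min (by norm_num) (by positivity)
  have hη'1 : η' * (2 * M + 1) ≤ η := by
    rw [← le_div_iff₀ (by positivity)]
    exact min_le_right _ _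
  obtain ⟨ε₁, hε₁, Z₁, hZ₁A, hZ₁, H₁⟩ :=
    h.exists_integral_close_of_hasCompactSupport c hA hχc hχs hη'0
  obtain ⟨ε₂, hε₂, Z₂, hZ₂A, hZ₂, H₂⟩ :=
    h.exists_integral_close_of_hasCompactSupport c hA (f.continuous.mul hχc) hχs.mul_left hη'0
  refine ⟨min ε₁ ε₂, lt_min hε₁ hε₂, Z₁ ∪ Z₂, union_subset hZ₁A hZ₂A, hZ₁.union hZ₂,
    fun n p hn hp => ?_⟩
  have d1 := H₁ n p hn (hp.mono (min_le_left _ _) subset_union_left)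
  have d2 := H₂ n p hn (hp.mono (min_le_right _ _) subset_union_right)
  rw [hI1] at d1
  simp only [Pi.mul_apply] at d2
  rw [hIf] at d2
  have hn' : (0 : ℝ) < n := by exact_mod_cast Nat.pos_of_ne_zero hn
  have hfin := isFiniteMeasure_rootMeasure (p := p) hn
  obtain ⟨R', hR'⟩ := rootMeasure_closedBall_compl n p
  set μ := rootMeasure n p with hμ
  set m := μ.real univ with hm
  have hmd : m = p.natDegree / n := rootMeasure_real_univ n p
  have hm1 : m ≤ 1 := by
    rw [hmd]
    exact div_le_one_of_le₀ (by exact_mod_cast hp.natDegree_le) (Nat.cast_nonneg _)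
  have hχi := integrable_of_compactSupport hR' hχc
  have hfi := integrable_of_compactSupport hR' f.continuous
  have hfχi : Integrable (fun y => f y * χ y) μ := integrable_of_compactSupport hR' (f.continuous.mul hχc)
  have hχm : ∫ y, χ y ∂μ ≤ m := by
    have := integral_mono hχi (integrable_const (1 : ℝ)) hχ1
    simpa [integral_const] using this
  have hmlow : 1 - η' ≤ m := by linarith [(abs_le.1 d1).1]
  have hmpos : 0 < m := by
    have : η' ≤ 1 / 2 := min_le_left _ _
    linarith
  -- `zeroMeasure` normalises by the degree and `rootMeasure` by `n`; their ratio `m` is close to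
  -- `1`.
  have hscale : ∫ y, f y ∂(zeroMeasure p) = m⁻¹ * ∫ y, f y ∂μ := by
    rw [integral_zeroMeasure, hμ, integral_rootMeasure, hmd, inv_div, ← mul_assoc]
    congr 1
    field_simp
  have hfM : |∫ y, f y ∂μ| ≤ M * m := by
    rw [← Real.norm_eq_abs]
    exact norm_integral_le_of_norm_le_const (Eventually.of_forall fun y => f.norm_coe_le_norm y)
  have e1 : |m⁻¹ * (∫ y, f y ∂μ) - ∫ y, f y ∂μ| ≤ M * η' := by
    have : m⁻¹ * (∫ y, f y ∂μ) - ∫ y, f y ∂μ = (m⁻¹ * (1 - m)) * ∫ y, f y ∂μ := by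
      field_simp
    rw [this, abs_mul, abs_of_nonneg (mul_nonneg (inv_nonneg.2 hmpos.le) (sub_nonneg.2 hm1))]
    calc m⁻¹ * (1 - m) * |∫ y, f y ∂μ| ≤ m⁻¹ * (1 - m) * (M * m) := by
          refine mul_le_mul_of_nonneg_left hfM ?_
          exact mul_nonneg (inv_nonneg.2 hmpos.le) (sub_nonneg.2 hm1)
      _ = M * (1 - m) := by field_simp
      _ ≤ M * η' := by gcongr; linarith
  have e2 : |(∫ y, f y ∂μ) - ∫ y, f y * χ y ∂μ| ≤ M * η' := by
    rw [← integral_sub hfi hfχi]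
    have h1 : ∫ y, M * (1 - χ y) ∂μ = M * (m - ∫ y, χ y ∂μ) := by
      rw [integral_const_mul, integral_sub (integrable_const _) hχi]
      simp [hm]
    have h2 : |∫ y, (f y - f y * χ y) ∂μ| ≤ ∫ y, M * (1 - χ y) ∂μ := by
      refine abs_integral_le_integral_abs.trans (integral_mono (g := fun y => M * (1 - χ y)) (hfi.sub hfχi).abs
        (((integrable_const _).sub hχi).const_mul _) fun y => ?_)
      have h3 : |f y| ≤ M := f.norm_coe_le_norm y
      have h4 : 0 ≤ 1 - χ y := sub_nonneg.2 (hχ1 y)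
      simp only
      rw [← mul_one_sub, abs_mul, abs_of_nonneg h4]
      exact mul_le_mul_of_nonneg_right h3 h4
    rw [h1] at h2
    refine h2.trans ?_
    gcongr
    linarith [(abs_le.1 d1).1]
  rw [hscale]
  have d2' := abs_le.1 d2
  have e1' := abs_le.1 e1
  have e2' := abs_le.1 e2
  rw [abs_le]
  constructor <;> linarith [d2'.1, d2'.2, e1'.1, e1'.2, e2'.1, e2'.2]

end Zeros

/-! ### Anti-concentration of sums of independent variables -/

section AntiConcentration

variable {Ω : Type*} [MeasurableSpace Ω] {P : Measure Ω} {ξ : ℕ → Ω → ℂ}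

/-- The part over `s` of a random sum with coefficients `c`. -/
noncomputable def partialSum (ξ : ℕ → Ω → ℂ) (c : ℕ → ℂ) (s : Finset ℕ) (ω : Ω) : ℂ :=
  ∑ k ∈ s, c k * ξ k ω

theorem measurable_partialSum (h : RandomCoeffs P ξ) (c : ℕ → ℂ) (s : Finset ℕ) :
    Measurable (partialSum ξ c s) :=
  Finset.measurable_fun_sum s fun k _ => (h.measurable k).const_mul (c k)

theorem indepFun_partialSum (h : RandomCoeffs P ξ) (c : ℕ → ℂ) {s : Finset ℕ} {k : ℕ}
    (hk : k ∉ s) : IndepFun (fun ω => c k * ξ k ω) (partialSum ξ c s) P := by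
  have h1 : iIndepFun (fun k ω => c k * ξ k ω) P :=
    h.indep.comp (fun k x => c k * x) fun k => measurable_const_mul (c k)
  have h2 := h1.indepFun_finsetSum_of_notMem (fun k => (h.measurable k).const_mul (c k)) hk
  have e : (∑ j ∈ s, fun ω => c j * ξ j ω) = partialSum ξ c s := by
    funext ω
    simp [partialSum]
  rw [e] at h2
  exact h2.symm

variable [IsProbabilityMeasure P]

/-- Conditionally on `U`, the variable `V` has to hit a ball of radius `r` about `y - U`. The set
`E` retains an additional restriction on `U`, which supplies the extra factor. -/
theorem measure_inter_norm_add_sub_le {U V : Ω → ℂ} (hU : Measurable U) (hV : Measurable V)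
    (hUV : IndepFun U V P) {r : ℝ} {Q : ℝ≥0∞} (hQ : ∀ y, P {ω | ‖V ω - y‖ ≤ r} ≤ Q)
    {E : Set ℂ} (hE : MeasurableSet E) (y : ℂ) :
    P {ω | U ω ∈ E ∧ ‖U ω + V ω - y‖ ≤ r} ≤ P {ω | U ω ∈ E} * Q := by
  have hpair := (indepFun_iff_map_prod_eq_prod_map_map hU.aemeasurable hV.aemeasurable).1 hUV
  have : IsProbabilityMeasure (P.map V) := Measure.isProbabilityMeasure_map hV.aemeasurable
  have hS : MeasurableSet {q : ℂ × ℂ | q.1 ∈ E ∧ ‖q.1 + q.2 - y‖ ≤ r} :=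
    (measurable_fst hE).inter
      (measurableSet_le (f := fun q : ℂ × ℂ => ‖q.1 + q.2 - y‖) (by fun_prop) measurable_const)
  have h1 : P {ω | U ω ∈ E ∧ ‖U ω + V ω - y‖ ≤ r}
      = ((P.map U).prod (P.map V)) {q : ℂ × ℂ | q.1 ∈ E ∧ ‖q.1 + q.2 - y‖ ≤ r} := by
    rw [← hpair, Measure.map_apply (hU.prodMk hV) hS]
    rfl
  have h2 : P {ω | U ω ∈ E} = (P.map U) E := by
    rw [Measure.map_apply hU hE]
    rfl
  rw [h1, Measure.prod_apply hS, h2, mul_comm, ← setLIntegral_const, ← lintegral_indicator hE]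
  refine lintegral_mono fun u => ?_
  by_cases hu : u ∈ E
  · rw [indicator_of_mem hu, Measure.map_apply hV (measurable_prodMk_left hS)]
    refine le_trans (measure_mono fun ω hω => ?_) (hQ (y - u))
    have : ‖u + V ω - y‖ ≤ r := hω.2
    rw [mem_ofPred_eq, show V ω - (y - u) = u + V ω - y by ring]
    exact this
  · rw [indicator_of_notMem hu, nonpos_iff_eq_zero]
    refine measure_mono_null (t := ∅) (fun v hv => hu hv.1) measure_empty

theorem measure_partialSum_insert_le (h : RandomCoeffs P ξ) (c : ℕ → ℂ) {s : Finset ℕ} {k : ℕ}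
    (hk : k ∉ s) {r : ℝ} {Q : ℝ≥0∞} (hQ : ∀ y, P {ω | ‖partialSum ξ c s ω - y‖ ≤ r} ≤ Q)
    {E : Set ℂ} (hE : MeasurableSet E) (y : ℂ) :
    P {ω | c k * ξ k ω ∈ E ∧ ‖partialSum ξ c (insert k s) ω - y‖ ≤ r}
      ≤ P {ω | c k * ξ k ω ∈ E} * Q := by
  have := measure_inter_norm_add_sub_le ((h.measurable k).const_mul (c k))
    (measurable_partialSum h c s) (indepFun_partialSum h c hk) hQ hE y
  simp only [partialSum, Finset.sum_insert hk]
  exact this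

/-- Adding independent summands cannot increase concentration. -/
theorem measure_partialSum_mono (h : RandomCoeffs P ξ) (c : ℕ → ℂ) {s s' : Finset ℕ}
    (hs : s ⊆ s') {r : ℝ} {Q : ℝ≥0∞} (hQ : ∀ y, P {ω | ‖partialSum ξ c s ω - y‖ ≤ r} ≤ Q)
    (y : ℂ) : P {ω | ‖partialSum ξ c s' ω - y‖ ≤ r} ≤ Q := by
  suffices H : ∀ u : Finset ℕ, Disjoint s u →
      ∀ y, P {ω | ‖partialSum ξ c (u ∪ s) ω - y‖ ≤ r} ≤ Q by
    have := H (s' \ s) Finset.disjoint_sdiff y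
    rwa [Finset.sdiff_union_of_subset hs] at this
  intro u
  induction u using Finset.induction_on with
  | empty => simpa using hQ
  | insert k u hk ih =>
    intro hd y
    rw [Finset.disjoint_insert_right] at hd
    have h1 := measure_partialSum_insert_le h c (k := k) (s := u ∪ s)
      (by simp [hk, hd.1]) (ih hd.2) MeasurableSet.univ y
    simpa [Finset.insert_union] using h1

/-- The law has two support points at distance `4 ρ`. Every ball of radius `ρ` misses the `ρ`-ball
about one of them, and thus a fixed amount `m` of mass. -/
theorem RandomCoeffs.exists_concentration_bound (h : RandomCoeffs P ξ) :
    ∃ (q : ℝ≥0∞) (ρ : ℝ), q < 1 ∧ 0 < ρ ∧ ∀ k y, P {ω | ‖ξ k ω - y‖ ≤ ρ} ≤ q := by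
  set μ := P.map (ξ 0) with hμ
  have : IsProbabilityMeasure μ := Measure.isProbabilityMeasure_map (h.measurable 0).aemeasurable
  obtain ⟨x, hx⟩ := Measure.nonempty_support (IsProbabilityMeasure.ne_zero μ)
  have hex : ∃ x' ∈ μ.support, x' ≠ x := by
    by_contra! hall
    refine h.nondegenerate ⟨x, ?_⟩
    have h1 : ∀ᵐ y ∂μ, y = x := by
      filter_upwards [Measure.support_mem_ae (μ := μ)] with y hy using hall y hy
    exact ae_of_ae_map (h.measurable 0).aemeasurable h1
  obtain ⟨x', hx', hne⟩ := hex
  set ρ := dist x' x / 4 with hρ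
  have hρ0 : 0 < ρ := by have := dist_pos.2 hne; positivity
  have p1 := (Measure.mem_support_iff_forall x).1 hx _ (Metric.ball_mem_nhds x hρ0)
  have p2 := (Measure.mem_support_iff_forall x').1 hx' _ (Metric.ball_mem_nhds x' hρ0)
  set m := min (μ (Metric.ball x ρ)) (μ (Metric.ball x' ρ)) with hm
  have hm0 : 0 < m := lt_min p1 p2
  refine ⟨1 - m, ρ, ENNReal.sub_lt_self ENNReal.one_ne_top one_ne_zero hm0.ne', hρ0,
    fun k y => ?_⟩
  have hmeas : MeasurableSet {z : ℂ | ‖z - y‖ ≤ ρ} :=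
    measurableSet_le (by fun_prop) measurable_const
  have e : P {ω | ‖ξ k ω - y‖ ≤ ρ} = μ {z : ℂ | ‖z - y‖ ≤ ρ} := by
    rw [hμ, Measure.map_apply (h.measurable 0) hmeas]
    exact (h.identDistrib k).measure_mem_eq hmeas
  have key : ∃ z, m ≤ μ (Metric.ball z ρ) ∧ Disjoint (Metric.ball z ρ) {z : ℂ | ‖z - y‖ ≤ ρ} := by
    by_cases hd : Disjoint (Metric.ball x ρ) {z : ℂ | ‖z - y‖ ≤ ρ}
    · exact ⟨x, min_le_left _ _, hd⟩
    · refine ⟨x', min_le_right _ _, ?_⟩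
      obtain ⟨u, hu1, hu2⟩ := Set.not_disjoint_iff.1 hd
      refine Set.disjoint_left.2 fun v hv1 hv2 => ?_
      have a1 : dist u x < ρ := hu1
      have a2 : dist u y ≤ ρ := by rw [dist_eq_norm]; exact hu2
      have a3 : dist v x' < ρ := hv1
      have a4 : dist v y ≤ ρ := by rw [dist_eq_norm]; exact hv2
      have a5 : dist x' x ≤ dist x' v + dist v y + dist y u + dist u x :=
        (dist_triangle4 x' v y x).trans (by linarith [dist_triangle y u x])
      rw [dist_comm x' v, dist_comm y u] at a5
      have a6 : dist x' x = 4 * ρ := by rw [hρ]; ring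
      linarith
  obtain ⟨z, hz, hd⟩ := key
  rw [e]
  refine ENNReal.le_sub_of_add_le_right (ne_top_of_le_ne_top (measure_ne_top μ _) hz) ?_
  calc μ {z : ℂ | ‖z - y‖ ≤ ρ} + m ≤ μ {z : ℂ | ‖z - y‖ ≤ ρ} + μ (Metric.ball z ρ) := by gcongr
    _ = μ ({z : ℂ | ‖z - y‖ ≤ ρ} ∪ Metric.ball z ρ) :=
      (measure_union hd.symm Metric.isOpen_ball.measurableSet).symm
    _ ≤ 1 := prob_le_one

/-- All `ξ k` have the law of `ξ 0`, so they are uniformly tight. -/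
theorem RandomCoeffs.tendsto_measure_lt_mul_norm (h : RandomCoeffs P ξ) {b c : ℕ → ℂ}
    (hbc : b =o[atTop] c) (hc : ∀ᶠ n in atTop, c n ≠ 0) (κ : ℕ → ℕ) {ρ : ℝ} (hρ : 0 < ρ) :
    Tendsto (fun n => P {ω | ρ * ‖c n‖ < ‖b n * ξ (κ n) ω‖}) atTop (𝓝 0) := by
  have hM : Tendsto (fun m : ℕ => P {ω | (m : ℝ) < ‖ξ 0 ω‖}) atTop (𝓝 0) := by
    have hanti : Antitone fun m : ℕ => {ω | (m : ℝ) < ‖ξ 0 ω‖} := fun m m' hmm ω hω =>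
      lt_of_le_of_lt (Nat.cast_le.2 hmm : (m : ℝ) ≤ m') hω
    have h1 := tendsto_measure_iInter_atTop (μ := P) (s := fun m : ℕ => {ω | (m : ℝ) < ‖ξ 0 ω‖})
      (fun m => (measurableSet_lt measurable_const (h.measurable 0).norm).nullMeasurableSet) hanti
      ⟨0, measure_ne_top _ _⟩
    have h2 : (⋂ m : ℕ, {ω | (m : ℝ) < ‖ξ 0 ω‖}) = ∅ := by
      refine eq_empty_of_forall_notMem fun ω hω => ?_
      obtain ⟨m, hm⟩ := exists_nat_gt ‖ξ 0 ω‖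
      exact lt_asymm hm (mem_iInter.1 hω m)
    rwa [h2, measure_empty] at h1
  refine ENNReal.tendsto_nhds_zero.2 fun η hη => ?_
  obtain ⟨m, hm⟩ := (ENNReal.tendsto_nhds_zero.1 hM η hη).exists
  filter_upwards [hbc.def (c := ρ / (m + 1)) (by positivity), hc] with n hn hcn
  refine le_trans ?_ hm
  have hmeas : MeasurableSet {z : ℂ | (m : ℝ) < ‖z‖} :=
    measurableSet_lt measurable_const measurable_norm
  refine le_trans (measure_mono fun ω hω => ?_) ((h.identDistrib (κ n)).measure_mem_eq hmeas).le
  have hω' : ρ * ‖c n‖ < ‖b n * ξ (κ n) ω‖ := hω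
  change (m : ℝ) < ‖ξ (κ n) ω‖
  rw [norm_mul] at hω'
  have hc0 : 0 < ‖c n‖ := norm_pos_iff.2 hcn
  by_contra hlt
  rw [not_lt] at hlt
  have : ‖b n‖ * ‖ξ (κ n) ω‖ ≤ ρ / (m + 1) * ‖c n‖ * m := by gcongr
  have h3 : ρ / (m + 1) * ‖c n‖ * m = ρ * ‖c n‖ * (m / (m + 1)) := by field_simp
  have h4 : (m : ℝ) / (m + 1) ≤ 1 := div_le_one_of_le₀ (by linarith) (by positivity)
  have h5 : ρ * ‖c n‖ * (m / (m + 1)) ≤ ρ * ‖c n‖ := mul_le_of_le_one_right (by positivity) h4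
  linarith

/-- The indices `κ 0 n, …, κ (N - 1) n`. -/
def indexSet (κ : ℕ → ℕ → ℕ) (N n : ℕ) : Finset ℕ := (Finset.range N).image fun j => κ j n

theorem indexSet_succ (κ : ℕ → ℕ → ℕ) (N n : ℕ) :
    indexSet κ (N + 1) n = insert (κ N n) (indexSet κ N n) := by
  rw [indexSet, Finset.range_add_one, Finset.image_insert, indexSet]

theorem eventually_notMem_indexSet {b : ℕ → ℕ → ℂ} {κ : ℕ → ℕ → ℕ} (N : ℕ)
    (h0 : ∀ j, ∀ᶠ n in atTop, b n (κ j n) ≠ 0)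
    (hlt : ∀ i j, i < j → (fun n => b n (κ i n)) =o[atTop] fun n => b n (κ j n)) :
    ∀ᶠ n in atTop, κ N n ∉ indexSet κ N n := by
  have h1 : ∀ᶠ n in atTop, ∀ i ∈ Finset.range N, ‖b n (κ i n)‖ ≤ 1 / 2 * ‖b n (κ N n)‖ := by
    refine (Finset.eventually_all _).2 fun i hi => ?_
    exact (hlt i N (Finset.mem_range.1 hi)).def (by norm_num)
  filter_upwards [h1, h0 N] with n hn hn0 hmem
  obtain ⟨i, hi, he⟩ := Finset.mem_image.1 hmem
  have h2 := hn i hi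
  rw [he] at h2
  have := norm_pos_iff.2 hn0
  linarith

theorem RandomCoeffs.tendsto_measure_partialSum (h : RandomCoeffs P ξ) {b : ℕ → ℕ → ℂ}
    {κ : ℕ → ℕ → ℕ} (h0 : ∀ j, ∀ᶠ n in atTop, b n (κ j n) ≠ 0)
    (hlt : ∀ i j, i < j → (fun n => b n (κ i n)) =o[atTop] fun n => b n (κ j n)) {c : ℕ → ℂ}
    (hc : ∀ᶠ n in atTop, c n ≠ 0) (N : ℕ)
    (hbc : ∀ j < N, (fun n => b n (κ j n)) =o[atTop] c) {ρ : ℝ} (hρ : 0 < ρ) :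
    Tendsto (fun n => P {ω | ρ * ‖c n‖ < ‖partialSum ξ (b n) (indexSet κ N n) ω‖}) atTop
      (𝓝 0) := by
  induction N generalizing ρ with
  | zero =>
    refine tendsto_const_nhds.congr fun n => ?_
    have : {ω | ρ * ‖c n‖ < ‖partialSum ξ (b n) (indexSet κ 0 n) ω‖} = ∅ := by
      refine eq_empty_of_forall_notMem fun ω hω => ?_
      have : ρ * ‖c n‖ < ‖(0 : ℂ)‖ := by simpa [partialSum, indexSet] using hω
      rw [norm_zero] at this
      exact absurd this (not_lt.2 (by positivity))
    rw [this, measure_empty]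
  | succ N ih =>
    have t1 := ih (fun j hj => hbc j (by omega)) (half_pos hρ)
    have t2 := h.tendsto_measure_lt_mul_norm (hbc N (by omega)) hc (κ N) (half_pos hρ)
    have t := t1.add t2
    rw [add_zero] at t
    refine tendsto_of_tendsto_of_tendsto_of_le_of_le' tendsto_const_nhds t
      (Eventually.of_forall fun _ => zero_le) ?_
    filter_upwards [eventually_notMem_indexSet N h0 hlt] with n hn
    refine le_trans (measure_mono fun ω hω => ?_) (measure_union_le _ _)
    have hω' : ρ * ‖c n‖ < ‖partialSum ξ (b n) (indexSet κ (N + 1) n) ω‖ := hω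
    rw [indexSet_succ, partialSum, Finset.sum_insert hn] at hω'
    by_contra hcon
    rw [mem_union, not_or] at hcon
    have c1 : ‖partialSum ξ (b n) (indexSet κ N n) ω‖ ≤ ρ / 2 * ‖c n‖ := not_lt.1 hcon.1
    have c2 : ‖b n (κ N n) * ξ (κ N n) ω‖ ≤ ρ / 2 * ‖c n‖ := not_lt.1 hcon.2
    have c3 := hω'.trans_le (norm_add_le _ _)
    rw [partialSum] at c1
    linarith

/-- Induction on the number of terms. If the sum is close to `y` and the earlier terms are
negligible against the new one, the new term alone lies in a ball of radius `ρ |b|`, with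
probability at most `q`. By independence the earlier terms must in addition hit a small ball, with
probability at most `q ^ N` up to an error. -/
theorem RandomCoeffs.eventually_concentration_le (h : RandomCoeffs P ξ) {q : ℝ≥0∞} {ρ : ℝ}
    (hq1 : q ≤ 1) (hρ : 0 < ρ) (hq : ∀ k y, P {ω | ‖ξ k ω - y‖ ≤ ρ} ≤ q) {b : ℕ → ℕ → ℂ}
    {κ : ℕ → ℕ → ℕ} (h0 : ∀ j, ∀ᶠ n in atTop, b n (κ j n) ≠ 0)
    (hlt : ∀ i j, i < j → (fun n => b n (κ i n)) =o[atTop] fun n => b n (κ j n)) {r : ℕ → ℝ}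
    (hr : ∀ j, r =o[atTop] fun n => b n (κ j n)) (N : ℕ) {η : ℝ≥0∞} (hη : 0 < η) :
    ∀ᶠ n in atTop, ∀ y,
      P {ω | ‖partialSum ξ (b n) (indexSet κ N n) ω - y‖ ≤ r n} ≤ q ^ N + η := by
  induction N generalizing η with
  | zero =>
    refine Eventually.of_forall fun n y => ?_
    rw [pow_zero]
    exact prob_le_one.trans le_self_add
  | succ N ih =>
    have hη2 : 0 < η / 2 := ENNReal.half_pos hη.ne'
    have t := h.tendsto_measure_partialSum h0 hlt (h0 N) N (fun j hj => hlt j N hj) (half_pos hρ)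
    filter_upwards [ih hη2, ENNReal.tendsto_nhds_zero.1 t (η / 2) hη2,
      (hr N).def (c := ρ / 2) (by positivity), h0 N, eventually_notMem_indexSet N h0 hlt]
      with n hn htn hrn hb hnot y
    have hE : MeasurableSet {z : ℂ | ‖z - y‖ ≤ ρ * ‖b n (κ N n)‖} :=
      measurableSet_le (by fun_prop) measurable_const
    have h1 := measure_partialSum_insert_le h (b n) hnot hn hE y
    have h2 : P {ω | b n (κ N n) * ξ (κ N n) ω ∈ {z : ℂ | ‖z - y‖ ≤ ρ * ‖b n (κ N n)‖}} ≤ q := by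
      refine le_trans (measure_mono fun ω hω => ?_) (hq (κ N n) (y / b n (κ N n)))
      have hω' : ‖b n (κ N n) * ξ (κ N n) ω - y‖ ≤ ρ * ‖b n (κ N n)‖ := hω
      have hb0 : 0 < ‖b n (κ N n)‖ := norm_pos_iff.2 hb
      have e : b n (κ N n) * ξ (κ N n) ω - y
          = b n (κ N n) * (ξ (κ N n) ω - y / b n (κ N n)) := by
        field_simp
      rw [e, norm_mul, mul_comm ρ] at hω'
      exact le_of_mul_le_mul_left hω' hb0
    rw [← indexSet_succ] at h1
    have hsub : {ω | ‖partialSum ξ (b n) (indexSet κ (N + 1) n) ω - y‖ ≤ r n}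
        ⊆ {ω | b n (κ N n) * ξ (κ N n) ω ∈ {z : ℂ | ‖z - y‖ ≤ ρ * ‖b n (κ N n)‖} ∧
            ‖partialSum ξ (b n) (indexSet κ (N + 1) n) ω - y‖ ≤ r n}
          ∪ {ω | ρ / 2 * ‖b n (κ N n)‖ < ‖partialSum ξ (b n) (indexSet κ N n) ω‖} := by
      intro ω hω
      by_cases hV : ρ / 2 * ‖b n (κ N n)‖ < ‖partialSum ξ (b n) (indexSet κ N n) ω‖
      · exact Or.inr hV
      · refine Or.inl ⟨?_, hω⟩
        have hω' : ‖partialSum ξ (b n) (indexSet κ (N + 1) n) ω - y‖ ≤ r n := hω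
        change ‖b n (κ N n) * ξ (κ N n) ω - y‖ ≤ ρ * ‖b n (κ N n)‖
        rw [indexSet_succ, partialSum, Finset.sum_insert hnot] at hω'
        have e : b n (κ N n) * ξ (κ N n) ω - y
            = (b n (κ N n) * ξ (κ N n) ω + partialSum ξ (b n) (indexSet κ N n) ω - y)
              - partialSum ξ (b n) (indexSet κ N n) ω := by ring
        rw [e]
        refine (norm_sub_le _ _).trans ?_
        have c1 : ‖b n (κ N n) * ξ (κ N n) ω + partialSum ξ (b n) (indexSet κ N n) ω - y‖
            ≤ ρ / 2 * ‖b n (κ N n)‖ := hω'.trans ((le_abs_self _).trans hrn)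
        have c2 := not_lt.1 hV
        linarith
    refine (measure_mono hsub).trans ((measure_union_le _ _).trans ?_)
    calc _ ≤ q * (q ^ N + η / 2) + η / 2 := by
          gcongr
          exact h1.trans (by gcongr)
      _ ≤ q ^ (N + 1) + η / 2 + η / 2 := by
          rw [mul_add, pow_succ' q N]
          gcongr
          exact mul_le_of_le_one_left zero_le hq1
      _ = q ^ (N + 1) + η := by rw [add_assoc, ENNReal.add_halves]

theorem RandomCoeffs.tendsto_measure_norm_partialSum_le (h : RandomCoeffs P ξ) {b : ℕ → ℕ → ℂ}
    {κ : ℕ → ℕ → ℕ} (h0 : ∀ j, ∀ᶠ n in atTop, b n (κ j n) ≠ 0)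
    (hlt : ∀ i j, i < j → (fun n => b n (κ i n)) =o[atTop] fun n => b n (κ j n)) {r : ℕ → ℝ}
    (hr : ∀ j, r =o[atTop] fun n => b n (κ j n)) (hκ : ∀ j, ∀ n, κ j n ≤ n) :
    Tendsto (fun n => P {ω | ‖partialSum ξ (b n) (Finset.range (n + 1)) ω‖ ≤ r n}) atTop
      (𝓝 0) := by
  obtain ⟨q, ρ, hq1, hρ, hq⟩ := h.exists_concentration_bound
  refine ENNReal.tendsto_nhds_zero.2 fun η hη => ?_
  have hη2 : 0 < η / 2 := ENNReal.half_pos hη.ne'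
  obtain ⟨N, hN⟩ := (ENNReal.tendsto_nhds_zero.1
    (ENNReal.tendsto_pow_atTop_nhds_zero_of_lt_one hq1) (η / 2) hη2).exists
  filter_upwards [h.eventually_concentration_le hq1.le hρ hq h0 hlt hr N hη2] with n hn
  have hs : indexSet κ N n ⊆ Finset.range (n + 1) := fun k hk => by
    obtain ⟨j, -, rfl⟩ := Finset.mem_image.1 hk
    exact Finset.mem_range.2 (Nat.lt_succ_of_le (hκ j n))
  have h1 := measure_partialSum_mono h (b n) hs hn 0
  simp only [sub_zero] at h1
  calc _ ≤ q ^ N + η / 2 := h1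
    _ ≤ η / 2 + η / 2 := by gcongr
    _ = η := ENNReal.add_halves η

/-- With high probability, the coefficients are subexponential. -/
theorem RandomCoeffs.tendsto_measure_exists_lt (h : RandomCoeffs P ξ) {ε : ℝ} (hε : 0 < ε) :
    Tendsto (fun n : ℕ => P {ω | ∃ k ≤ n, Real.exp (ε * n) < ‖ξ k ω‖}) atTop (𝓝 0) := by
  set L : Ω → ℝ := fun ω => Real.log (1 + ‖ξ 0 ω‖) with hL
  have hL0 : ∀ ω, 0 ≤ L ω := fun ω => Real.log_nonneg (by linarith [norm_nonneg (ξ 0 ω)])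
  have hLm : Measurable L := ((h.measurable 0).norm.const_add 1).log
  -- The tail expectation `E [L; L > ε n]` tends to `0`. Markov's inequality gains a factor `1 / (ε
  -- n)`, which compensates the union over `n + 1` indices.
  set F : ℕ → Ω → ℝ := fun n => {ω | ε * n < L ω}.indicator L with hF
  have hset : ∀ n : ℕ, MeasurableSet {ω | ε * n < L ω} := fun n =>
    measurableSet_lt measurable_const hLm
  have hlim : Tendsto (fun n => ∫ ω, F n ω ∂P) atTop (𝓝 (∫ _, (0 : ℝ) ∂P)) := by
    refine tendsto_integral_of_dominated_convergence L
      (fun n => (hLm.indicator (hset n)).aestronglyMeasurable) h.logMoment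
      (fun n => Eventually.of_forall fun ω => ?_) (Eventually.of_forall fun ω => ?_)
    · rw [Real.norm_eq_abs, abs_of_nonneg (indicator_nonneg (fun ω _ => hL0 ω) _)]
      exact indicator_le_self' (fun ω _ => hL0 ω) _
    · refine tendsto_const_nhds.congr' ?_
      filter_upwards [(tendsto_natCast_atTop_atTop (R := ℝ)).eventually_ge_atTop (L ω / ε)]
        with n hn
      rw [div_le_iff₀ hε] at hn
      refine (indicator_of_notMem (fun hmem => ?_) _).symm
      have : ε * n < L ω := hmem
      linarith
  rw [integral_zero] at hlim
  have hbound : ∀ᶠ n : ℕ in atTop, P {ω | ∃ k ≤ n, Real.exp (ε * n) < ‖ξ k ω‖}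
      ≤ ENNReal.ofReal (2 / ε * ∫ ω, F n ω ∂P) := by
    filter_upwards [eventually_ge_atTop 1] with n hn
    have hn' : (1 : ℝ) ≤ n := by exact_mod_cast hn
    have h1 : {ω | ∃ k ≤ n, Real.exp (ε * n) < ‖ξ k ω‖}
        ⊆ ⋃ k ∈ Finset.range (n + 1), {ω | Real.exp (ε * n) < ‖ξ k ω‖} := by
      rintro ω ⟨k, hk, hω⟩
      exact mem_iUnion₂.2 ⟨k, Finset.mem_range.2 (by omega), hω⟩
    have hmeas : MeasurableSet {z : ℂ | Real.exp (ε * n) < ‖z‖} :=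
      measurableSet_lt measurable_const measurable_norm
    have h2 : ∀ k, P {ω | Real.exp (ε * n) < ‖ξ k ω‖} ≤ P {ω | ε * n < L ω} := by
      intro k
      refine ((h.identDistrib k).measure_mem_eq hmeas).le.trans (measure_mono fun ω hω => ?_)
      have hω' : Real.exp (ε * n) < ‖ξ 0 ω‖ := hω
      change ε * n < Real.log (1 + ‖ξ 0 ω‖)
      rw [Real.lt_log_iff_exp_lt (by positivity)]
      linarith
    have h3 : P {ω | ε * n < L ω} ≤ ENNReal.ofReal ((ε * n)⁻¹ * ∫ ω, F n ω ∂P) := by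
      have hFi : Integrable (F n) P := h.logMoment.indicator (hset n)
      have h4 : (ε * n) * P.real {ω | ε * n < L ω} ≤ ∫ ω, F n ω ∂P := by
        have : ∫ ω, {ω | ε * n < L ω}.indicator (fun _ => ε * n) ω ∂P
            = (ε * n) * P.real {ω | ε * n < L ω} := by
          rw [integral_indicator_const _ (hset n), smul_eq_mul, mul_comm]
        rw [← this]
        refine integral_mono ((integrable_const _).indicator (hset n)) hFi fun ω => ?_
        simp only [hF]
        by_cases hω : ω ∈ {ω | ε * n < L ω}
        · rw [indicator_of_mem hω, indicator_of_mem hω]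
          exact (show ε * n < L ω from hω).le
        · rw [indicator_of_notMem hω, indicator_of_notMem hω]
      rw [← ofReal_measureReal]
      refine ENNReal.ofReal_le_ofReal ?_
      rw [inv_mul_eq_div, le_div_iff₀ (by positivity)]
      linarith
    calc P {ω | ∃ k ≤ n, Real.exp (ε * n) < ‖ξ k ω‖}
        ≤ ∑ k ∈ Finset.range (n + 1), P {ω | Real.exp (ε * n) < ‖ξ k ω‖} :=
          (measure_mono h1).trans (measure_biUnion_finset_le _ _)
      _ ≤ ∑ _k ∈ Finset.range (n + 1), ENNReal.ofReal ((ε * n)⁻¹ * ∫ ω, F n ω ∂P) :=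
          Finset.sum_le_sum fun k _ => (h2 k).trans h3
      _ = ENNReal.ofReal ((n + 1) * ((ε * n)⁻¹ * ∫ ω, F n ω ∂P)) := by
          rw [Finset.sum_const, Finset.card_range, nsmul_eq_mul,
            ENNReal.ofReal_mul (p := (n : ℝ) + 1) (by positivity), ← Nat.cast_succ,
            ENNReal.ofReal_natCast]
      _ ≤ _ := by
          refine ENNReal.ofReal_le_ofReal ?_
          rw [← mul_assoc]
          have hI : 0 ≤ ∫ ω, F n ω ∂P :=
            integral_nonneg fun ω => indicator_nonneg (fun ω _ => hL0 ω) _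
          refine mul_le_mul_of_nonneg_right ?_ hI
          rw [← div_eq_mul_inv, div_le_div_iff₀ (by positivity) hε]
          nlinarith
  have hlim2 : Tendsto (fun n => ENNReal.ofReal (2 / ε * ∫ ω, F n ω ∂P)) atTop (𝓝 0) := by
    have := ENNReal.tendsto_ofReal (hlim.const_mul (2 / ε))
    rwa [mul_zero, ENNReal.ofReal_zero] at this
  exact tendsto_of_tendsto_of_tendsto_of_le_of_le' tendsto_const_nhds hlim2
    (Eventually.of_forall fun _ => zero_le) hbound

end AntiConcentration

/-! ### Growth of the heat-evolved random polynomials -/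

/-- The exponential growth rate at `z` of the term of degree `α n`. -/
noncomputable def termRate (g : ℝ → ℝ) (t : ℝ) (z : ℂ) (α : ℝ) : ℝ :=
  g α + rate α z (outerRoot (t * α) z)

section Growth

variable {g : ℝ → ℝ} {t L : ℝ} {a : ℕ → ℕ → ℂ}

namespace IsProfile

theorem continuousOn_termRate (hg : IsProfile g) (ht : 0 ≤ t) (z : ℂ) :
    ContinuousOn (termRate g t z) (Icc 0 1) :=
  hg.continuousOn.add ((continuousOn_rate_outerRoot ht z).mono Icc_subset_Ici_self)

theorem termRate_le (hg : IsProfile g) (hL : IsSlopeBound g L) (ht : 0 ≤ t) (htL : t * L < 1)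
    {z : ℂ} (hz : 0 < t ∨ z ≠ 0) {α : ℝ} (hα : α ∈ Icc (0 : ℝ) 1) :
    termRate g t z α ≤ logPotential (nuT g t) z + g 1 := by
  have := hg.le_logPotential_nuT hL ht htL hz hα (outerRoot_spec _ _)
  rw [termRate]
  linarith

/-- Stated so as to include `t = 0`, where the outer root is `z` and the rate is `α log |z|`. -/
theorem exists_isUniqueMaximizer_termRate (hg : IsProfile g) (hL : IsSlopeBound g L) (ht : 0 ≤ t)
    (htL : t * L < 1) {z : ℂ} (hz : 0 < t ∨ z ≠ 0) :
    ∃ m, IsUniqueMaximizer (termRate g t z) m ∧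
      termRate g t z m = logPotential (nuT g t) z + g 1 := by
  obtain ⟨w, rfl⟩ := hg.surjective_transport hL ht htL z
  have hval : termRate g t (transport g t w) (alphaZero g w)
      = logPotential (nuT g t) (transport g t w) + g 1 := by
    rw [hg.logPotential_nuT hL ht htL, termRate,
      (hg.isOuterRoot_self hL ht htL w).rate_eq (outerRoot_spec _ _)]
    ring
  refine ⟨alphaZero g w, ⟨hg.alphaZero_mem w, fun β hβ hne => ?_⟩, hval⟩
  rcases ht.eq_or_lt with rfl | ht
  · have hT : transport g 0 w = w := by simp [transport]
    rw [hT] at hz ⊢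
    have hr : ∀ β, termRate g 0 w β = g β + β * Real.log ‖w‖ := by
      intro β
      have h := outerRoot_spec (0 * β) w
      rw [zero_mul] at h
      rw [termRate, zero_mul, h.eq_of_zero, rate]
      simp
    rw [hr, hr]
    exact (hg.isUniqueMaximizer_alphaZero (hz.resolve_left (lt_irrefl _))).2 β hβ hne
  · have h := (hg.isUniqueMaximizer_fT hL ht htL w).2 β hβ hne
    simp only at h
    rwa [fT_eq ht hβ.1 (outerRoot_spec _ _), fT_eq ht (hg.alphaZero_mem w).1 (outerRoot_spec _ _)]
      at h

/-- There are infinitely many degrees with almost maximal and pairwise different rates. -/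
theorem exists_levels (hg : IsProfile g) (hL : IsSlopeBound g L) (ht : 0 ≤ t)
    (htL : t * L < 1) {z : ℂ} (hz : 0 < t ∨ z ≠ 0) {ε : ℝ} (hε : 0 < ε) :
    ∃ α : ℕ → ℝ, (∀ j, α j ∈ Ioo (0 : ℝ) 1) ∧
      (∀ j, logPotential (nuT g t) z + g 1 - ε < termRate g t z (α j)) ∧
      ∀ i j, i < j → termRate g t z (α i) < termRate g t z (α j) := by
  obtain ⟨m, hm, hval⟩ := hg.exists_isUniqueMaximizer_termRate hL ht htL hz
  rw [← hval]
  set φ := termRate g t z with hφ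
  have hc := hg.continuousOn_termRate ht z
  -- The maximizer may be an endpoint of `[0, 1]`, so a nearby interior point is chosen on an
  -- available side.
  have hx : ∃ x ∈ Ioo (0 : ℝ) 1, x ≠ m ∧ φ m - ε < φ x := by
    have h1 : ∀ᶠ x in 𝓝[Icc 0 1] m, φ m - ε < φ x :=
      (hc m hm.1).eventually_const_lt (by linarith)
    obtain ⟨δ, hδ, H⟩ := Metric.mem_nhdsWithin_iff.1 h1
    rcases lt_or_ge m 1 with h | h
    · set x := m + min (δ / 2) ((1 - m) / 2) with hxdef
      have p0 : 0 < min (δ / 2) ((1 - m) / 2) := lt_min (by linarith) (by linarith)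
      have p1 := min_le_left (δ / 2) ((1 - m) / 2)
      have p2 := min_le_right (δ / 2) ((1 - m) / 2)
      have p3 := hm.1.1
      have hxI : x ∈ Ioo (0 : ℝ) 1 := ⟨by linarith, by linarith⟩
      refine ⟨x, hxI, by linarith, H ⟨?_, Ioo_subset_Icc_self hxI⟩⟩
      rw [Metric.mem_ball, Real.dist_eq, hxdef, add_sub_cancel_left, abs_of_pos p0]
      linarith
    · set x := m - min (δ / 2) (1 / 2) with hxdef
      have p0 : 0 < min (δ / 2) (1 / 2) := lt_min (by linarith) (by norm_num)
      have p1 := min_le_left (δ / 2) (1 / 2)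
      have p2 := min_le_right (δ / 2) (1 / 2)
      have p3 := hm.1.2
      have hxI : x ∈ Ioo (0 : ℝ) 1 := ⟨by linarith, by linarith⟩
      refine ⟨x, hxI, by linarith, H ⟨?_, Ioo_subset_Icc_self hxI⟩⟩
      rw [Metric.mem_ball, Real.dist_eq, hxdef, sub_sub_cancel_left, abs_neg, abs_of_pos p0]
      linarith
  obtain ⟨x, hxI, hxm, hxε⟩ := hx
  have hlt : φ x < φ m := hm.2 x (Ioo_subset_Icc_self hxI) hxm
  -- Values increasing strictly from above `φ x` towards `φ m`; the intermediate value theorem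
  -- realises each as a rate.
  set v : ℕ → ℝ := fun j => φ m - (φ m - φ x) / (j + 2) with hv
  have hsub : uIcc x m ⊆ Icc (0 : ℝ) 1 :=
    OrdConnected.uIcc_subset inferInstance (Ioo_subset_Icc_self hxI) hm.1
  have hvx : ∀ j, φ x < v j ∧ v j < φ m := fun j => by
    have h0 : 0 < φ m - φ x := sub_pos.2 hlt
    have h1 : (φ m - φ x) / (j + 2) < φ m - φ x := by
      rw [div_lt_iff₀ (by positivity)]
      nlinarith [(Nat.cast_nonneg j : (0 : ℝ) ≤ j)]
    have h2 : 0 < (φ m - φ x) / (j + 2) := by positivity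
    exact ⟨by simp only [hv]; linarith, by simp only [hv]; linarith⟩
  have hivt : ∀ j, ∃ y ∈ uIcc x m, φ y = v j := fun j => by
    have := intermediate_value_uIcc (hc.mono hsub)
      (mem_uIcc.2 (Or.inl ⟨(hvx j).1.le, (hvx j).2.le⟩) : v j ∈ uIcc (φ x) (φ m))
    exact this
  choose α hα hαv using hivt
  refine ⟨α, fun j => ?_, fun j => ?_, fun i j hij => ?_⟩
  · have hne1 : α j ≠ x := fun h => by
      have := hαv j
      rw [h] at this
      exact (hvx j).1.ne this
    have hne2 : α j ≠ m := fun h => by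
      have := hαv j
      rw [h] at this
      exact (hvx j).2.ne' this
    have hm01 := hm.1
    rcases mem_uIcc.1 (hα j) with h | h
    · exact ⟨hxI.1.trans_le h.1, (h.2.lt_of_ne hne2).trans_le hm01.2⟩
    · exact ⟨hm01.1.trans_lt (h.1.lt_of_ne' hne2), h.2.trans_lt hxI.2⟩
  · rw [hαv]
    linarith [(hvx j).1]
  · rw [hαv, hαv]
    simp only [hv]
    have h0 : 0 < φ m - φ x := sub_pos.2 hlt
    have : (i : ℝ) < j := by exact_mod_cast hij
    gcongr

end IsProfile

/-! ### Exponential size of the coefficients and of the random sum -/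

theorem eventually_mul_sq_le_exp (C : ℝ) {θ : ℝ} (hθ : 0 < θ) :
    ∀ᶠ n : ℕ in atTop, C * ((n : ℝ) + 1) ^ 2 ≤ Real.exp (n * θ) := by
  have h1 : Tendsto (fun n : ℕ => Real.exp (n * θ) / (n * θ) ^ 2) atTop atTop :=
    (Real.tendsto_exp_div_pow_atTop 2).comp
      (tendsto_natCast_atTop_atTop.atTop_mul_const hθ)
  filter_upwards [h1.eventually_ge_atTop (4 * |C| / θ ^ 2), eventually_ge_atTop 1] with n hn hn1
  have hn1' : (1 : ℝ) ≤ n := by exact_mod_cast hn1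
  rw [le_div_iff₀ (by positivity)] at hn
  have e : 4 * |C| / θ ^ 2 * (n * θ) ^ 2 = |C| * (2 * n) ^ 2 := by field_simp; ring
  rw [e] at hn
  refine le_trans ?_ hn
  calc C * ((n : ℝ) + 1) ^ 2 ≤ |C| * ((n : ℝ) + 1) ^ 2 := by gcongr; exact le_abs_self C
    _ ≤ _ := by gcongr; linarith

theorem isLittleO_of_exp_bounds {E F : Type*} [SeminormedAddCommGroup E] [SeminormedAddCommGroup F]
    {u : ℕ → E} {v : ℕ → F} {x y : ℝ} (hxy : x < y)
    (hu : ∀ᶠ n : ℕ in atTop, ‖u n‖ ≤ Real.exp (n * x))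
    (hv : ∀ᶠ n : ℕ in atTop, Real.exp (n * y) ≤ ‖v n‖) : u =o[atTop] v := by
  refine Asymptotics.isLittleO_iff.2 fun c hc => ?_
  filter_upwards [hu, hv, eventually_mul_sq_le_exp c⁻¹ (sub_pos.2 hxy)] with n h1 h2 h3
  have h4 : c⁻¹ ≤ Real.exp (n * (y - x)) := by
    refine le_trans (le_mul_of_one_le_right (by positivity) ?_) h3
    exact one_le_pow₀ (by linarith [(Nat.cast_nonneg n : (0 : ℝ) ≤ n)])
  rw [inv_le_iff_one_le_mul₀' hc] at h4
  calc ‖u n‖ ≤ Real.exp (n * x) * 1 := by rw [mul_one]; exact h1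
    _ ≤ Real.exp (n * x) * (c * Real.exp (n * (y - x))) := by gcongr
    _ = c * Real.exp (n * y) := by
      rw [mul_left_comm, ← Real.exp_add]
      congr 2
      ring
    _ ≤ c * ‖v n‖ := by gcongr

theorem ExponentialProfile.eventually_norm_mem (ha : ExponentialProfile a g) {ε : ℝ}
    (hε : 0 < ε) : ∀ᶠ n : ℕ in atTop, ∀ k ≤ n,
      Real.exp (n * (g (k / n) - ε)) ≤ ‖a n k‖ ∧ ‖a n k‖ ≤ Real.exp (n * (g (k / n) + ε)) := by
  filter_upwards [ha.profile ε hε, eventually_gt_atTop 0] with n hn hn0 k hk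
  obtain ⟨h0, h1⟩ := hn k hk
  have hn0' : (0 : ℝ) < n := by exact_mod_cast hn0
  have hpos : 0 < ‖a n k‖ := norm_pos_iff.2 h0
  rw [abs_le, one_div, inv_mul_eq_div] at h1
  have e : Real.log ‖a n k‖ = n * (Real.log ‖a n k‖ / n) := by field_simp
  rw [← Real.le_log_iff_exp_le hpos, ← Real.log_le_iff_le_exp hpos, e]
  exact ⟨by gcongr; linarith [h1.1], by gcongr; linarith [h1.2]⟩

/-- The coefficient of the `k`-th random variable in the evolved polynomial at `z`. -/
noncomputable def evolvedCoeff (a : ℕ → ℕ → ℂ) (t : ℝ) (z : ℂ) (n k : ℕ) : ℂ :=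
  a n k * (hermiteFlow ((t : ℂ) / n) k).eval z

theorem norm_outerRoot_lt (ht : 0 ≤ t) {z : ℂ} (hz : z.im ≠ 0) {α : ℝ} (hα : 0 < α) :
    ‖z - outerRoot (t * α) z‖ < ‖outerRoot (t * α) z‖ := by
  have h := outerRoot_spec (t * α) z
  rcases ht.eq_or_lt with rfl | ht
  · rw [zero_mul] at h ⊢
    rw [h.eq_of_zero, sub_self, norm_zero, norm_pos_iff]
    rintro rfl
    exact hz rfl
  · exact h.2.lt_of_ne fun he => hz ((h.norm_eq_iff (mul_pos ht hα)).1 he).1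

/-- The factor `n + 1` pays in advance for the number of terms in the sum. -/
theorem ExponentialProfile.eventually_evolvedCoeff_le (ha : ExponentialProfile a g)
    (ht : 0 ≤ t) {θ : ℝ} (hθ : 0 < θ) :
    ∀ᶠ n : ℕ in atTop, ∀ k ≤ n, ∀ z : ℂ, (0 < t ∨ z ≠ 0) →
      ((n : ℝ) + 1) * ‖evolvedCoeff a t z n k‖ ≤ Real.exp (n * (termRate g t z (k / n) + θ)) := by
  filter_upwards [ha.eventually_norm_mem (half_pos hθ),
    eventually_mul_sq_le_exp (Real.exp 1) (half_pos hθ), eventually_gt_atTop 0]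
    with n h1 h2 h3 k hk z hz
  have hH := norm_eval_hermiteFlow_le ht h3.ne' hz (outerRoot_spec (t * (k / n)) z) (k := k)
  have hk' : (k : ℝ) ≤ n := by exact_mod_cast hk
  rw [evolvedCoeff, norm_mul]
  calc ((n : ℝ) + 1) * (‖a n k‖ * ‖(hermiteFlow ((t : ℂ) / n) k).eval z‖)
      ≤ ((n : ℝ) + 1) * (Real.exp (n * (g (k / n) + θ / 2))
        * (Real.exp 1 * (n + 1) * Real.exp (n * rate (k / n) z (outerRoot (t * (k / n)) z)))) := by
        gcongr
        · exact (h1 k hk).2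
        · exact hH.trans (by gcongr)
    _ = (Real.exp 1 * ((n : ℝ) + 1) ^ 2) * (Real.exp (n * (g (k / n) + θ / 2))
        * Real.exp (n * rate (k / n) z (outerRoot (t * (k / n)) z))) := by ring
    _ ≤ Real.exp (n * (θ / 2)) * (Real.exp (n * (g (k / n) + θ / 2))
        * Real.exp (n * rate (k / n) z (outerRoot (t * (k / n)) z))) := by gcongr
    _ = _ := by
      rw [← Real.exp_add, ← Real.exp_add, termRate]
      congr 1
      ring

theorem IsProfile.eventually_evolvedCoeff_mem (hg : IsProfile g) (ha : ExponentialProfile a g)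
    (ht : 0 ≤ t) {z : ℂ} (hz : z.im ≠ 0) {α : ℝ} (hα : α ∈ Ioo (0 : ℝ) 1) {θ : ℝ} (hθ : 0 < θ) :
    ∀ᶠ n : ℕ in atTop,
      Real.exp (n * (termRate g t z α - θ)) ≤ ‖evolvedCoeff a t z n ⌊α * n⌋₊‖ ∧
      ‖evolvedCoeff a t z n ⌊α * n⌋₊‖ ≤ Real.exp (n * (termRate g t z α + θ)) := by
  have hz0 : z ≠ 0 := by
    rintro rfl
    exact hz rfl
  have hκ : Tendsto (fun n : ℕ => ((⌊α * n⌋₊ : ℕ) : ℝ) / n) atTop (𝓝 α) :=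
    (tendsto_nat_floor_mul_div_atTop hα.1.le).comp tendsto_natCast_atTop_atTop
  have hmem : Icc (0 : ℝ) 1 ∈ 𝓝 α := Icc_mem_nhds hα.1 hα.2
  have hg' : Tendsto (fun n : ℕ => g (((⌊α * n⌋₊ : ℕ) : ℝ) / n)) atTop (𝓝 (g α)) :=
    (hg.continuousOn.continuousAt hmem).tendsto.comp hκ
  have hφ : Tendsto (fun n : ℕ => termRate g t z (((⌊α * n⌋₊ : ℕ) : ℝ) / n)) atTop
      (𝓝 (termRate g t z α)) :=
    ((hg.continuousOn_termRate ht z).continuousAt hmem).tendsto.comp hκ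
  filter_upwards [ha.eventually_norm_mem (by positivity : 0 < θ / 3),
    ha.eventually_evolvedCoeff_le ht (half_pos hθ),
    eventually_le_norm_eval_hermiteFlow hα.1 (norm_outerRoot_lt ht hz hα.1) hκ
      (by positivity : 0 < θ / 3),
    hg'.eventually_const_lt (u := g α - θ / 3) (by linarith),
    hφ.eventually_lt_const (u := termRate g t z α + θ / 2) (by linarith)]
    with n h1 h2 h3 h4 h5
  have hle : ⌊α * n⌋₊ ≤ n := by
    refine Nat.floor_le_of_le ?_
    exact mul_le_of_le_one_left (Nat.cast_nonneg n) hα.2.le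
  have hn0 : (0 : ℝ) ≤ n := Nat.cast_nonneg n
  constructor
  · rw [evolvedCoeff, norm_mul]
    refine le_trans ?_ (mul_le_mul (h1 _ hle).1 h3 (Real.exp_pos _).le (norm_nonneg _))
    rw [← Real.exp_add, Real.exp_le_exp, ← mul_add, termRate]
    refine mul_le_mul_of_nonneg_left ?_ hn0
    linarith
  · have h6 := h2 _ hle z (Or.inr hz0)
    refine (le_mul_of_one_le_left (norm_nonneg _) (by linarith)).trans (h6.trans ?_)
    rw [Real.exp_le_exp]
    refine mul_le_mul_of_nonneg_left ?_ hn0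
    linarith

/-- The evolved random polynomial at time `t / n`. -/
noncomputable def evolvedPoly (x : ℕ → ℂ) (a : ℕ → ℕ → ℂ) (t : ℝ) (n : ℕ) : Polynomial ℂ :=
  heatFlow ((t : ℂ) / n) (randomPoly x a n)

theorem eval_evolvedPoly (x : ℕ → ℂ) (a : ℕ → ℕ → ℂ) (t : ℝ) (n : ℕ) (z : ℂ) :
    (evolvedPoly x a t n).eval z
      = ∑ k ∈ Finset.range (n + 1), evolvedCoeff a t z n k * x k :=
  heatFlow_randomPoly _ x a n z

theorem IsProfile.eventually_norm_eval_le (hg : IsProfile g) (hL : IsSlopeBound g L)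
    (ha : ExponentialProfile a g) (ht : 0 ≤ t) (htL : t * L < 1) {ε : ℝ} (hε : 0 < ε) :
    ∀ᶠ n : ℕ in atTop, ∀ x : ℕ → ℂ, (∀ k ≤ n, ‖x k‖ ≤ Real.exp (ε / 2 * n)) → ∀ z : ℂ,
      ‖(evolvedPoly x a t n).eval z‖
        ≤ Real.exp (n * (logPotential (nuT g t) z + g 1 + ε)) := by
  obtain ⟨C, R, hν⟩ := hg.isBoundedDensity_nuT hL ht htL
  filter_upwards [ha.eventually_evolvedCoeff_le ht (half_pos hε), eventually_gt_atTop 0]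
    with n hn hn0 x hx
  have hn0' : (0 : ℝ) < n := by exact_mod_cast hn0
  have hmain : ∀ z : ℂ, z ≠ 0 → ‖(evolvedPoly x a t n).eval z‖
      ≤ Real.exp (n * (logPotential (nuT g t) z + g 1 + ε)) := by
    intro z hz
    rw [eval_evolvedPoly]
    refine (norm_sum_le _ _).trans ?_
    have hterm : ∀ k ∈ Finset.range (n + 1), ‖evolvedCoeff a t z n k * x k‖
        ≤ ((n : ℝ) + 1)⁻¹ * Real.exp (n * (logPotential (nuT g t) z + g 1 + ε)) := by
      intro k hk
      have hk' : k ≤ n := Nat.lt_succ_iff.1 (Finset.mem_range.1 hk)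
      have h1 := hn k hk' z (Or.inr hz)
      have hkn : (k : ℝ) / n ∈ Icc (0 : ℝ) 1 :=
        ⟨by positivity, div_le_one_of_le₀ (by exact_mod_cast hk') hn0'.le⟩
      have h2 := hg.termRate_le hL ht htL (Or.inr hz : 0 < t ∨ z ≠ 0) hkn
      rw [← le_inv_mul_iff₀ (by positivity)] at h1
      rw [norm_mul]
      calc ‖evolvedCoeff a t z n k‖ * ‖x k‖
          ≤ (((n : ℝ) + 1)⁻¹ * Real.exp (n * (termRate g t z (k / n) + ε / 2)))
            * Real.exp (ε / 2 * n) := by gcongr; exact hx k hk'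
        _ = ((n : ℝ) + 1)⁻¹ * Real.exp (n * (termRate g t z (k / n) + ε)) := by
          rw [mul_assoc, ← Real.exp_add]
          congr 2
          ring
        _ ≤ _ := by gcongr
    refine (Finset.sum_le_sum hterm).trans (le_of_eq ?_)
    rw [Finset.sum_const, Finset.card_range, nsmul_eq_mul, ← mul_assoc]
    push_cast
    rw [mul_inv_cancel₀ (by positivity), one_mul]
  -- At time zero the term estimates exclude `z = 0`; both sides are continuous in `z`, so the bound
  -- extends there.
  have hclosed : IsClosed {z : ℂ | ‖(evolvedPoly x a t n).eval z‖
      ≤ Real.exp (n * (logPotential (nuT g t) z + g 1 + ε))} := by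
    have := hν.contDiff_logPotential.continuous
    exact isClosed_le (by fun_prop) (by fun_prop)
  have hdense : Dense {z : ℂ | z ≠ 0} := dense_compl_singleton 0
  intro z
  exact (hdense.mono hmain).closure_eq.symm.subset.trans hclosed.closure_subset (mem_univ z)

end Growth

/-! ### Convergence of the zeros -/

section Convergence

variable {Ω : Type*} [MeasurableSpace Ω] {P : Measure Ω} [IsProbabilityMeasure P]
  {ξ : ℕ → Ω → ℂ} {a : ℕ → ℕ → ℂ} {g : ℝ → ℝ} {t L : ℝ}

/-- The degrees `⌊α_j n⌋` from `exists_levels` have coefficients of strictly increasing exponential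
order, all larger than the threshold, so the anti-concentration bound applies. A non-real `z` avoids
the cut at every level, where lower bounds on Hermite polynomials could fail. -/
theorem IsProfile.tendsto_measure_norm_eval_lt (hg : IsProfile g) (hL : IsSlopeBound g L)
    (hξ : RandomCoeffs P ξ) (ha : ExponentialProfile a g) (ht : 0 ≤ t) (htL : t * L < 1) {z : ℂ}
    (hz : z.im ≠ 0) {ε : ℝ} (hε : 0 < ε) :
    Tendsto (fun n : ℕ => P {ω | ‖(evolvedPoly (fun k => ξ k ω) a t n).eval z‖
      < Real.exp (n * (logPotential (nuT g t) z + g 1 - ε))}) atTop (𝓝 0) := by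
  have hz0 : z ≠ 0 := by
    rintro rfl
    exact hz rfl
  obtain ⟨α, hα, hαε, hαlt⟩ := hg.exists_levels hL ht htL (Or.inr hz0 : 0 < t ∨ z ≠ 0) hε
  set S := logPotential (nuT g t) z + g 1 with hS
  have hb := fun j θ (hθ : 0 < θ) => hg.eventually_evolvedCoeff_mem ha ht hz (hα j) hθ
  have h0 : ∀ j, ∀ᶠ n : ℕ in atTop, evolvedCoeff a t z n ⌊α j * n⌋₊ ≠ 0 := fun j => by
    filter_upwards [hb j 1 one_pos] with n hn
    exact norm_pos_iff.1 ((Real.exp_pos _).trans_le hn.1)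
  have h1 : ∀ i j, i < j → (fun n : ℕ => evolvedCoeff a t z n ⌊α i * n⌋₊)
      =o[atTop] fun n : ℕ => evolvedCoeff a t z n ⌊α j * n⌋₊ := by
    intro i j hij
    have hgap := hαlt i j hij
    have hθ : 0 < (termRate g t z (α j) - termRate g t z (α i)) / 4 := by linarith
    refine isLittleO_of_exp_bounds
      (x := termRate g t z (α i) + (termRate g t z (α j) - termRate g t z (α i)) / 4)
      (y := termRate g t z (α j) - (termRate g t z (α j) - termRate g t z (α i)) / 4)
      (by linarith) ((hb i _ hθ).mono fun n hn => hn.2) ((hb j _ hθ).mono fun n hn => hn.1)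
  have h2 : ∀ j, (fun n : ℕ => Real.exp (n * (S - ε)))
      =o[atTop] fun n : ℕ => evolvedCoeff a t z n ⌊α j * n⌋₊ := by
    intro j
    have hgap := hαε j
    have hθ : 0 < (termRate g t z (α j) - (S - ε)) / 2 := by linarith
    refine isLittleO_of_exp_bounds (x := S - ε)
      (y := termRate g t z (α j) - (termRate g t z (α j) - (S - ε)) / 2) (by linarith)
      (Eventually.of_forall fun n => ?_) ((hb j _ hθ).mono fun n hn => hn.1)
    rw [Real.norm_eq_abs, abs_of_pos (Real.exp_pos _)]
  have h3 := hξ.tendsto_measure_norm_partialSum_le (b := evolvedCoeff a t z)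
    (κ := fun j n => ⌊α j * n⌋₊) h0 h1 h2 fun j n =>
      Nat.floor_le_of_le (mul_le_of_le_one_left (Nat.cast_nonneg n) (hα j).2.le)
  refine tendsto_of_tendsto_of_tendsto_of_le_of_le tendsto_const_nhds h3 (fun _ => zero_le)
    fun n => measure_mono fun ω hω => ?_
  have hω' : ‖(evolvedPoly (fun k => ξ k ω) a t n).eval z‖ < Real.exp (n * (S - ε)) := hω
  rw [eval_evolvedPoly] at hω'
  exact hω'.le

/-- The upper bound holds at all points simultaneously once the coefficients are subexponential; the
lower bound is needed only on a finite set and follows by a union bound. -/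
theorem IsProfile.tendsto_measure_not_growthClose (hg : IsProfile g) (hL : IsSlopeBound g L)
    (hξ : RandomCoeffs P ξ) (ha : ExponentialProfile a g) (ht : 0 ≤ t) (htL : t * L < 1)
    {Z : Set ℂ} (hZ : Z.Finite) (hZim : ∀ z ∈ Z, z.im ≠ 0) {ε : ℝ} (hε : 0 < ε) :
    Tendsto (fun n : ℕ => P {ω | ¬ GrowthClose (nuT g t) (g 1) ε Z n
      (evolvedPoly (fun k => ξ k ω) a t n)}) atTop (𝓝 0) := by
  have t1 := hξ.tendsto_measure_exists_lt (half_pos hε)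
  have t2 : Tendsto (fun n : ℕ => ∑ z ∈ hZ.toFinset,
      P {ω | ‖(evolvedPoly (fun k => ξ k ω) a t n).eval z‖
        < Real.exp (n * (logPotential (nuT g t) z + g 1 - ε))}) atTop (𝓝 0) := by
    have := tendsto_finsetSum hZ.toFinset fun z hz =>
      hg.tendsto_measure_norm_eval_lt hL hξ ha ht htL (hZim z (hZ.mem_toFinset.1 hz)) hε
    simpa using this
  have t3 := t1.add t2
  rw [add_zero] at t3
  refine tendsto_of_tendsto_of_tendsto_of_le_of_le' tendsto_const_nhds t3
    (Eventually.of_forall fun _ => zero_le) ?_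
  filter_upwards [hg.eventually_norm_eval_le hL ha ht htL hε] with n hn
  refine le_trans (measure_mono fun ω hω => ?_) ((measure_union_le _ _).trans
    (add_le_add_right (measure_biUnion_finset_le _ _) _))
  by_contra hcon
  rw [mem_union, not_or] at hcon
  refine hω ⟨?_, ?_, fun z hz => ?_⟩
  · exact (natDegree_heatFlow_le _ _).trans (natDegree_randomPoly_le _ _ _)
  · refine hn _ fun k hk => ?_
    by_contra hlt
    exact hcon.1 ⟨k, hk, not_le.1 hlt⟩
  · by_contra hlt
    exact hcon.2 (mem_iUnion₂.2 ⟨z, hZ.mem_toFinset.2 hz, not_le.1 hlt⟩)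

theorem dense_im_ne_zero : Dense {z : ℂ | z.im ≠ 0} := by
  refine Metric.dense_iff.2 fun z r hr => ?_
  by_cases hz : z.im = 0
  · refine ⟨z + ((r / 2 : ℝ) : ℂ) * Complex.I, ?_, ?_⟩
    · rw [Metric.mem_ball, dist_eq_norm, add_sub_cancel_left, norm_mul, Complex.norm_I, mul_one,
        Complex.norm_real, Real.norm_eq_abs, abs_of_pos (half_pos hr)]
      exact half_lt_self hr
    · change (z + ((r / 2 : ℝ) : ℂ) * Complex.I).im ≠ 0
      rw [Complex.add_im, hz, Complex.im_ofReal_mul, Complex.I_im]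
      simpa using hr.ne'
  · exact ⟨z, Metric.mem_ball_self hr, hz⟩

theorem IsProfile.tendstoWeaklyInProbability_zeroMeasure (hg : IsProfile g)
    (hL : IsSlopeBound g L) (hξ : RandomCoeffs P ξ) (ha : ExponentialProfile a g) (ht : 0 ≤ t)
    (htL : t * L < 1) :
    TendstoWeaklyInProbability P
      (fun n ω => zeroMeasure (evolvedPoly (fun k => ξ k ω) a t n)) (nuT g t) := by
  intro f
  refine tendstoInMeasure_of_ne_top fun ε₀ hε₀ hε₀top => ?_
  obtain ⟨C, R, hν⟩ := hg.isBoundedDensity_nuT hL ht htL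
  have hη : 0 < ε₀.toReal / 2 := half_pos (ENNReal.toReal_pos hε₀.ne' hε₀top)
  obtain ⟨ε, hε, Z, hZA, hZ, H⟩ := hν.exists_zeroMeasure_close (g 1) dense_im_ne_zero f hη
  refine tendsto_of_tendsto_of_tendsto_of_le_of_le' tendsto_const_nhds
    (hg.tendsto_measure_not_growthClose hL hξ ha ht htL hZ (fun z hz => hZA hz) hε)
    (Eventually.of_forall fun _ => zero_le) ?_
  filter_upwards [eventually_ne_atTop 0] with n hn
  refine measure_mono fun ω hω hclose => ?_
  have h1 := H n _ hn hclose
  have h2 : ε₀ ≤ edist (∫ z, f z ∂(zeroMeasure (evolvedPoly (fun k => ξ k ω) a t n)))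
    (∫ z, f z ∂(nuT g t)) := hω
  rw [edist_dist, Real.dist_eq] at h2
  have h3 := (ENNReal.le_ofReal_iff_toReal_le hε₀top (abs_nonneg _)).1 h2
  linarith

end Convergence

end HeatFlowZeros

/-! ### The main theorem -/

open HeatFlowZeros

theorem theorem3p3 {Ω : Type*} [MeasurableSpace Ω] (P : Measure Ω) [IsProbabilityMeasure P]
    (ξ : ℕ → Ω → ℂ) (a : ℕ → ℕ → ℂ) (g : ℝ → ℝ)
    (hA1 : RandomCoeffs P ξ) (hA2 : ExponentialProfile a g) (hA3 : SmoothProfile g)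
    (t : ℝ) (ht : 0 < t) (htsing : ENNReal.ofReal t < tSing g) :
    ∃ ν₀ νₜ : Measure ℂ, IsProbabilityMeasure ν₀ ∧ IsProbabilityMeasure νₜ ∧
      -- `ν₀` and `νₜ` are the limiting zero distributions at times `0` and `t`
      TendstoWeaklyInProbability P
        (fun n ω => zeroMeasure (randomPoly (fun k => ξ k ω) a n)) ν₀ ∧
      TendstoWeaklyInProbability P (fun n ω => evolvedZeros (fun k => ξ k ω) a t n) νₜ ∧
      -- (a) push-forward
      AEMeasurable (transport g t) ν₀ ∧
      Measure.map (transport g t) ν₀ = νₜ ∧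
      νₜ (domain g t)ᶜ = 0 ∧
      (∀ s : ℝ, 0 < s → νₜ (ellipse g s t) = ENNReal.ofReal (alphaZero g (s : ℂ))) ∧
      -- (b) bounded density
      (∃ p : ℂ → ℝ, Measurable p ∧ (∃ C : ℝ, ∀ z, 0 ≤ p z ∧ p z ≤ C) ∧
        νₜ = volume.withDensity (fun z => ENNReal.ofReal (p z))) ∧
      -- (c) Stieltjes transform
      (∀ z : ℂ, Integrable (fun y => 1 / (z - y)) νₜ) ∧
      Continuous (stieltjes νₜ) ∧
      (∀ w : ℂ, w ≠ 0 →
        Integrable (fun y => 1 / (w - y)) ν₀ ∧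
        stieltjes νₜ (transport g t w) = stieltjes ν₀ w ∧
        stieltjes ν₀ w = (alphaZero g w : ℂ) / w ∧
        HasDerivAt (fun τ : ℝ => transport g τ w) ((alphaZero g w : ℂ) / w) t) ∧
      -- (d) maximisers
      (∀ z ∈ domain g t, alphaT g t z ∈ Ioo (0 : ℝ) 1 ∧
        IsUniqueMaximizer (fun α => fT g t α z) (alphaT g t z)) ∧
      (∀ w : ℂ, IsUniqueMaximizer (fun α => fT g t α (transport g t w)) (alphaZero g w) ∧
        alphaT g t (transport g t w) = alphaZero g w) ∧
      -- (e) logarithmic potentials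
      (∀ w : ℂ, w ≠ 0 → HasLogPotentialAt ν₀ (UZero g w) w) ∧
      (∀ z : ℂ, HasLogPotentialAt νₜ (UT g t z) z) ∧
      ContDiff ℝ 1 (UT g t) ∧
      (∀ w : ℂ, w ≠ 0 → UT g t (transport g t w)
        = UZero g w + (alphaZero g w) ^ 2 / 2 * ((t : ℂ) / w ^ 2).re) := by
  have hg : IsProfile g := ⟨hA2.continuousOn, hA2.concaveOn, hA2.leftDeriv_one, hA3⟩
  obtain ⟨L, hL, htL⟩ := exists_isSlopeBound ht htsing
  have h0 := hg.isBoundedDensity_nuZero hL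
  obtain ⟨C, R, hν⟩ := hg.isBoundedDensity_nuT hL ht.le htL
  have hT0 : ∀ w, transport g 0 w = w := fun w => by simp [transport]
  have hst0 : ∀ w : ℂ, w ≠ 0 → stieltjes (nuZero g) w = (alphaZero g w : ℂ) / w := by
    intro w hw
    have h := hg.stieltjes_nuT hL le_rfl (by simp) hw
    rwa [nuT_zero, hT0] at h
  have hUT : logPotential (nuT g t) = UT g t := funext (hg.logPotential_nuT_eq_UT hL ht htL)
  refine ⟨nuZero g, nuT g t, inferInstance, hν.prob, ?_, ?_,
    (hg.continuous_transport hL).measurable.aemeasurable, rfl,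
    hg.nuT_domain_compl hL ht.le htL, fun s hs => hg.nuT_ellipse hL ht.le htL hs,
    hν.exists_density, hν.integrable_cauchy, hν.continuous_stieltjes, ?_, ?_, ?_, ?_, ?_, ?_, ?_⟩
  -- Time zero is the case `t = 0` of the same convergence statement.
  · have h := hg.tendstoWeaklyInProbability_zeroMeasure hL hA1 hA2 le_rfl (by simp)
    simpa only [evolvedPoly, Complex.ofReal_zero, zero_div, heatFlow_zero_left, nuT_zero] using h
  · exact hg.tendstoWeaklyInProbability_zeroMeasure hL hA1 hA2 ht.le htL
  · intro w hw
    refine ⟨h0.integrable_cauchy w, ?_, hst0 w hw, ?_⟩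
    · rw [hg.stieltjes_nuT hL ht.le htL hw, hst0 w hw]
    · have h := ((Complex.ofRealCLM.hasDerivAt (x := t)).mul_const
        ((alphaZero g w : ℂ) / w)).const_add w
      refine h.congr_deriv ?_
      simp
  · intro z hz
    obtain ⟨w, rfl⟩ := hg.surjective_transport hL ht.le htL z
    rw [hg.alphaT_transport hL ht htL]
    exact ⟨hg.alphaZero_mem_Ioo ((hg.transport_mem_domain_iff hL ht.le htL).1 hz),
      hg.isUniqueMaximizer_fT hL ht htL w⟩
  · exact fun w => ⟨hg.isUniqueMaximizer_fT hL ht htL w, hg.alphaT_transport hL ht htL w⟩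
  · exact fun w hw => ⟨h0.integrable_log w, hg.logPotential_nuZero hL hw⟩
  · exact fun z => ⟨hν.integrable_log z, hg.logPotential_nuT_eq_UT hL ht htL z⟩
  -- Smoothness is inherited from the potential of a measure with bounded density, not from the
  -- supremum.
  · rw [← hUT]
    exact hν.contDiff_logPotential
  · intro w hw
    rw [hg.UT_transport hL ht htL, hg.UZero_eq hw, IsProfile.rate_transport]
    ring
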